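/- For $A\in\mathbb Z^{2\times n}$ with $n>2$ write $A=(B\,|\,N)$, where $B\in\mathbb Z^{2\times 2}$ consists of the first two columns and $N\in\mathbb Z^{2\times(n-2)}$ of the remaining ones. Let $\gcd(A)$ be the greatest common divisor of all $2\times 2$ subdeterminants of $A$, let $l_B$ and $l_N$ be the Euclidean lengths of the longest columns of $B$ and $N$, let $\mathcal C_M$ be the cone of all nonnegative real linear combinations of the columns of a matrix $M$, and let $\boldsymbol v$ be the sum of the columns of $A$. There exists a polynomial-time algorithm which, given as input any $n>2$, $A=(B\,|\,N)\in\mathbb Z^{2\times n}$ and $\boldsymbol b\in\mathbb Z^2$ such that 1. $B$ is nonsingular and $\mathcal C_B=\mathcal C_A$, 2. $\gcd(A)=1$, 3. $\{\boldsymbol x\in\mathbb R^n_{\ge 0}: A\boldsymbol x=\boldsymbol 0\}=\{\boldsymbol 0\}$, and 4. $\boldsymbol b\in \frac{l_Bl_N}{|\det(B)|}\,(|\det(B)|-1)\,\boldsymbol v+\mathcal C_A$, computes a vector $\boldsymbol x\in\mathbb Z^n_{\ge 0}$ with $A\boldsymbol x=\boldsymbol b$. Here polynomial time means: by a Turing machine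 (with finitely many stacks as memory) whose number of steps is bounded by one fixed polynomial in the length of the input, all integers being written in binary; the number $n$ of columns is part of the input. -/

import Mathlib

open scoped Pointwise Matrix

/-- Input data `(A, b)` of the linear Diophantine problem `A x = b`, `x ≥ 0` integer, where `A` is
an integer `m × n` matrix with `m < n`. We write `n = m + k`, so that `A = (B | N)` with `B` the
first `m` and `N` the last `k` columns. -/
structure KnapsackInput (m : ℕ) where
  /-- the number of columns of `N` -/
  k : ℕ
  k_pos : 0 < k
  /-- the coefficient matrix -/
  A : Matrix (Fin m) (Fin (m + k)) ℤ
  /-- the right-hand side -/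
  b : Fin m → ℤ

namespace KnapsackInput

variable {m : ℕ}

/-- The block `B` of `A = (B | N)`. -/
def B (I : KnapsackInput m) : Matrix (Fin m) (Fin m) ℤ := I.A.submatrix id (Fin.castAdd I.k)

/-- The block `N` of `A = (B | N)`. -/
def N (I : KnapsackInput m) : Matrix (Fin m) (Fin I.k) ℤ := I.A.submatrix id (Fin.natAdd m)

end KnapsackInput

/-- An integer matrix, viewed as a real matrix. -/
def realMatrix {m n : ℕ} (M : Matrix (Fin m) (Fin n) ℤ) : Matrix (Fin m) (Fin n) ℝ :=
  M.map fun z => (z : ℝ)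

/-- The cone `C_M` of all nonnegative real combinations of the columns of `M`. -/
def columnCone {m n : ℕ} (M : Matrix (Fin m) (Fin n) ℤ) : Set (Fin m → ℝ) :=
  {y | ∃ c : Fin n → ℝ, 0 ≤ c ∧ y = realMatrix M *ᵥ c}

/-- The Euclidean length of the longest column of `M` (a matrix with at least one column). -/
noncomputable def maxColumnLength {m n : ℕ} (M : Matrix (Fin m) (Fin n) ℤ) : ℝ :=
  ⨆ j : Fin n, ‖WithLp.toLp 2 ((realMatrix M)ᵀ j)‖

/-- The sum of the columns of `M`, as a real vector. -/
def columnSum {m n : ℕ} (M : Matrix (Fin m) (Fin n) ℤ) : Fin m → ℝ :=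
  ∑ j : Fin n, (realMatrix M)ᵀ j

/-- `gcd(M)`: the (nonnegative) greatest common divisor of all `m × m` subdeterminants of the
`m × n` matrix `M`. -/
noncomputable def subdetGcd {m n : ℕ} (M : Matrix (Fin m) (Fin n) ℤ) : ℤ :=
  (Finset.univ : Finset (Fin m ↪ Fin n)).gcd fun s => (M.submatrix id s).det

/-- The four-letter alphabet in which inputs and outputs of algorithms are written. -/
inductive Letter : Type
  | zero
  | one
  | minus
  | endMark

/-- An integer in binary (least significant digit first), with a leading minus sign if it is
negative, and closed by an end mark. -/
def writeInt (z : ℤ) : List Letter :=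
  (if z < 0 then [Letter.minus] else []) ++
    (Computability.encodeNat z.natAbs).map (fun d => if d then Letter.one else Letter.zero) ++
    [Letter.endMark]

/-- A finite sequence of integers, written one after the other. -/
def writeInts (l : List ℤ) : List Letter := l.flatMap writeInt

/-- The input `(A, b)` as a word: the entries of `b`, then those of `A`, column by column. -/
def writeInput {m : ℕ} (I : KnapsackInput m) : List Letter :=
  writeInts (List.ofFn I.b ++ (List.ofFn fun j => List.ofFn fun i => I.A i j).flatten)

/-- A vector of integers of arbitrary length as a word. -/
def writeOutput (x : Σ n : ℕ, Fin n → ℤ) : List Letter := writeInts (List.ofFn x.2)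

/-- The search problem "given an instance `a` with property `P`, find some `x` with `R a x`" is
solvable in polynomial time: a Turing machine, started on the word of any instance `a` with
property `P`, halts after a number of steps bounded by a polynomial in the length of that word, with
the word of some `x` such that `R a x` as its output. -/
def SolvableInPolyTime {α β Γ Δ : Type} (wIn : α → List Γ) (wOut : β → List Δ)
    (P : α → Prop) (R : α → β → Prop) : Prop :=
  ∃ f : {a : α // P a} → β,
    Nonempty (Turing.TM2ComputableInPolyTime (fun a : {a : α // P a} => wIn a.1) wOut f) ∧
      ∀ a : {a : α // P a}, R a.1 (f a)

/-! Let `u`, `w` be the columns of `B` and `d = |det B|`. The map `y ↦ ±(det(y, w), det(u, y))`,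
with the sign of `det(u, w)`, gives the coordinates of `y` with respect to `u`, `w`, multiplied by
`d` (`coordHom`). It is injective and sends `u`, `w` to `(d, 0)`, `(0, d)`. As `C_B = C_A`, it sends
all columns of `A` to nonnegative vectors, and the columns of `N` get coordinates at most `m = ⌊l_B
l_N⌋`, since a determinant is at most the product of the lengths. Both coordinates of `b` are at
least `l_B l_N (d - 1)`: evaluate the two coordinate functionals on the condition that `b` lies deep
in the cone (`coordHom_bounds`).

Let `Λ_j` be the lattice generated by `dℤ²` and the images `z_1, ..., z_j` of the first `j` columns
of `N`. As `gcd(A) = 1`, the columns of `A` generate `ℤ²` (`eq_top_of_subdetGcd`), so the last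
lattice of the chain is the image of `ℤ²`. It has determinant `d`, hence the indices `p_j = [Λ_j :
Λ_{j-1}]` have product `d`. Every vector of `Λ_j` falls into `Λ_{j-1}` after subtraction of `x_j
z_j` for some `0 ≤ x_j < p_j` (`extend_spec`, `forward_spec`). Going down the chain from the image
of `b` ends in `dℤ²`. Since `∑ x_j ≤ ∑ (p_j - 1) ≤ ∏ p_j - 1 = d - 1`, at most `m (d - 1)` is
subtracted from either coordinate, so the rest is nonnegative and gives the coefficients of `u` and
`w` (`backward_spec`, `solveVectors_spec`).

Each `Λ_j` is kept as a triangular basis computed by the Euclidean algorithm; the remaining entries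
are reduced modulo `d`, so that numbers do not grow along the chain (`small_extend`). For the
machine model, structured programs on stacks are compiled to Turing machines (`Exec.reach`), and
data are binary trees in prefix code. The class `PolyTime` is closed under composition, pairing,
case distinction, and folds with polynomially bounded intermediate values (`PolyTime.foldl`); binary
arithmetic and the algorithm are built from these. -/

/-! ### Structured programs on stacks and their compilation to Turing machines -/

namespace StackMachine

/-- The six stacks of our machines. -/
inductive Stk : Type
  | inp
  | out
  | x
  | y
  | z
  | c
  deriving DecidableEq

instance : Fintype Stk :=
  ⟨{.inp, .out, .x, .y, .z, .c}, fun k => by cases k <;> decide⟩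

/-- Structured programs; the internal state is the letter read last. -/
inductive Prog : Type
  | push (k : Stk) (f : Option Letter → Letter)
  | pop (k : Stk)
  | peek (k : Stk)
  | load (f : Option Letter → Option Letter)
  | seq (p q : Prog)
  | ite (f : Option Letter → Bool) (p q : Prog)
  | loop (f : Option Letter → Bool) (p : Prog)

/-- A memory state: the internal state and the contents of the stacks. -/
structure Mem : Type where
  v : Option Letter
  inp : List Letter
  out : List Letter
  x : List Letter
  y : List Letter
  z : List Letter
  c : List Letter

namespace Mem

/-- The contents of a stack. -/
def get (s : Mem) : Stk → List Letter
  | .inp => s.inp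
  | .out => s.out
  | .x => s.x
  | .y => s.y
  | .z => s.z
  | .c => s.c

/-- Replace the contents of a stack. -/
def set (s : Mem) : Stk → List Letter → Mem
  | .inp, l => { s with inp := l }
  | .out, l => { s with out := l }
  | .x, l => { s with x := l }
  | .y, l => { s with y := l }
  | .z, l => { s with z := l }
  | .c, l => { s with c := l }

/-- Replace the internal state. -/
def setV (s : Mem) (v : Option Letter) : Mem := { s with v := v }

theorem get_set (s : Mem) (k : Stk) (l : List Letter) :
    (s.set k l).get = Function.update s.get k l := by
  funext k'
  cases k <;> cases k' <;> rfl

theorem set_v (s : Mem) (k : Stk) (l : List Letter) : (s.set k l).v = s.v := by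
  cases k <;> rfl

theorem length_x_set_le (s : Mem) (k : Stk) (l : List Letter) (n : ℕ)
    (h : l.length ≤ (s.get k).length + n) : (s.set k l).x.length ≤ s.x.length + n := by
  cases k <;> first | exact h | exact Nat.le_add_right _ _

end Mem

/-! ### Timed semantics of programs. -/

/-- `Exec p s s' t`: started in `s`, the program `p` ends in `s'` within time `t`. -/
inductive Exec : Prog → Mem → Mem → ℕ → Prop
  | push (k f s) : Exec (.push k f) s (s.set k (f s.v :: s.get k)) 1
  | pop (k s) : Exec (.pop k) s ((s.set k (s.get k).tail).setV (s.get k).head?) 1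
  | peek (k s) : Exec (.peek k) s (s.setV (s.get k).head?) 1
  | load (f s) : Exec (.load f) s (s.setV (f s.v)) 1
  | seq {p q s₁ s₂ s₃ t₁ t₂} : Exec p s₁ s₂ t₁ → Exec q s₂ s₃ t₂ →
      Exec (.seq p q) s₁ s₃ (t₁ + t₂)
  | ite_true {f p q s s' t} : f s.v = true → Exec p s s' t → Exec (.ite f p q) s s' (t + 1)
  | ite_false {f p q s s' t} : f s.v = false → Exec q s s' t → Exec (.ite f p q) s s' (t + 1)
  | loop_true {f p s₁ s₂ s₃ t₁ t₂} : f s₁.v = true → Exec p s₁ s₂ t₁ →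
      Exec (.loop f p) s₂ s₃ t₂ → Exec (.loop f p) s₁ s₃ (t₁ + t₂ + 1)
  | loop_false {f p s} : f s.v = false → Exec (.loop f p) s s 1
  | mono {p s s' t t'} : Exec p s s' t → t ≤ t' → Exec p s s' t'

/-- An instruction pushes at most one letter. Hence the running time bounds the size of the result,
which `PolyTime.bound` needs for composing programs. -/
theorem Exec.length_x_le {p : Prog} {s s' : Mem} {t : ℕ} (h : Exec p s s' t) :
    s'.x.length ≤ s.x.length + t := by
  induction h with
  | push k f s => exact Mem.length_x_set_le _ _ _ _ (by simp)
  | pop k s => exact Mem.length_x_set_le _ _ _ _ (by simp; omega)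
  | peek k s => exact Nat.le_add_right _ _
  | load f s => exact Nat.le_add_right _ _
  | seq _ _ h₁ h₂ => omega
  | ite_true _ _ h => omega
  | ite_false _ _ h => omega
  | loop_true _ _ _ h₁ h₂ => omega
  | loop_false _ => omega
  | mono _ _ h => omega

/-! ### Compilation to labelled machine statements. -/

/-- The labels of the compiled program. -/
def Lab : Prog → Type
  | .push _ _ => Unit
  | .pop _ => Unit
  | .peek _ => Unit
  | .load _ => Unit
  | .seq p q => Lab p ⊕ Lab q
  | .ite _ p q => Option (Lab p ⊕ Lab q)
  | .loop _ p => Option (Lab p)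

/-- There are finitely many labels. -/
@[reducible] noncomputable def labFintype : (p : Prog) → Fintype (Lab p)
  | .push _ _ => inferInstanceAs (Fintype Unit)
  | .pop _ => inferInstanceAs (Fintype Unit)
  | .peek _ => inferInstanceAs (Fintype Unit)
  | .load _ => inferInstanceAs (Fintype Unit)
  | .seq p q =>
    letI := labFintype p
    letI := labFintype q
    inferInstanceAs (Fintype (Lab p ⊕ Lab q))
  | .ite _ p q =>
    letI := labFintype p
    letI := labFintype q
    inferInstanceAs (Fintype (Option (Lab p ⊕ Lab q)))
  | .loop _ p =>
    letI := labFintype p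
    inferInstanceAs (Fintype (Option (Lab p)))

/-- The first label of the compiled program. -/
def entry : (p : Prog) → Lab p
  | .push _ _ => ()
  | .pop _ => ()
  | .peek _ => ()
  | .load _ => ()
  | .seq p _ => Sum.inl (entry p)
  | .ite _ _ _ => none
  | .loop _ _ => none

/-- Statements of the Turing machine. -/
abbrev MStmt (Λ : Type) : Type := Turing.TM2.Stmt (fun _ : Stk => Letter) Λ (Option Letter)

open Turing.TM2.Stmt in
/-- The compiled program, with labels embedded in `Λ` by `e`, that continues at `next`. -/
def code {Λ : Type} : (p : Prog) → (e : Lab p → Λ) → (next : Λ) → Lab p → MStmt Λ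
  | .push k f, _, next, _ => push k f (goto fun _ => next)
  | .pop k, _, next, _ => pop k (fun _ a => a) (goto fun _ => next)
  | .peek k, _, next, _ => peek k (fun _ a => a) (goto fun _ => next)
  | .load f, _, next, _ => load f (goto fun _ => next)
  | .seq p q, e, next, l =>
    Sum.elim (code p (fun a => e (Sum.inl a)) (e (Sum.inr (entry q))))
      (code q (fun a => e (Sum.inr a)) next) l
  | .ite f p q, e, next, l =>
    Option.elim l
      (branch f (goto fun _ => e (some (Sum.inl (entry p))))
        (goto fun _ => e (some (Sum.inr (entry q)))))
      (Sum.elim (code p (fun a => e (some (Sum.inl a))) next)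
        (code q (fun a => e (some (Sum.inr a))) next))
  | .loop f p, e, next, l =>
    Option.elim l
      (branch f (goto fun _ => e (some (entry p))) (goto fun _ => next))
      (code p (fun a => e (some a)) (e none))

/-- A configuration of the Turing machine. -/
def cfg {Λ : Type} (l : Option Λ) (s : Mem) :
    Turing.TM2.Cfg (fun _ : Stk => Letter) Λ (Option Letter) := ⟨l, s.v, s.get⟩

open StateTransition in
/-- The Turing machine reaches a configuration within time `t`. -/
def Reach {Λ : Type} (M : Λ → MStmt Λ)
    (a b : Turing.TM2.Cfg (fun _ : Stk => Letter) Λ (Option Letter)) (t : ℕ) : Prop :=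
  Nonempty (EvalsToInTime (Turing.TM2.step M) a (some b) t)

theorem Reach.trans {Λ : Type} {M : Λ → MStmt Λ}
    {a b c : Turing.TM2.Cfg (fun _ : Stk => Letter) Λ (Option Letter)} {t₁ t₂ : ℕ}
    (h₁ : Reach M a b t₁) (h₂ : Reach M b c t₂) : Reach M a c (t₁ + t₂) := by
  obtain ⟨h₁⟩ := h₁
  obtain ⟨h₂⟩ := h₂
  rw [Nat.add_comm]
  exact ⟨h₁.trans _ _ _ _ _ _ h₂⟩

theorem Reach.mono {Λ : Type} {M : Λ → MStmt Λ}
    {a b : Turing.TM2.Cfg (fun _ : Stk => Letter) Λ (Option Letter)} {t₁ t₂ : ℕ}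
    (h₁ : Reach M a b t₁) (h : t₁ ≤ t₂) : Reach M a b t₂ := by
  obtain ⟨h₁⟩ := h₁
  exact ⟨⟨h₁.toEvalsTo, h₁.steps_le_m.trans h⟩⟩

theorem Reach.single {Λ : Type} {M : Λ → MStmt Λ} (l : Λ) (s : Mem)
    {b : Turing.TM2.Cfg (fun _ : Stk => Letter) Λ (Option Letter)}
    (h : Turing.TM2.stepAux (M l) s.v s.get = b) : Reach M (cfg (some l) s) b 1 := by
  refine ⟨⟨⟨1, ?_⟩, le_rfl⟩⟩
  subst h
  rfl

/-- Induction on the execution. The label embedding `e` and the exit `next` are arbitrary because a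
subprogram sits inside a larger one and hands over to whatever follows it. -/
theorem Exec.reach {p : Prog} {s s' : Mem} {t : ℕ} (h : Exec p s s' t) :
    ∀ {Λ : Type} {M : Λ → MStmt Λ} {e : Lab p → Λ} {next : Λ},
      (∀ l, M (e l) = code p e next l) →
      Reach M (cfg (some (e (entry p))) s) (cfg (some next) s') t := by
  induction h with
  | push k f s =>
    intro Λ M e next hM
    refine Reach.single _ _ ?_
    rw [hM]
    simp [code, cfg, Mem.get_set, Mem.set_v]
  | pop k s =>
    intro Λ M e next hM
    refine Reach.single _ _ ?_
    rw [hM]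
    simp only [code, cfg, Turing.TM2.stepAux]
    rw [← Mem.get_set]
    rfl
  | peek k s =>
    intro Λ M e next hM
    refine Reach.single _ _ ?_
    rw [hM]
    rfl
  | load f s =>
    intro Λ M e next hM
    refine Reach.single _ _ ?_
    rw [hM]
    rfl
  | @seq p q _ _ _ _ _ _ _ h₁ h₂ =>
    intro Λ M e next hM
    exact (h₁ (e := fun a => e (Sum.inl a)) fun l => hM (Sum.inl l)).trans
      (h₂ (e := fun a => e (Sum.inr a)) fun l => hM (Sum.inr l))
  | @ite_true f p q s s' t hf _ h =>
    intro Λ M e next hM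
    rw [Nat.add_comm]
    refine Reach.trans (b := cfg (some (e (some (Sum.inl (entry p))))) s) (Reach.single _ _ ?_)
      (h (e := fun a => e (some (Sum.inl a))) fun l => hM (some (Sum.inl l)))
    rw [hM]
    simp [code, entry, hf, cfg]
  | @ite_false f p q s s' t hf _ h =>
    intro Λ M e next hM
    rw [Nat.add_comm]
    refine Reach.trans (b := cfg (some (e (some (Sum.inr (entry q))))) s) (Reach.single _ _ ?_)
      (h (e := fun a => e (some (Sum.inr a))) fun l => hM (some (Sum.inr l)))
    rw [hM]
    simp [code, entry, hf, cfg]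
  | @loop_true f p s₁ s₂ s₃ t₁ t₂ hf _ _ h₁ h₂ =>
    intro Λ M e next hM
    rw [Nat.add_comm]
    -- The body exits to the head of the same loop, so `h₂` applies to the same code `hM`.
    refine Reach.trans (b := cfg (some (e (some (entry p)))) s₁) (Reach.single _ _ ?_)
      (Reach.trans (h₁ (e := fun a => e (some a)) fun l => hM (some l)) (h₂ hM))
    rw [hM]
    simp [code, entry, hf, cfg]
  | @loop_false f p s hf =>
    intro Λ M e next hM
    refine Reach.single _ _ ?_
    rw [hM]
    simp [code, entry, hf, cfg]
  | mono _ hle h =>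
    intro Λ M e next hM
    exact (h hM).mono hle

/-- `Letter` is finite. -/
def letterEquiv : Letter ≃ Fin 4 where
  toFun
    | .zero => 0
    | .one => 1
    | .minus => 2
    | .endMark => 3
  invFun
    | 0 => .zero
    | 1 => .one
    | 2 => .minus
    | 3 => .endMark
  left_inv a := by cases a <;> rfl
  right_inv a := by fin_cases a <;> rfl

instance : Fintype Letter := Fintype.ofEquiv _ letterEquiv.symm

open Turing.TM2.Stmt in
/-- The Turing machine of a program. -/
noncomputable def machine (p : Prog) : Turing.FinTM2 :=
  letI := labFintype p
  { K := Stk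
    k₀ := Stk.inp
    k₁ := Stk.out
    Γ := fun _ => Letter
    Λ := Option (Lab p)
    main := some (entry p)
    σ := Option Letter
    initialState := none
    Γk₀Fin := inferInstanceAs (Fintype Letter)
    m := fun l => Option.elim l (load (fun _ => none) halt) (code p some none) }

/-- A problem is solvable in polynomial time if a structured program solves it. -/
theorem nonempty_computable {α β : Type} (wIn : α → List Letter) (wOut : β → List Letter)
    (f : α → β) (p : Prog) (P : Polynomial ℕ)
    (h : ∀ a, ∃ v, Exec p ⟨none, wIn a, [], [], [], [], []⟩ ⟨v, [], wOut (f a), [], [], [], []⟩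
      (P.eval (wIn a).length)) :
    Nonempty (Turing.TM2ComputableInPolyTime wIn wOut f) := by
  refine ⟨⟨⟨machine p, Equiv.refl _, Equiv.refl _⟩, P + 1, fun a => Classical.choice ?_⟩⟩
  obtain ⟨v, hv⟩ := h a
  have h1 := hv.reach (M := (machine p).m) (e := some) (next := none) fun l => rfl
  -- The label `none` spends one step on clearing the internal state, since a halting configuration
  -- must carry the initial state; hence `P + 1`.
  have h2 : Reach (machine p).m (cfg (some none) ⟨v, [], wOut (f a), [], [], [], []⟩)
      (cfg none ⟨none, [], wOut (f a), [], [], [], []⟩) 1 := Reach.single _ _ rfl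
  have h3 := h1.trans h2
  have e1 : cfg (some (some (entry p))) ⟨none, wIn a, [], [], [], [], []⟩ =
      Turing.initList (machine p) (wIn a) := by
    refine congrArg (Turing.TM2.Cfg.mk _ _) ?_
    funext k
    cases k <;> rfl
  have e2 : cfg none ⟨none, [], wOut (f a), [], [], [], []⟩ =
      Turing.haltList (machine p) (wOut (f a)) := by
    refine congrArg (Turing.TM2.Cfg.mk _ _) ?_
    funext k
    cases k <;> rfl
  -- Words are transported along the alphabet equivalences, here identities; with the words
  -- generalized, `List.map_id` removes them at the end.
  have key (l₁ l₂ : List Letter) (hl₁ : l₁ = wIn a) (hl₂ : l₂ = wOut (f a)) :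
      Nonempty (Turing.TM2OutputsInTime (machine p) l₁ (some l₂)
        ((P + 1).eval (wIn a).length)) := by
    subst hl₁ hl₂
    rw [Polynomial.eval_add, Polynomial.eval_one]
    unfold Turing.TM2OutputsInTime
    rw [← e1]
    change Nonempty (StateTransition.EvalsToInTime _ _ (some (Turing.haltList (machine p) _)) _)
    rw [← e2]
    exact h3
  exact key _ _ (List.map_id (wIn a)) (List.map_id (wOut (f a)))

end StackMachine

/-! ### Binary trees on a stack -/

namespace StackMachine

/-- Binary trees, the universal data type of our programs. -/
inductive BTree : Type
  | nil
  | cons (a b : BTree)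

namespace BTree

/-- The prefix code of a tree. -/
def word : BTree → List Letter
  | nil => [.zero]
  | cons a b => .one :: (word a ++ word b)

/-- The length of the code of a tree. -/
def size (a : BTree) : ℕ := a.word.length

@[simp] theorem size_nil : size nil = 1 := rfl

@[simp] theorem size_cons (a b : BTree) : size (cons a b) = size a + size b + 1 := by
  simp [size, word]

theorem size_pos (a : BTree) : 0 < size a := by
  cases a <;> simp

end BTree

open BTree

/-- The code of a stack of trees. -/
def words (s : List BTree) : List Letter := s.flatMap word

@[simp] theorem words_nil : words [] = [] := rfl

@[simp] theorem words_cons (a : BTree) (s : List BTree) : words (a :: s) = a.word ++ words s := rfl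

/-- The memory state with a given stack of trees, between the execution of two instructions. -/
abbrev treeMem (i o : List Letter) (s : List BTree) : Mem := ⟨none, i, o, words s, [], [], []⟩

/-- `Computes p s s' t`: the program `p` turns the stack of trees `s` into `s'` in time `t`. -/
def Computes (p : Prog) (s s' : List BTree) (t : ℕ) : Prop :=
  ∀ i o, Exec p (treeMem i o s) (treeMem i o s') t

theorem Computes.mono {p : Prog} {s s' : List BTree} {t t' : ℕ} (h : Computes p s s' t)
    (ht : t ≤ t') : Computes p s s' t' := fun i o => (h i o).mono ht

theorem Computes.seq {p q : Prog} {s₁ s₂ s₃ : List BTree} {t₁ t₂ : ℕ} (h₁ : Computes p s₁ s₂ t₁)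
    (h₂ : Computes q s₂ s₃ t₂) : Computes (.seq p q) s₁ s₃ (t₁ + t₂) :=
  fun i o => (h₁ i o).seq (h₂ i o)

/-- Was the letter `one` read? -/
def isOne : Option Letter → Bool
  | some .one => true
  | _ => false

/-- The program that does nothing. -/
def skip : Prog := .load id

theorem Exec.skip (s : Mem) : Exec skip s s 1 := Exec.load id s

theorem computes_skip (s : List BTree) : Computes skip s s 1 := fun _ _ => Exec.skip _

/-- Forget the letter read last. -/
def reset : Prog := .load fun _ => none

/-- Push the empty tree. -/
def pushNil : Prog := .push .x fun _ => .zero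

theorem computes_pushNil (s : List BTree) : Computes pushNil s (nil :: s) 1 :=
  fun _ _ => Exec.push _ _ _

/-- Combine the two topmost trees. -/
def mkCons : Prog := .push .x fun _ => .one

/-- In prefix code both subtrees already lie on the stack in the right order, so a single letter
joins them. -/
theorem computes_mkCons (a b : BTree) (s : List BTree) :
    Computes mkCons (a :: b :: s) (cons a b :: s) 1 := by
  intro i o
  have := Exec.push .x (fun _ => .one) (treeMem i o (a :: b :: s))
  simpa [mkCons, treeMem, word, Mem.set, Mem.get] using this

/-- Split the topmost tree. -/
def unCons : Prog := .seq (.pop .x) reset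

theorem computes_unCons (a b : BTree) (s : List BTree) :
    Computes unCons (cons a b :: s) (a :: b :: s) 2 := by
  intro i o
  have := (Exec.pop .x (treeMem i o (cons a b :: s))).seq (Exec.load (fun _ => none) _)
  simpa [unCons, reset, treeMem, word, Mem.set, Mem.setV, Mem.get] using this

/-- Branch on the topmost tree. -/
def ifCons (p q : Prog) : Prog := .seq (.peek .x) (.ite isOne (.seq reset p) (.seq reset q))

theorem computes_ifCons_cons {p q : Prog} {a b : BTree} {s s' : List BTree} {t : ℕ}
    (h : Computes p (cons a b :: s) s' t) : Computes (ifCons p q) (cons a b :: s) s' (t + 3) := by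
  intro i o
  refine Exec.mono (Exec.seq (Exec.peek .x _) (Exec.ite_true rfl
    (Exec.seq (Exec.load _ _) (h i o)))) (by omega)

theorem computes_ifCons_nil {p q : Prog} {s s' : List BTree} {t : ℕ}
    (h : Computes q (nil :: s) s' t) : Computes (ifCons p q) (nil :: s) s' (t + 3) := by
  intro i o
  refine Exec.mono (Exec.seq (Exec.peek .x _) (Exec.ite_false rfl
    (Exec.seq (Exec.load _ _) (h i o)))) (by omega)

/-- The main loop of `whileCons`. -/
def consLoop (p : Prog) : Prog := .loop isOne (.seq reset (.seq p (.peek .x)))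

/-- Repeat while the topmost tree is not empty. -/
def whileCons (p : Prog) : Prog := .seq (.peek .x) (.seq (consLoop p) reset)

/-- The specification of `consLoop`. -/
def LoopComputes (p : Prog) (s s' : List BTree) (t : ℕ) : Prop :=
  ∀ i o, Exec (consLoop p) ⟨(words s).head?, i, o, words s, [], [], []⟩
    ⟨some .zero, i, o, words s', [], [], []⟩ t

theorem LoopComputes.mono {p : Prog} {s s' : List BTree} {t t' : ℕ} (h : LoopComputes p s s' t)
    (ht : t ≤ t') : LoopComputes p s s' t' := fun i o => (h i o).mono ht

theorem loopComputes_nil (p : Prog) (s : List BTree) : LoopComputes p (nil :: s) (nil :: s) 1 :=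
  fun _ _ => Exec.loop_false rfl

theorem loopComputes_cons {p : Prog} {a b : BTree} {s s₂ s₃ : List BTree} {t₁ t₂ : ℕ}
    (h₁ : Computes p (cons a b :: s) s₂ t₁) (h₂ : LoopComputes p s₂ s₃ t₂) :
    LoopComputes p (cons a b :: s) s₃ (t₁ + t₂ + 3) := by
  intro i o
  refine Exec.mono (Exec.loop_true rfl (Exec.seq (Exec.load _ _) (Exec.seq (h₁ i o)
    (Exec.peek .x _))) (h₂ i o)) (by omega)

theorem LoopComputes.whileCons {p : Prog} {s s' : List BTree} {t : ℕ} (h : LoopComputes p s s' t) :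
    Computes (whileCons p) s s' (t + 2) := by
  intro i o
  exact Exec.mono (Exec.seq (Exec.peek .x _) (Exec.seq (h i o) (Exec.load _ _))) (by omega)

/-! #### Moving trees -/

/-- One step of `moveTree`. -/
def moveStep : Prog :=
  .seq (.pop .x) (.seq (.push .y fun v => v.getD .zero)
    (.seq (.ite isOne (.seq (.push .c fun _ => .one) (.push .c fun _ => .one)) skip) (.pop .c)))

/-- Move the topmost tree to the stack `y`, reversing it. -/
def moveTree : Prog := .seq (.load fun _ => some .one) (.loop Option.isSome moveStep)

/-- The stack `c` holds one letter for each tree still to be read after the current one: a `one`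
adds a tree, a `zero` finishes one, and popping the empty `c` yields `none`, which ends the loop. An
arbitrary continuation is allowed so that the two subtrees can be treated one after the other. -/
theorem exec_moveLoop (a : BTree) : ∀ {l : Letter} {i o r y z c : List Letter} {s : Mem} {t : ℕ},
    Exec (.loop Option.isSome moveStep) ⟨c.head?, i, o, r, a.word.reverse ++ y, z, c.tail⟩ s t →
    Exec (.loop Option.isSome moveStep) ⟨some l, i, o, a.word ++ r, y, z, c⟩ s
      (t + 8 * a.size) := by
  induction a with
  | nil =>
    intro l i o r y z c s t h
    have step : Exec moveStep ⟨some l, i, o, nil.word ++ r, y, z, c⟩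
        ⟨c.head?, i, o, r, nil.word.reverse ++ y, z, c.tail⟩ 6 :=
      Exec.mono (Exec.seq (Exec.pop .x _) (Exec.seq (Exec.push .y _ _) (Exec.seq
        (Exec.ite_false rfl (Exec.skip _)) (Exec.pop .c _)))) (by omega)
    exact (Exec.loop_true rfl step h).mono (by simp; omega)
  | cons a b iha ihb =>
    intro l i o r y z c s t h
    have step : Exec moveStep ⟨some l, i, o, (cons a b).word ++ r, y, z, c⟩
        ⟨some .one, i, o, a.word ++ (b.word ++ r), .one :: y, z, .one :: c⟩ 6 := by
      rw [← List.append_assoc]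
      exact Exec.mono (Exec.seq (Exec.pop .x _) (Exec.seq (Exec.push .y _ _) (Exec.seq
        (Exec.ite_true rfl (Exec.seq (Exec.push .c _ _) (Exec.push .c _ _)))
          (Exec.pop .c _)))) (by omega)
    refine (Exec.loop_true rfl step (iha (c := .one :: c) (ihb (l := .one) (c := c) ?_))).mono
      (t' := t + 8 * (cons a b).size) (t := 6 + (t + 8 * b.size + 8 * a.size) + 1) ?_
    · simpa [word] using h
    · simp
      omega

theorem exec_moveTree (v : Option Letter) (a : BTree) (i o r y z : List Letter) :
    Exec moveTree ⟨v, i, o, a.word ++ r, y, z, []⟩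
      ⟨none, i, o, r, a.word.reverse ++ y, z, []⟩ (8 * a.size + 2) := by
  refine Exec.mono (Exec.seq (Exec.load _ _) (exec_moveLoop a (Exec.loop_false rfl))) (by omega)

/-- Move a whole stack, reversing it. -/
def shift (k₁ k₂ : Stk) : Prog :=
  .seq (.pop k₁) (.loop Option.isSome (.seq (.push k₂ fun v => v.getD .zero) (.pop k₁)))

theorem exec_shift_y_z (w : List Letter) {v : Option Letter} {i o x z c : List Letter} :
    Exec (shift .y .z) ⟨v, i, o, x, w, z, c⟩ ⟨none, i, o, x, [], w.reverse ++ z, c⟩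
      (3 * w.length + 2) := by
  refine Exec.mono (t := 1 + (3 * w.length + 1)) (Exec.seq (Exec.pop .y _) ?_) (by omega)
  change Exec _ ⟨w.head?, i, o, x, w.tail, z, c⟩ _ _
  induction w generalizing z with
  | nil => exact Exec.loop_false rfl
  | cons a w ih =>
    simp only [List.reverse_cons, List.append_assoc]
    refine Exec.mono (Exec.loop_true rfl (Exec.seq (Exec.push .z _ _) (Exec.pop .y _)) ?_)
      (t := 2 + (3 * w.length + 1) + 1) (by simp; omega)
    exact ih (z := a :: z)

theorem exec_shift_z_c (w : List Letter) {v : Option Letter} {i o x y c : List Letter} :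
    Exec (shift .z .c) ⟨v, i, o, x, y, w, c⟩ ⟨none, i, o, x, y, [], w.reverse ++ c⟩
      (3 * w.length + 2) := by
  refine Exec.mono (t := 1 + (3 * w.length + 1)) (Exec.seq (Exec.pop .z _) ?_) (by omega)
  change Exec _ ⟨w.head?, i, o, x, y, w.tail, c⟩ _ _
  induction w generalizing c with
  | nil => exact Exec.loop_false rfl
  | cons a w ih =>
    simp only [List.reverse_cons, List.append_assoc]
    refine Exec.mono (Exec.loop_true rfl (Exec.seq (Exec.push .c _ _) (Exec.pop .z _)) ?_)
      (t := 2 + (3 * w.length + 1) + 1) (by simp; omega)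
    exact ih (c := a :: c)

theorem exec_shift_c_x (w : List Letter) {v : Option Letter} {i o x y z : List Letter} :
    Exec (shift .c .x) ⟨v, i, o, x, y, z, w⟩ ⟨none, i, o, w.reverse ++ x, y, z, []⟩
      (3 * w.length + 2) := by
  refine Exec.mono (t := 1 + (3 * w.length + 1)) (Exec.seq (Exec.pop .c _) ?_) (by omega)
  change Exec _ ⟨w.head?, i, o, x, y, z, w.tail⟩ _ _
  induction w generalizing x with
  | nil => exact Exec.loop_false rfl
  | cons a w ih =>
    simp only [List.reverse_cons, List.append_assoc]
    refine Exec.mono (Exec.loop_true rfl (Exec.seq (Exec.push .x _ _) (Exec.pop .c _)) ?_)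
      (t := 2 + (3 * w.length + 1) + 1) (by simp; omega)
    exact ih (x := a :: x)

theorem exec_shift_y_x (w : List Letter) {v : Option Letter} {i o x z c : List Letter} :
    Exec (shift .y .x) ⟨v, i, o, x, w, z, c⟩ ⟨none, i, o, w.reverse ++ x, [], z, c⟩
      (3 * w.length + 2) := by
  refine Exec.mono (t := 1 + (3 * w.length + 1)) (Exec.seq (Exec.pop .y _) ?_) (by omega)
  change Exec _ ⟨w.head?, i, o, x, w.tail, z, c⟩ _ _
  induction w generalizing x with
  | nil => exact Exec.loop_false rfl
  | cons a w ih =>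
    simp only [List.reverse_cons, List.append_assoc]
    refine Exec.mono (Exec.loop_true rfl (Exec.seq (Exec.push .x _ _) (Exec.pop .y _)) ?_)
      (t := 2 + (3 * w.length + 1) + 1) (by simp; omega)
    exact ih (x := a :: x)

/-- Copy the stack `y` to `x` and `z`, reversing it. -/
def fork : Prog :=
  .seq (.pop .y) (.loop Option.isSome (.seq (.push .x fun v => v.getD .zero)
    (.seq (.push .z fun v => v.getD .zero) (.pop .y))))

theorem exec_fork (w : List Letter) {v : Option Letter} {i o x z c : List Letter} :
    Exec fork ⟨v, i, o, x, w, z, c⟩ ⟨none, i, o, w.reverse ++ x, [], w.reverse ++ z, c⟩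
      (4 * w.length + 2) := by
  refine Exec.mono (t := 1 + (4 * w.length + 1)) (Exec.seq (Exec.pop .y _) ?_) (by omega)
  change Exec _ ⟨w.head?, i, o, x, w.tail, z, c⟩ _ _
  induction w generalizing x z with
  | nil => exact Exec.loop_false rfl
  | cons a w ih =>
    simp only [List.reverse_cons, List.append_assoc]
    refine Exec.mono (Exec.loop_true rfl (Exec.seq (Exec.push .x _ _) (Exec.seq
      (Exec.push .z _ _) (Exec.pop .y _))) ?_)
      (t := 3 + (4 * w.length + 1) + 1) (by simp; omega)
    exact ih (x := a :: x) (z := a :: z)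

/-- Empty the stack `y`. -/
def clear : Prog := .seq (.pop .y) (.loop Option.isSome (.pop .y))

theorem exec_clear (w : List Letter) {v : Option Letter} {i o x z c : List Letter} :
    Exec clear ⟨v, i, o, x, w, z, c⟩ ⟨none, i, o, x, [], z, c⟩ (2 * w.length + 2) := by
  refine Exec.mono (t := 1 + (2 * w.length + 1)) (Exec.seq (Exec.pop .y _) ?_) (by omega)
  change Exec _ ⟨w.head?, i, o, x, w.tail, z, c⟩ _ _
  induction w with
  | nil => exact Exec.loop_false rfl
  | cons a w ih =>
    exact Exec.mono (Exec.loop_true rfl (Exec.pop .y _) ih)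
      (t := 1 + (2 * w.length + 1) + 1) (by simp; omega)

/-- Delete the topmost tree. -/
def drop : Prog := .seq moveTree clear

theorem computes_drop (a : BTree) (s : List BTree) :
    Computes drop (a :: s) s (10 * a.size + 4) := by
  intro i o
  have h : (a.word.reverse ++ []).length = a.size := by simp [size]
  exact Exec.mono (Exec.seq (exec_moveTree _ a i o (words s) [] []) (exec_clear _))
    (by rw [h]; omega)

/-- Duplicate the topmost tree. -/
def dup : Prog := .seq moveTree (.seq fork (.seq (shift .z .c) (shift .c .x)))

/-- Every move reverses a word. `fork` undoes the reversal of `moveTree` on both `x` and `z`, and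
the detour of the second copy through `c` reverses it twice. -/
theorem computes_dup (a : BTree) (s : List BTree) :
    Computes dup (a :: s) (a :: a :: s) (18 * a.size + 8) := by
  intro i o
  have := Exec.seq (exec_moveTree none a i o (words s) [] []) (Exec.seq (exec_fork _)
    (Exec.seq (exec_shift_z_c _) (exec_shift_c_x _)))
  refine Exec.mono (t := _) (by simpa [dup, treeMem] using this) ?_
  simp [size]
  omega

/-- Exchange the two topmost trees. -/
def swap : Prog :=
  .seq moveTree (.seq (shift .y .z) (.seq moveTree
    (.seq (shift .z .c) (.seq (shift .c .x) (shift .y .x)))))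

theorem computes_swap (a b : BTree) (s : List BTree) :
    Computes swap (a :: b :: s) (b :: a :: s) (17 * (a.size + b.size) + 12) := by
  intro i o
  have := Exec.seq (exec_moveTree none a i o (words (b :: s)) [] []) (Exec.seq (exec_shift_y_z _)
    (Exec.seq (exec_moveTree none b i o (words s) [] _) (Exec.seq
    (exec_shift_z_c _) (Exec.seq (exec_shift_c_x _) (exec_shift_y_x _)))))
  refine Exec.mono (t := _) (by simpa [swap, treeMem] using this) ?_
  simp [size]
  omega

end StackMachine

/-! ### Functions computable in polynomial time -/

namespace StackMachine

open BTree

/-- Types whose elements are encoded by trees. -/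
class Enc (α : Type) where
  enc : α → BTree

open Enc (enc)

/-- The size of the code of an element. -/
def esize {α : Type} [Enc α] (a : α) : ℕ := (enc a).size

instance : Enc Unit := ⟨fun _ => nil⟩

/-- Both Boolean values get codes of the same size. -/
instance : Enc Bool := ⟨fun b => bif b then cons (cons nil nil) nil else cons nil (cons nil nil)⟩

instance {α β : Type} [Enc α] [Enc β] : Enc (α × β) := ⟨fun p => cons (enc p.1) (enc p.2)⟩

/-- The code of a list. -/
def encList {α : Type} [Enc α] : List α → BTree
  | [] => nil
  | a :: l => cons (enc a) (encList l)

instance {α : Type} [Enc α] : Enc (List α) := ⟨encList⟩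

instance : Enc ℕ := ⟨fun n => enc n.bits⟩

/-! ### Sizes of codes. -/

section Sizes

variable {α β : Type} [Enc α] [Enc β]

theorem esize_prod (p : α × β) : esize p = esize p.1 + esize p.2 + 1 := size_cons _ _

theorem esize_mk (a : α) (b : β) : esize (a, b) = esize a + esize b + 1 := size_cons _ _

theorem esize_nil : esize ([] : List α) = 1 := rfl

theorem esize_cons (a : α) (l : List α) : esize (a :: l) = esize a + esize l + 1 := size_cons _ _

theorem esize_bool (b : Bool) : esize b = 5 := by cases b <;> rfl

theorem esize_pos (a : α) : 0 < esize a := size_pos _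

theorem length_le_esize (l : List α) : l.length ≤ esize l := by
  induction l with
  | nil => simp
  | cons a l ih =>
    rw [esize_cons, List.length_cons]
    omega

theorem esize_append (l l' : List α) : esize (l ++ l') + 1 = esize l + esize l' := by
  induction l with
  | nil => rw [List.nil_append, esize_nil, Nat.add_comm]
  | cons a l ih =>
    rw [List.cons_append, esize_cons, esize_cons]
    omega

theorem esize_reverse (l : List α) : esize l.reverse = esize l := by
  induction l with
  | nil => rfl
  | cons a l ih =>
    have := esize_append l.reverse [a]
    rw [List.reverse_cons, esize_cons]
    rw [esize_cons, esize_nil, ih] at this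
    omega

theorem esize_le_of_prefix {l l' : List α} (h : l <+: l') : esize l ≤ esize l' := by
  obtain ⟨k, rfl⟩ := h
  have := esize_append l k
  have := esize_pos k
  omega

theorem esize_le_of_mem {a : α} {l : List α} (h : a ∈ l) : esize a ≤ esize l := by
  induction l with
  | nil => simp at h
  | cons b l ih =>
    rw [esize_cons]
    rcases List.mem_cons.1 h with rfl | h
    · omega
    · have := ih h
      omega

/-- A digit costs 5 for the Boolean and 1 for the list cell; code sizes of numbers are therefore
linear in their binary length. -/
theorem esize_bools (l : List Bool) : esize l = 6 * l.length + 1 := by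
  induction l with
  | nil => rfl
  | cons a l ih =>
    rw [esize_cons, ih, esize_bool, List.length_cons]
    omega

theorem esize_nat (n : ℕ) : esize n = 6 * n.size + 1 := by
  rw [← Nat.size_eq_bits_len]
  exact esize_bools _

theorem esize_nat_mono {m n : ℕ} (h : m ≤ n) : esize m ≤ esize n := by
  rw [esize_nat, esize_nat]
  have := Nat.size_le_size h
  omega

end Sizes

theorem eval_mono (P : Polynomial ℕ) {m n : ℕ} (h : m ≤ n) : P.eval m ≤ P.eval n := by
  rw [Polynomial.eval_eq_sum_range, Polynomial.eval_eq_sum_range]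
  exact Finset.sum_le_sum fun i _ => Nat.mul_le_mul_left _ (Nat.pow_le_pow_left h i)

/-- A quantity that is bounded by a polynomial in the size of the input. -/
def PolyBound {α : Type} [Enc α] (b : α → ℕ) : Prop :=
  ∃ P : Polynomial ℕ, ∀ x, b x ≤ P.eval (esize x)

/-- A function that a program computes in polynomial time. -/
@[fun_prop]
def PolyTime {α β : Type} [Enc α] [Enc β] (f : α → β) : Prop :=
  ∃ (p : Prog) (P : Polynomial ℕ), ∀ a s,
    Computes p (enc a :: s) (enc (f a) :: s) (P.eval (esize a))

section PolyBound

variable {α : Type} [Enc α]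

theorem PolyBound.const (n : ℕ) : PolyBound fun _ : α => n := ⟨Polynomial.C n, by simp⟩

theorem PolyBound.id : PolyBound fun x : α => esize x := ⟨Polynomial.X, by simp⟩

theorem PolyBound.add {b b' : α → ℕ} (h : PolyBound b) (h' : PolyBound b') :
    PolyBound fun x => b x + b' x := by
  obtain ⟨P, hP⟩ := h
  obtain ⟨P', hP'⟩ := h'
  refine ⟨P + P', fun x => ?_⟩
  rw [Polynomial.eval_add]
  exact add_le_add (hP x) (hP' x)

theorem PolyBound.mul {b b' : α → ℕ} (h : PolyBound b) (h' : PolyBound b') :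
    PolyBound fun x => b x * b' x := by
  obtain ⟨P, hP⟩ := h
  obtain ⟨P', hP'⟩ := h'
  refine ⟨P * P', fun x => ?_⟩
  rw [Polynomial.eval_mul]
  exact Nat.mul_le_mul (hP x) (hP' x)

theorem PolyBound.eval {b : α → ℕ} (h : PolyBound b) (Q : Polynomial ℕ) :
    PolyBound fun x => Q.eval (b x) := by
  obtain ⟨P, hP⟩ := h
  refine ⟨Q.comp P, fun x => ?_⟩
  rw [Polynomial.eval_comp]
  exact eval_mono Q (hP x)

theorem PolyTime.bound {β : Type} [Enc β] {f : α → β} (hf : PolyTime f) :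
    PolyBound fun x => esize (f x) := by
  obtain ⟨p, P, hp⟩ := hf
  refine ⟨Polynomial.X + P, fun x => ?_⟩
  have := (hp x [] [] []).length_x_le
  simpa [esize, size] using this

/-- A program with a polynomially bounded running time. -/
theorem PolyTime.of_bound {β : Type} [Enc β] {f : α → β} (p : Prog) {b : α → ℕ}
    (hb : PolyBound b) (h : ∀ a s, Computes p (enc a :: s) (enc (f a) :: s) (b a)) :
    PolyTime f := by
  obtain ⟨P, hP⟩ := hb
  exact ⟨p, P, fun a s => (h a s).mono (hP a)⟩

end PolyBound

/-! ### Closure properties of `PolyTime`. -/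

section Closure

variable {α β γ δ : Type} [Enc α] [Enc β] [Enc γ] [Enc δ]

theorem PolyTime.of_enc_eq {f : α → β} (h : ∀ a, enc (f a) = enc a) : PolyTime f :=
  .of_bound skip (.const 1) fun a s => by
    rw [h]
    exact computes_skip _

@[fun_prop]
theorem PolyTime.id' : PolyTime fun x : α => x := .of_enc_eq fun _ => rfl

@[fun_prop]
theorem PolyTime.comp {g : β → γ} {f : α → β} (hg : PolyTime g) (hf : PolyTime f) :
    PolyTime fun x => g (f x) := by
  have hb := hf.bound
  obtain ⟨p, P, hp⟩ := hf
  obtain ⟨q, Q, hq⟩ := hg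
  exact .of_bound (.seq p q) ((PolyBound.id.eval P).add (hb.eval Q)) fun a s =>
    (hp a s).seq (hq (f a) s)

/-- The program that pushes a fixed tree. -/
def pushTree : BTree → Prog
  | nil => pushNil
  | cons a b => .seq (pushTree b) (.seq (pushTree a) mkCons)

theorem computes_pushTree (a : BTree) : ∀ s, Computes (pushTree a) s (a :: s) a.size := by
  induction a with
  | nil => exact computes_pushNil
  | cons a b iha ihb =>
    intro s
    refine ((ihb s).seq ((iha _).seq (computes_mkCons a b s))).mono ?_
    rw [size_cons]
    omega

@[fun_prop]
theorem PolyTime.const (b : β) : PolyTime fun _ : α => b :=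
  .of_bound (.seq drop (pushTree (enc b)))
    (((PolyBound.const 10).mul PolyBound.id).add (.const (4 + (enc b).size))) fun a s =>
    ((computes_drop _ _).seq (computes_pushTree _ _)).mono (by simp only [esize]; omega)

@[fun_prop]
theorem PolyTime.prodMk {f : α → β} {g : α → γ} (hf : PolyTime f) (hg : PolyTime g) :
    PolyTime fun x => (f x, g x) := by
  have hgb := hg.bound
  obtain ⟨p, P, hp⟩ := hf
  obtain ⟨q, Q, hq⟩ := hg
  -- `g` is evaluated first, so that `f x` ends above `g x`, as `mkCons` requires.
  refine .of_bound (.seq dup (.seq q (.seq swap (.seq p mkCons))))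
    (b := fun x => 18 * esize x + 8 + (Q.eval (esize x) + (17 * (esize (g x) + esize x) + 12 +
      (P.eval (esize x) + 1)))) ?_ fun a s =>
    (computes_dup _ _).seq ((hq a _).seq ((computes_swap _ _ _).seq ((hp a _).seq
      (computes_mkCons _ _ _))))
  exact (((PolyBound.const 18).mul .id).add (.const 8)).add ((PolyBound.id.eval Q).add
    ((((PolyBound.const 17).mul (hgb.add .id)).add (.const 12)).add
      ((PolyBound.id.eval P).add (.const 1))))

theorem polyTime_fst : PolyTime fun p : α × β => p.1 :=
  .of_bound (.seq unCons (.seq swap drop))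
    (((PolyBound.const 27).mul .id).add (.const 18)) fun a s =>
    ((computes_unCons _ _ _).seq ((computes_swap _ _ _).seq (computes_drop _ _))).mono (by
      rw [esize_prod, esize, esize]
      omega)

theorem polyTime_snd : PolyTime fun p : α × β => p.2 :=
  .of_bound (.seq unCons drop)
    (((PolyBound.const 27).mul .id).add (.const 18)) fun a s =>
    ((computes_unCons _ _ _).seq (computes_drop _ _)).mono (by
      rw [esize_prod, esize, esize]
      omega)

@[fun_prop]
theorem PolyTime.fst {f : α → β × γ} (hf : PolyTime f) : PolyTime fun x => (f x).1 :=
  polyTime_fst.comp hf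

@[fun_prop]
theorem PolyTime.snd {f : α → β × γ} (hf : PolyTime f) : PolyTime fun x => (f x).2 :=
  polyTime_snd.comp hf

@[fun_prop]
theorem PolyTime.cond {c : α → Bool} {f g : α → β} (hc : PolyTime c) (hf : PolyTime f)
    (hg : PolyTime g) : PolyTime fun x => bif c x then f x else g x := by
  obtain ⟨r, R, hr⟩ := hc
  obtain ⟨p, P, hp⟩ := hf
  obtain ⟨q, Q, hq⟩ := hg
  refine .of_bound (.seq (.seq dup r) (.seq unCons (.seq swap (.seq drop
    (ifCons (.seq drop p) (.seq drop q))))))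
    (b := fun x => 18 * esize x + R.eval (esize x) + (P.eval (esize x) + Q.eval (esize x)) + 200)
    ?_ fun a s => ?_
  · exact (((((PolyBound.const 18).mul .id).add (.eval .id R)).add
      ((PolyBound.id.eval P).add (.eval .id Q))).add (.const 200))
  · have h1 := (computes_dup (enc a) s).seq (hr a _)
    cases h : c a with
    | true =>
      rw [h] at h1
      have h2 := (computes_unCons (cons nil nil) nil (enc a :: s)).seq ((computes_swap _ _ _).seq
        ((computes_drop _ _).seq (computes_ifCons_cons (q := .seq drop q)
          ((computes_drop (cons nil nil) _).seq (hp a s)))))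
      refine (h1.seq h2).mono ?_
      simp [esize]
      omega
    | false =>
      rw [h] at h1
      have h2 := (computes_unCons nil (cons nil nil) (enc a :: s)).seq ((computes_swap _ _ _).seq
        ((computes_drop _ _).seq (computes_ifCons_nil (p := .seq drop p)
          ((computes_drop nil _).seq (hq a s)))))
      refine (h1.seq h2).mono ?_
      simp [esize]
      omega

@[fun_prop]
theorem PolyTime.cons {f : α → β} {g : α → List β} (hf : PolyTime f) (hg : PolyTime g) :
    PolyTime fun x => f x :: g x :=
  (PolyTime.of_enc_eq (f := fun p : β × List β => p.1 :: p.2) fun _ => rfl).comp (hf.prodMk hg)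

/-- Case distinction on a list. -/
def caseList (l : List β) (d : δ) (h : β → List β → δ) : δ :=
  match l with
  | [] => d
  | b :: t => h b t

@[fun_prop]
theorem PolyTime.listCase {l : α → List β} {f : α → γ} {g : α × β × List β → γ}
    (hl : PolyTime l) (hf : PolyTime f) (hg : PolyTime g) :
    PolyTime fun x => caseList (l x) (f x) fun b t => g (x, b, t) := by
  have hlb := hl.bound
  obtain ⟨r, R, hr⟩ := hl
  obtain ⟨p, P, hp⟩ := hf
  obtain ⟨q, Q, hq⟩ := hg
  refine .of_bound (.seq (.seq dup r) (ifCons (.seq swap (.seq mkCons q)) (.seq drop p)))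
    (b := fun x => 18 * esize x + R.eval (esize x) + (P.eval (esize x) +
      Q.eval (esize x + esize (l x) + 1)) + 17 * (esize x + esize (l x)) + 200) ?_ fun a s => ?_
  · exact ((((((PolyBound.const 18).mul .id).add (.eval .id R)).add
      ((PolyBound.id.eval P).add (.eval ((PolyBound.id.add hlb).add (.const 1)) Q))).add
      ((PolyBound.const 17).mul (PolyBound.id.add hlb))).add (.const 200))
  · have h1 := (computes_dup (enc a) s).seq (hr a _)
    cases h : l a with
    | nil =>
      rw [h] at h1
      refine (h1.seq (computes_ifCons_nil ((computes_drop nil _).seq (hp a s)))).mono ?_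
      simp [esize]
      omega
    | cons b t =>
      rw [h] at h1
      -- A nonempty list has the code of the pair of its head and tail, so joining it with `a` gives
      -- the code of `(a, b, t)`.
      refine (h1.seq (computes_ifCons_cons ((computes_swap (enc (b :: t)) _ _).seq
        ((computes_mkCons _ _ _).seq (hq (a, b, t) s))))).mono ?_
      have e : esize (a, b, t) = esize a + esize (b :: t) + 1 := by
        rw [esize_mk, esize_mk, esize_cons]
      rw [e]
      simp only [esize]
      omega

@[fun_prop]
theorem PolyTime.tail {l : α → List β} (hl : PolyTime l) : PolyTime fun x => (l x).tail := by
  have : (fun x => (l x).tail) = fun x => caseList (l x) [] fun _ t => t := by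
    funext x
    cases l x <;> rfl
  rw [this]
  exact hl.listCase (.const []) (g := fun p => p.2.2) (by fun_prop)

@[fun_prop]
theorem PolyTime.headD {l : α → List β} {d : α → β} (hl : PolyTime l) (hd : PolyTime d) :
    PolyTime fun x => (l x).headD (d x) := by
  have : (fun x => (l x).headD (d x)) = fun x => caseList (l x) (d x) fun b _ => b := by
    funext x
    cases l x <;> rfl
  rw [this]
  exact hl.listCase hd (g := fun p => p.2.1) (by fun_prop)

/-! #### Folds -/

/-- The remaining list lies above the pair of parameter and accumulator, so the loop's test for an
empty tree is the test for an exhausted list. Beyond the call of `p`, a round costs 1 for packing, 2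
for unpacking and 3 for the loop. -/
theorem loopComputes_foldl {f : α × γ × β → γ} {p : Prog} {P : Polynomial ℕ}
    (hp : ∀ (a : (β × List β) × (α × γ)) s, Computes p (enc a :: s)
      (enc (a.1.2, (a.2.1, f (a.2.1, a.2.2, a.1.1))) :: s) (P.eval (esize a)))
    (x : α) (M N : ℕ) (st : List BTree) (l : List β) : ∀ (c : γ), esize l ≤ N →
      (∀ l', l' <+: l → esize (l'.foldl (fun s b => f (x, s, b)) c) ≤ M) →
      LoopComputes (.seq mkCons (.seq p unCons)) (enc l :: enc (x, c) :: st)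
        (nil :: enc (x, l.foldl (fun s b => f (x, s, b)) c) :: st)
        (l.length * (P.eval (N + (esize x + M + 1) + 1) + 6) + 1) := by
  induction l with
  | nil =>
    intro c _ _
    exact (loopComputes_nil _ _).mono (by simp)
  | cons b t ih =>
    intro c hN hM
    rw [esize_cons] at hN
    have hc : esize c ≤ M := hM [] List.nil_prefix
    have h1 := (computes_mkCons (enc (b :: t)) (enc (x, c)) st).seq
      ((hp ((b, t), (x, c)) st).seq (computes_unCons _ _ st))
    have h2 := ih (f (x, c, b)) (by omega) fun l' hl' =>
      hM (b :: l') ((List.prefix_cons_inj b).2 hl')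
    refine (loopComputes_cons h1 h2).mono ?_
    have h3 : P.eval (esize ((b, t), (x, c))) ≤ P.eval (N + (esize x + M + 1) + 1) := by
      refine eval_mono P ?_
      rw [esize_mk, esize_mk, esize_mk]
      omega
    rw [List.length_cons, Nat.succ_mul]
    omega

/-- Iterating a polynomial-time step can produce values of exponential size. The bound `m` on all
intermediate accumulators excludes this and makes every round polynomial in the original input. -/
theorem PolyTime.foldl {l : α → List β} {i : α → γ} {f : α × γ × β → γ} (hl : PolyTime l)
    (hi : PolyTime i) (hf : PolyTime f) {m : α → ℕ} (hm : PolyBound m)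
    (h : ∀ x l', l' <+: l x → esize (l'.foldl (fun s b => f (x, s, b)) (i x)) ≤ m x) :
    PolyTime fun x => (l x).foldl (fun s b => f (x, s, b)) (i x) := by
  have hlb := hl.bound
  have h0 : PolyTime fun x => (l x, (x, i x)) := by fun_prop
  have h1 : PolyTime fun a : (β × List β) × (α × γ) =>
      (a.1.2, (a.2.1, f (a.2.1, a.2.2, a.1.1))) := by fun_prop
  obtain ⟨q, Q, hq⟩ := h0
  obtain ⟨p, P, hp⟩ := h1
  refine .of_bound (.seq q (.seq unCons (.seq (whileCons (.seq mkCons (.seq p unCons)))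
    (.seq drop (.seq unCons drop))))) (b := fun x =>
      Q.eval (esize x) + esize (l x) * (P.eval (esize (l x) + (esize x + m x + 1) + 1) + 6) +
      27 * (esize x + m x) + 100) ?_ fun x s => ?_
  · exact (((PolyBound.id.eval Q).add (hlb.mul (((((hlb.add ((PolyBound.id.add hm).add
      (.const 1))).add (.const 1))).eval P).add (.const 6)))).add ((PolyBound.const 27).mul
      (PolyBound.id.add hm))).add (.const 100)
  · have h2 := loopComputes_foldl hp x (m x) (esize (l x)) s (l x) (i x) le_rfl (h x)
    have h3 := h x (l x) List.prefix_rfl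
    refine ((hq x s).seq ((computes_unCons _ _ _).seq (h2.whileCons.seq ((computes_drop _ _).seq
      ((computes_unCons _ _ _).seq (computes_drop _ _)))))).mono ?_
    have h4 := Nat.mul_le_mul_right
      (P.eval (esize (l x) + (esize x + m x + 1) + 1) + 6) (length_le_esize (l x))
    rw [size_nil]
    simp only [esize] at *
    omega

/-- A fold that ignores the entries: the list only serves as a clock. -/
theorem PolyTime.iterate {l : α → List β} {i : α → γ} {f : α × γ → γ} (hl : PolyTime l)
    (hi : PolyTime i) (hf : PolyTime f) {m : α → ℕ} (hm : PolyBound m)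
    (h : ∀ x k, k ≤ (l x).length → esize ((fun s => f (x, s))^[k] (i x)) ≤ m x) :
    PolyTime fun x => (fun s => f (x, s))^[(l x).length] (i x) := by
  have := PolyTime.foldl (f := fun p : α × γ × β => f (p.1, p.2.1)) hl hi (by fun_prop) hm
    fun x l' hl' => by
      change esize (l'.foldl (fun s _ => f (x, s)) (i x)) ≤ m x
      rw [List.foldl_const]
      exact h x _ hl'.length_le
  simpa only [List.foldl_const] using this

@[fun_prop]
theorem PolyTime.reverse {l : α → List β} (hl : PolyTime l) : PolyTime fun x => (l x).reverse := by
  have h (t : List β) : ∀ s, t.foldl (fun s b => b :: s) s = t.reverse ++ s := by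
    induction t with
    | nil => simp
    | cons b t ih => simp [ih]
  have := PolyTime.foldl (f := fun p : α × List β × β => p.2.2 :: p.2.1) hl (.const []) (by fun_prop)
    hl.bound fun x l' hl' => by
      simp only [h, List.append_nil, esize_reverse]
      exact esize_le_of_prefix hl'
  simpa only [h, List.append_nil] using this

end Closure

end StackMachine

/-! ### Binary arithmetic in polynomial time -/

namespace StackMachine

open BTree
open Enc (enc)

section Bool

variable {α β γ : Type} [Enc α] [Enc β] [Enc γ]

/-- Functions with equal codes share a program. This identifies a number with its list of digits, or
a structure with a tuple. -/
theorem PolyTime.of_enc_comp {g : α → β} {f : α → γ} (hg : PolyTime g)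
    (h : ∀ a, enc (f a) = enc (g a)) : PolyTime f := by
  obtain ⟨p, P, hp⟩ := hg
  refine ⟨p, P, fun a s => ?_⟩
  rw [h]
  exact hp a s

theorem polyTime_of_bool (f : Bool → β) : PolyTime f := by
  have : f = fun b => bif b then f true else f false := by
    funext b
    cases b <;> rfl
  rw [this]
  fun_prop

theorem polyTime_of_bool₃ (f : Bool × Bool × Bool → β) : PolyTime f := by
  have : f = fun p => bif p.1 then (bif p.2.1 then (bif p.2.2 then f (true, true, true) else
      f (true, true, false)) else (bif p.2.2 then f (true, false, true) else
      f (true, false, false))) else (bif p.2.1 then (bif p.2.2 then f (false, true, true) else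
      f (false, true, false)) else (bif p.2.2 then f (false, false, true) else
      f (false, false, false))) := by
    funext ⟨a, b, c⟩
    cases a <;> cases b <;> cases c <;> rfl
  rw [this]
  fun_prop

@[fun_prop]
theorem PolyTime.not {c : α → Bool} (hc : PolyTime c) : PolyTime fun x => !c x :=
  (polyTime_of_bool fun b => !b).comp hc

@[fun_prop]
theorem PolyTime.and {c d : α → Bool} (hc : PolyTime c) (hd : PolyTime d) :
    PolyTime fun x => c x && d x := by
  have : (fun x => c x && d x) = fun x => bif c x then d x else false := by
    funext x
    cases c x <;> rfl
  rw [this]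
  fun_prop

theorem PolyTime.ite {c : α → Prop} [DecidablePred c] {f g : α → β}
    (hc : PolyTime fun x => decide (c x)) (hf : PolyTime f) (hg : PolyTime g) :
    PolyTime fun x => if c x then f x else g x := by
  have : (fun x => if c x then f x else g x) = fun x => bif decide (c x) then f x else g x := by
    funext x
    by_cases h : c x <;> simp [h]
  rw [this]
  fun_prop

@[fun_prop]
theorem PolyTime.append {l l' : α → List β} (hl : PolyTime l) (hl' : PolyTime l') :
    PolyTime fun x => l x ++ l' x := by
  have h (t : List β) : ∀ s, t.foldl (fun s b => b :: s) s = t.reverse ++ s := by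
    induction t with
    | nil => simp
    | cons b t ih => simp [ih]
  have := PolyTime.foldl (f := fun p : α × List β × β => p.2.2 :: p.2.1) hl.reverse hl'
    (by fun_prop) (hl.bound.add hl'.bound) fun x t ht => by
      have h1 := esize_append t.reverse (l' x)
      have h2 := esize_le_of_prefix ht
      rw [esize_reverse] at h1 h2
      simp only [h]
      omega
  simpa only [h, List.reverse_reverse] using this

end Bool

/-- Recursion along the binary digits, the most significant one first. -/
def bitFold {γ : Type} (g : γ → Bool → γ) (c : γ) (n : ℕ) : γ := n.bits.reverse.foldl g c

theorem bitFold_zero {γ : Type} (g : γ → Bool → γ) (c : γ) : bitFold g c 0 = c := by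
  simp [bitFold]

theorem bitFold_bit {γ : Type} (g : γ → Bool → γ) (c : γ) (b : Bool) (n : ℕ) (h : n = 0 → b = true) :
    bitFold g c (Nat.bit b n) = g (bitFold g c n) b := by
  rw [bitFold, Nat.bits_append_bit _ _ h]
  simp [bitFold]

section Bits

variable {α β γ : Type} [Enc α] [Enc β] [Enc γ]

@[fun_prop]
theorem PolyTime.bits {n : α → ℕ} (hn : PolyTime n) : PolyTime fun x => (n x).bits :=
  hn.of_enc_comp fun _ => rfl

@[fun_prop]
theorem PolyTime.bodd {n : α → ℕ} (hn : PolyTime n) : PolyTime fun x => (n x).bodd := by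
  have : (fun x => (n x).bodd) = fun x => (n x).bits.headD false := by
    funext x
    rw [Nat.bodd_eq_bits_head]
    cases (n x).bits <;> rfl
  rw [this]
  fun_prop

@[fun_prop]
theorem PolyTime.div2 {n : α → ℕ} (hn : PolyTime n) : PolyTime fun x => (n x).div2 :=
  hn.bits.tail.of_enc_comp fun _ => congrArg encList (Nat.div2_bits_eq_tail _)

theorem PolyTime.decide_eq_zero {n : α → ℕ} (hn : PolyTime n) :
    PolyTime fun x => decide (n x = 0) := by
  have : (fun x => decide (n x = 0)) = fun x => caseList (n x).bits true fun _ _ => false := by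
    funext x
    rcases Nat.eq_zero_or_pos (n x) with h | h
    · simp [h, caseList]
    · have h1 : (n x).bits.length ≠ 0 := by
        rw [Nat.size_eq_bits_len]
        exact (Nat.size_pos.2 h).ne'
      cases h2 : (n x).bits with
      | nil => simp [h2] at h1
      | cons b t => simp [caseList, h.ne']
  rw [this]
  exact hn.bits.listCase (.const true) (g := fun _ => false) (.const _)

@[fun_prop]
theorem PolyTime.bit {b : α → Bool} {n : α → ℕ} (hb : PolyTime b) (hn : PolyTime n) :
    PolyTime fun x => Nat.bit (b x) (n x) := by
  -- Binary expansions have no leading zeros, so the digit `false` in front of the empty expansion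
  -- must disappear.
  have h1 : PolyTime fun x => if n x = 0 then (bif b x then [true] else []) else
      b x :: (n x).bits := .ite hn.decide_eq_zero (by fun_prop) (by fun_prop)
  refine h1.of_enc_comp fun x => congrArg encList ?_
  by_cases h : n x = 0
  · cases hb : b x <;> simp [h]
  · rw [if_neg h, Nat.bits_append_bit _ _ fun h' => absurd h' h]

theorem size_bit_le (b : Bool) (n : ℕ) : (Nat.bit b n).size ≤ n.size + 1 := by
  rw [Nat.size_le, Nat.bit_lt_two_pow_succ_iff]
  exact Nat.lt_size_self n

/-- Leading digits of `n` are the digits of some `m ≤ n`. Intermediate values of a `bitFold` are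
thus values of the same function at smaller arguments, which bounds their size. -/
theorem exists_of_prefix_bits (n : ℕ) : ∀ l, l <+: n.bits.reverse →
    ∃ m ≤ n, l = m.bits.reverse := by
  induction n using Nat.binaryRec' with
  | zero => exact fun l hl => ⟨0, le_rfl, by simpa using hl⟩
  | bit b n h ih =>
    intro l hl
    rw [Nat.bits_append_bit _ _ h, List.reverse_cons, List.prefix_concat_iff] at hl
    rcases hl with hl | hl
    · exact ⟨Nat.bit b n, le_rfl, by rw [Nat.bits_append_bit _ _ h, List.reverse_cons, hl]⟩
    · obtain ⟨m, hm, rfl⟩ := ih l hl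
      refine ⟨m, hm.trans ?_, rfl⟩
      rw [Nat.bit_val]
      omega

theorem PolyTime.bitFold {n : α → ℕ} {i : α → γ} {f : α × γ × Bool → γ} (hn : PolyTime n)
    (hi : PolyTime i) (hf : PolyTime f) {m : α → ℕ} (hm : PolyBound m)
    (h : ∀ x k, k ≤ n x → esize (bitFold (fun s b => f (x, s, b)) (i x) k) ≤ m x) :
    PolyTime fun x => bitFold (fun s b => f (x, s, b)) (i x) (n x) :=
  PolyTime.foldl hn.bits.reverse hi hf hm fun x l hl => by
    obtain ⟨k, hk, rfl⟩ := exists_of_prefix_bits _ _ hl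
    exact h x k hk

/-- The number with given binary digits, the most significant one first, after the digits
of `c`. -/
def ofDigits (c : ℕ) (l : List Bool) : ℕ := l.foldl (fun s b => Nat.bit b s) c

theorem size_ofDigits_le (l : List Bool) : ∀ c, (ofDigits c l).size ≤ c.size + l.length := by
  induction l with
  | nil => exact fun c => le_rfl
  | cons b l ih =>
    intro c
    have h1 := ih (Nat.bit b c)
    have h2 := size_bit_le b c
    have h3 : ofDigits c (b :: l) = ofDigits (Nat.bit b c) l := rfl
    rw [h3, List.length_cons]
    omega

@[fun_prop]
theorem PolyTime.ofDigits {c : α → ℕ} {l : α → List Bool} (hc : PolyTime c) (hl : PolyTime l) :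
    PolyTime fun x => ofDigits (c x) (l x) :=
  PolyTime.foldl (f := fun p : α × ℕ × Bool => Nat.bit p.2.2 p.2.1) hl hc (by fun_prop)
    (hc.bound.add ((PolyBound.const 6).mul hl.bound)) fun x t ht => by
      have h1 := size_ofDigits_le t (c x)
      have h2 := length_le_esize (l x)
      have h3 := ht.length_le
      change esize (StackMachine.ofDigits (c x) t) ≤ _
      rw [esize_nat, esize_nat]
      omega

/-! #### Addition and subtraction -/

/-- One step of a serial automaton with transition function `t` that reads the digits of two
numbers, the least significant one first. -/
def serialStep (t : Bool × Bool × Bool → Bool × Bool) (s : (ℕ × ℕ) × (Bool × List Bool)) :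
    (ℕ × ℕ) × (Bool × List Bool) :=
  ((s.1.1.div2, s.1.2.div2), ((t (s.1.1.bodd, s.1.2.bodd, s.2.1)).1,
    (t (s.1.1.bodd, s.1.2.bodd, s.2.1)).2 :: s.2.2))

/-- The final state and the output, most significant digit first, of a serial automaton. -/
def serial (t : Bool × Bool × Bool → Bool × Bool) (m n : ℕ) : (ℕ × ℕ) × (Bool × List Bool) :=
  (serialStep t)^[(m.bits ++ n.bits).length] ((m, n), (false, []))

theorem serial_invariant (t : Bool × Bool × Bool → Bool × Bool) (m n : ℕ) (k : ℕ) :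
    ((serialStep t)^[k] ((m, n), (false, []))).1 = (m / 2 ^ k, n / 2 ^ k) ∧
      ((serialStep t)^[k] ((m, n), (false, []))).2.2.length = k := by
  induction k with
  | zero => simp
  | succ k ih =>
    rw [Function.iterate_succ_apply']
    simp only [serialStep, ih.1, ih.2, Nat.div2_val, Nat.div_div_eq_div_mul, pow_succ,
      List.length_cons, and_self]

/-- The number of steps is the sum of the two digit counts, enough to consume both numbers. -/
theorem serial_fst (t : Bool × Bool × Bool → Bool × Bool) (m n : ℕ) :
    (serial t m n).1 = (0, 0) := by
  rw [serial, (serial_invariant t m n _).1, List.length_append, Nat.size_eq_bits_len,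
    Nat.size_eq_bits_len, Nat.div_eq_of_lt, Nat.div_eq_of_lt]
  · exact (Nat.lt_size_self n).trans_le (Nat.pow_le_pow_right two_pos (by omega))
  · exact (Nat.lt_size_self m).trans_le (Nat.pow_le_pow_right two_pos (by omega))

@[fun_prop]
theorem PolyTime.serial (t : Bool × Bool × Bool → Bool × Bool) {m n : α → ℕ} (hm : PolyTime m)
    (hn : PolyTime n) : PolyTime fun x => serial t (m x) (n x) := by
  have ht : PolyTime t := polyTime_of_bool₃ t
  have h1 : PolyTime fun p : α × ((ℕ × ℕ) × (Bool × List Bool)) => serialStep t p.2 := by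
    unfold serialStep
    fun_prop
  have hl : PolyTime fun x => (m x).bits ++ (n x).bits := by fun_prop
  refine PolyTime.iterate (f := fun p => serialStep t p.2) hl
    (i := fun x => ((m x, n x), (false, ([] : List Bool)))) (by fun_prop) h1
    (m := fun x => esize (m x) + esize (n x) + 6 * esize ((m x).bits ++ (n x).bits) + 10)
    (((hm.bound.add hn.bound).add ((PolyBound.const 6).mul hl.bound)).add (.const 10))
    fun x k hk => ?_
  obtain ⟨h2, h3⟩ := serial_invariant t (m x) (n x) k
  have h4 := length_le_esize ((m x).bits ++ (n x).bits)
  change esize ((serialStep t)^[k] ((m x, n x), (false, []))) ≤ _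
  rw [esize_prod, h2, esize_prod (Prod.snd _), esize_bools, h3, esize_bool, esize_mk]
  have h5 : esize (m x / 2 ^ k) ≤ esize (m x) := esize_nat_mono (Nat.div_le_self _ _)
  have h6 : esize (n x / 2 ^ k) ≤ esize (n x) := esize_nat_mono (Nat.div_le_self _ _)
  omega

/-- The transition function of the adder. -/
def adder (p : Bool × Bool × Bool) : Bool × Bool :=
  ((p.1 && p.2.1) || (p.2.2 && (p.1 || p.2.1)), (p.1 ^^ (p.2.1 ^^ p.2.2)))

theorem add_eq_serial (m n : ℕ) :
    m + n = ofDigits (serial adder m n).2.1.toNat (serial adder m n).2.2 := by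
  -- Invariant: the remaining operands plus the carry, followed by the digits already written,
  -- represent the sum. In the end only the carry is left in front of the digits.
  have step (s : (ℕ × ℕ) × (Bool × List Bool)) :
      ofDigits ((serialStep adder s).1.1 + (serialStep adder s).1.2 +
        (serialStep adder s).2.1.toNat) (serialStep adder s).2.2 =
      ofDigits (s.1.1 + s.1.2 + s.2.1.toNat) s.2.2 := by
    obtain ⟨⟨u, v⟩, c, l⟩ := s
    refine congrArg (fun c => ofDigits c l) ?_
    have hu := Nat.bodd_add_div2 u
    have hv := Nat.bodd_add_div2 v
    simp only [serialStep, adder, Nat.bit_val]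
    generalize u.bodd = bu at *
    generalize v.bodd = bv at *
    cases bu <;> cases bv <;> cases c <;> simp at hu hv ⊢ <;> omega
  have inv (k : ℕ) (s : (ℕ × ℕ) × (Bool × List Bool)) :
      ofDigits (((serialStep adder)^[k] s).1.1 + ((serialStep adder)^[k] s).1.2 +
        ((serialStep adder)^[k] s).2.1.toNat) ((serialStep adder)^[k] s).2.2 =
      ofDigits (s.1.1 + s.1.2 + s.2.1.toNat) s.2.2 := by
    induction k generalizing s with
    | zero => rfl
    | succ k ih => rw [Function.iterate_succ_apply, ih, step]
  have h := inv ((m.bits ++ n.bits).length) ((m, n), (false, []))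
  have h0 := serial_fst adder m n
  change ofDigits ((serial adder m n).1.1 + (serial adder m n).1.2 +
    (serial adder m n).2.1.toNat) (serial adder m n).2.2 = m + n + 0 at h
  rw [h0] at h
  simpa using h.symm

@[fun_prop]
theorem PolyTime.add {m n : α → ℕ} (hm : PolyTime m) (hn : PolyTime n) :
    PolyTime fun x => m x + n x := by
  have h : PolyTime Bool.toNat := polyTime_of_bool _
  simp only [add_eq_serial]
  fun_prop

/-- The transition function of the subtractor. -/
def subtractor (p : Bool × Bool × Bool) : Bool × Bool :=
  ((!p.1 && p.2.1) || (p.2.2 && (!p.1 || p.2.1)), (p.1 ^^ (p.2.1 ^^ p.2.2)))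

/-- The integer with given binary digits after the digits of `c`. -/
def ofDigitsInt (c : ℤ) (l : List Bool) : ℤ := l.foldl (fun s b => 2 * s + b.toNat) c

theorem ofDigitsInt_natCast (l : List Bool) : ∀ c : ℕ, ofDigitsInt c l = ofDigits c l := by
  induction l with
  | nil => exact fun c => rfl
  | cons b l ih =>
    intro c
    have h := ih (Nat.bit b c)
    rw [Nat.bit_val] at h
    push_cast at h
    change ofDigitsInt (2 * c + b.toNat) l = ofDigits (Nat.bit b c) l
    rw [h, Nat.bit_val]

theorem ofDigitsInt_neg (l : List Bool) : ∀ c : ℤ, c < 0 → ofDigitsInt c l < 0 := by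
  induction l with
  | nil => exact fun c hc => hc
  | cons b l ih =>
    intro c hc
    refine ih _ ?_
    cases b <;> simp <;> omega

/-- The invariant of addition with a borrow, over `ℤ`. The final borrow acts as a leading digit `-1`
and so decides the sign of the difference. -/
theorem sub_eq_serial (m n : ℕ) :
    (m : ℤ) - n = ofDigitsInt (-(serial subtractor m n).2.1.toNat)
      (serial subtractor m n).2.2 := by
  have step (s : (ℕ × ℕ) × (Bool × List Bool)) :
      ofDigitsInt ((serialStep subtractor s).1.1 - (serialStep subtractor s).1.2 -
        (serialStep subtractor s).2.1.toNat) (serialStep subtractor s).2.2 =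
      ofDigitsInt (s.1.1 - s.1.2 - s.2.1.toNat) s.2.2 := by
    obtain ⟨⟨u, v⟩, c, l⟩ := s
    refine congrArg (fun c => ofDigitsInt c l) ?_
    have hu := Nat.bodd_add_div2 u
    have hv := Nat.bodd_add_div2 v
    simp only [serialStep, subtractor]
    generalize u.bodd = bu at *
    generalize v.bodd = bv at *
    cases bu <;> cases bv <;> cases c <;> simp at hu hv ⊢ <;> omega
  have inv (k : ℕ) (s : (ℕ × ℕ) × (Bool × List Bool)) :
      ofDigitsInt (((serialStep subtractor)^[k] s).1.1 - ((serialStep subtractor)^[k] s).1.2 -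
        ((serialStep subtractor)^[k] s).2.1.toNat) ((serialStep subtractor)^[k] s).2.2 =
      ofDigitsInt (s.1.1 - s.1.2 - s.2.1.toNat) s.2.2 := by
    induction k generalizing s with
    | zero => rfl
    | succ k ih => rw [Function.iterate_succ_apply, ih, step]
  have h := inv ((m.bits ++ n.bits).length) ((m, n), (false, []))
  have h0 := serial_fst subtractor m n
  change ofDigitsInt ((serial subtractor m n).1.1 - (serial subtractor m n).1.2 -
    (serial subtractor m n).2.1.toNat) (serial subtractor m n).2.2 = m - n - 0 at h
  rw [h0] at h
  simpa using h.symm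

theorem lt_iff_serial (m n : ℕ) : m < n ↔ (serial subtractor m n).2.1 = true := by
  have h := sub_eq_serial m n
  cases hc : (serial subtractor m n).2.1 with
  | true =>
    rw [hc] at h
    have := ofDigitsInt_neg (serial subtractor m n).2.2 (-(true.toNat : ℤ)) (by simp)
    simp only [iff_true]
    omega
  | false =>
    rw [hc] at h
    have h1 := ofDigitsInt_natCast (serial subtractor m n).2.2 0
    simp only [Bool.toNat_false, Nat.cast_zero, neg_zero] at h h1
    simp only [Bool.false_eq_true, iff_false]
    omega

theorem tsub_eq_serial (m n : ℕ) : m - n =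
    bif (serial subtractor m n).2.1 then 0 else ofDigits 0 (serial subtractor m n).2.2 := by
  have h := sub_eq_serial m n
  cases hc : (serial subtractor m n).2.1 with
  | true =>
    have := (lt_iff_serial m n).2 hc
    simp only [cond_true]
    omega
  | false =>
    rw [hc] at h
    have h1 := ofDigitsInt_natCast (serial subtractor m n).2.2 0
    simp only [Bool.toNat_false, Nat.cast_zero, neg_zero] at h h1
    simp only [cond_false]
    omega

@[fun_prop]
theorem PolyTime.sub {m n : α → ℕ} (hm : PolyTime m) (hn : PolyTime n) :
    PolyTime fun x => m x - n x := by
  simp only [tsub_eq_serial]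
  fun_prop

theorem PolyTime.decide_lt {m n : α → ℕ} (hm : PolyTime m) (hn : PolyTime n) :
    PolyTime fun x => decide (m x < n x) := by
  simp only [lt_iff_serial, Bool.decide_eq_true]
  fun_prop

/-! #### Multiplication and division -/

theorem mul_eq_bitFold (m n : ℕ) :
    m * n = bitFold (fun s b => Nat.bit false s + bif b then n else 0) 0 m := by
  induction m using Nat.binaryRec' with
  | zero => simp [bitFold_zero]
  | bit b m h ih =>
    rw [bitFold_bit _ _ _ _ h, ← ih, Nat.bit_val, Nat.bit_val]
    cases b <;> simp <;> ring

theorem size_mul_le (m n : ℕ) : (m * n).size ≤ m.size + n.size := by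
  rw [Nat.size_le, pow_add]
  exact Nat.mul_lt_mul'' (Nat.lt_size_self m) (Nat.lt_size_self n)

@[fun_prop]
theorem PolyTime.mul {m n : α → ℕ} (hm : PolyTime m) (hn : PolyTime n) :
    PolyTime fun x => m x * n x := by
  simp only [mul_eq_bitFold]
  refine PolyTime.bitFold (f := fun p : α × ℕ × Bool => Nat.bit false p.2.1 +
    bif p.2.2 then n p.1 else 0) hm (.const 0) (by fun_prop) (hm.bound.add hn.bound)
    fun x k hk => ?_
  change esize (StackMachine.bitFold (fun s b => Nat.bit false s + bif b then n x else 0) 0 k) ≤ _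
  -- Horner's scheme: the partial result is `k * n x` with `k ≤ m x`.
  rw [← mul_eq_bitFold]
  refine (esize_nat_mono (Nat.mul_le_mul_right _ hk)).trans ?_
  have := size_mul_le (m x) (n x)
  rw [esize_nat, esize_nat, esize_nat]
  omega

/-- One step of the division by `n`. -/
def divStep (n : ℕ) (s : ℕ × ℕ) (b : Bool) : ℕ × ℕ :=
  bif !decide (n = 0) && !decide (Nat.bit b s.2 < n) then
    (Nat.bit true s.1, Nat.bit b s.2 - n) else (Nat.bit false s.1, Nat.bit b s.2)

/-- Long division: if `r < n` is the remainder so far, then `2 * r + b < 2 * n`, so the next digit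
of the quotient is 0 or 1. The test for `n = 0` reproduces the conventions `m / 0 = 0` and `m % 0 =
m`. -/
theorem divMod_eq_bitFold (m n : ℕ) : (m / n, m % n) = bitFold (divStep n) (0, 0) m := by
  induction m using Nat.binaryRec' with
  | zero => simp [bitFold_zero]
  | bit b m h ih =>
    rw [bitFold_bit _ _ _ _ h, ← ih]
    rcases Nat.eq_zero_or_pos n with rfl | hn
    · simp [divStep]
    have h1 := Nat.div_add_mod m n
    have h2 := Nat.mod_lt m hn
    have h3 : b.toNat ≤ 1 := by cases b <;> simp
    simp only [divStep, Nat.bit_val, hn.ne', decide_false, Bool.not_false, Bool.true_and]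
    by_cases hlt : 2 * (m % n) + b.toNat < n
    · have e : 2 * m + b.toNat = (2 * (m % n) + b.toNat) + n * (2 * (m / n)) := by
        conv_lhs => rw [← h1]
        ring
      simp only [hlt, decide_true, Bool.not_true, cond_false]
      rw [e, Nat.add_mul_div_left _ _ hn, Nat.add_mul_mod_self_left, Nat.div_eq_of_lt hlt,
        Nat.mod_eq_of_lt hlt]
      simp
    · have e : 2 * m + b.toNat = (2 * (m % n) + b.toNat - n) + n * (2 * (m / n) + 1) := by
        conv_lhs => rw [← h1]
        have : n * (2 * (m / n) + 1) = 2 * (n * (m / n)) + n := by ring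
        omega
      have hlt' : 2 * (m % n) + b.toNat - n < n := by omega
      simp only [hlt, decide_false, Bool.not_false, cond_true]
      rw [e, Nat.add_mul_div_left _ _ hn, Nat.add_mul_mod_self_left, Nat.div_eq_of_lt hlt',
        Nat.mod_eq_of_lt hlt']
      simp

theorem PolyTime.divMod {m n : α → ℕ} (hm : PolyTime m) (hn : PolyTime n) :
    PolyTime fun x => (m x / n x, m x % n x) := by
  simp only [divMod_eq_bitFold]
  have h1 : PolyTime fun p : α × (ℕ × ℕ) × Bool => decide (n p.1 = 0) :=
    PolyTime.decide_eq_zero (by fun_prop)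
  have h2 : PolyTime fun p : α × (ℕ × ℕ) × Bool => decide (Nat.bit p.2.2 p.2.1.2 < n p.1) :=
    PolyTime.decide_lt (by fun_prop) (by fun_prop)
  refine PolyTime.bitFold (f := fun p : α × (ℕ × ℕ) × Bool => divStep (n p.1) p.2.1 p.2.2)
    hm (.const (0, 0)) (by unfold divStep; fun_prop)
    ((hm.bound.add hm.bound).add (.const 1)) fun x k hk => ?_
  change esize (StackMachine.bitFold (divStep (n x)) (0, 0) k) ≤ _
  rw [← divMod_eq_bitFold, esize_mk]
  have h3 := esize_nat_mono ((Nat.div_le_self k (n x)).trans hk)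
  have h4 := esize_nat_mono ((Nat.mod_le k (n x)).trans hk)
  omega

@[fun_prop]
theorem PolyTime.div {m n : α → ℕ} (hm : PolyTime m) (hn : PolyTime n) :
    PolyTime fun x => m x / n x := (hm.divMod hn).fst

@[fun_prop]
theorem PolyTime.mod {m n : α → ℕ} (hm : PolyTime m) (hn : PolyTime n) :
    PolyTime fun x => m x % n x := (hm.divMod hn).snd

end Bits

end StackMachine

/-! ### Reading the input and writing the output -/

namespace StackMachine

open BTree
open Enc (enc)

instance : Enc Letter := ⟨fun
  | .zero => nil
  | .one => cons nil nil
  | .endMark => cons nil (cons nil nil)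
  | .minus => cons nil (cons nil (cons nil nil))⟩

theorem esize_letter_le (a : Letter) : esize a ≤ 7 := by
  cases a <;> simp [esize, enc]

theorem esize_letters_le (l : List Letter) : esize l ≤ 8 * l.length + 1 := by
  induction l with
  | nil => exact le_rfl
  | cons a l ih =>
    have := esize_letter_le a
    rw [esize_cons, List.length_cons]
    omega

/-- Push a fixed word. -/
def pushWord : List Letter → Prog
  | [] => skip
  | a :: w => .seq (pushWord w) (.push .x fun _ => a)

theorem exec_pushWord (w : List Letter) {v : Option Letter} {i o x y z c : List Letter} :
    Exec (pushWord w) ⟨v, i, o, x, y, z, c⟩ ⟨v, i, o, w ++ x, y, z, c⟩ (w.length + 1) := by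
  induction w with
  | nil => exact Exec.skip _
  | cons a w ih => exact Exec.seq ih (Exec.push _ _ _)

/-- Test for a letter. -/
def isLetter : Letter → Option Letter → Bool
  | .zero, some .zero => true
  | .one, some .one => true
  | .minus, some .minus => true
  | _, _ => false

/-- Add the letter read last to the list on the stack `x`. -/
def readLetter : Prog :=
  .ite (isLetter .zero) (pushWord (.one :: (enc Letter.zero).word))
    (.ite (isLetter .one) (pushWord (.one :: (enc Letter.one).word))
      (.ite (isLetter .minus) (pushWord (.one :: (enc Letter.minus).word))
        (pushWord (.one :: (enc Letter.endMark).word))))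

theorem exec_readLetter (a : Letter) (l : List Letter) {i o y z c : List Letter} :
    Exec readLetter ⟨some a, i, o, (enc l).word, y, z, c⟩
      ⟨some a, i, o, (enc (a :: l)).word, y, z, c⟩ 12 := by
  cases a with
  | zero => exact Exec.mono (Exec.ite_true rfl (exec_pushWord _)) (by simp [enc, word])
  | one =>
    exact Exec.mono (Exec.ite_false rfl (Exec.ite_true rfl (exec_pushWord _)))
      (by simp [enc, word])
  | minus =>
    exact Exec.mono (Exec.ite_false rfl (Exec.ite_false rfl (Exec.ite_true rfl
      (exec_pushWord _)))) (by simp [enc, word])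
  | endMark =>
    exact Exec.mono (Exec.ite_false rfl (Exec.ite_false rfl (Exec.ite_false rfl
      (exec_pushWord _)))) (by simp [enc, word])

/-- Turn the input into a list on the stack `x`, reversing it. -/
def readInput : Prog :=
  .seq pushNil (.seq (.pop .inp) (.loop Option.isSome (.seq readLetter (.pop .inp))))

/-- Pushing letter by letter reverses the input. Each number then begins with its end mark and its
most significant digit, which is the order that `parseStep` expects. -/
theorem exec_readInput (w : List Letter) :
    Exec readInput ⟨none, w, [], [], [], [], []⟩ (treeMem [] [] [enc w.reverse])
      (14 * w.length + 3) := by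
  have h (w : List Letter) : ∀ l : List Letter,
      Exec (.loop Option.isSome (.seq readLetter (.pop .inp)))
        ⟨w.head?, w.tail, [], (enc l).word, [], [], []⟩
        ⟨none, [], [], (enc (w.reverse ++ l)).word, [], [], []⟩ (14 * w.length + 1) := by
    induction w with
    | nil => exact fun l => Exec.loop_false rfl
    | cons a w ih =>
      intro l
      refine Exec.mono (Exec.loop_true rfl (Exec.seq (exec_readLetter a l) (Exec.pop .inp _))
        (t₂ := 14 * w.length + 1) ?_) (by simp; omega)
      simp only [List.reverse_cons, List.append_assoc]
      exact ih (a :: l)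
  have h' := h w []
  rw [List.append_nil, ← List.append_nil (enc w.reverse).word] at h'
  exact Exec.mono (Exec.seq (Exec.push _ _ _) (Exec.seq (Exec.pop .inp _) h')) (by omega)

/-- Write a letter, whose code is on the stack `x`, to the output. -/
def writeLetter : Prog :=
  .seq (.pop .x) (.ite isOne (.seq (.pop .x) (.seq (.pop .x) (.ite isOne (.seq (.pop .x)
    (.seq (.pop .x) (.ite isOne (.seq (.pop .x) (.seq (.pop .x) (.push .out fun _ => .minus)))
    (.push .out fun _ => .endMark)))) (.push .out fun _ => .one)))) (.push .out fun _ => .zero))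

theorem exec_writeLetter (a : Letter) {v : Option Letter} {i o x y z c : List Letter} :
    ∃ v', Exec writeLetter ⟨v, i, o, (enc a).word ++ x, y, z, c⟩
      ⟨v', i, a :: o, x, y, z, c⟩ 12 := by
  cases a with
  | zero => exact ⟨_, Exec.mono (Exec.seq (Exec.pop _ _) (Exec.ite_false rfl (Exec.push _ _ _)))
      (by omega)⟩
  | one => exact ⟨_, Exec.mono (Exec.seq (Exec.pop _ _) (Exec.ite_true rfl (Exec.seq
      (Exec.pop _ _) (Exec.seq (Exec.pop _ _) (Exec.ite_false rfl (Exec.push _ _ _))))))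
      (by omega)⟩
  | endMark => exact ⟨_, Exec.mono (Exec.seq (Exec.pop _ _) (Exec.ite_true rfl (Exec.seq
      (Exec.pop _ _) (Exec.seq (Exec.pop _ _) (Exec.ite_true rfl (Exec.seq (Exec.pop _ _)
      (Exec.seq (Exec.pop _ _) (Exec.ite_false rfl (Exec.push _ _ _)))))))))
      (by omega)⟩
  | minus => exact ⟨_, Exec.mono (Exec.seq (Exec.pop _ _) (Exec.ite_true rfl (Exec.seq
      (Exec.pop _ _) (Exec.seq (Exec.pop _ _) (Exec.ite_true rfl (Exec.seq (Exec.pop _ _)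
      (Exec.seq (Exec.pop _ _) (Exec.ite_true rfl (Exec.seq (Exec.pop _ _)
      (Exec.seq (Exec.pop _ _) (Exec.push _ _ _))))))))))) (by omega)⟩

/-- Write a list of letters on the stack `x` to the output, reversing it. -/
def writeResult : Prog := .seq (.pop .x) (.loop isOne (.seq writeLetter (.pop .x)))

theorem exec_writeResult (l : List Letter) : ∃ v,
    Exec writeResult (treeMem [] [] [enc l]) ⟨v, [], l.reverse, [], [], [], []⟩
      (14 * l.length + 2) := by
  have h (l : List Letter) : ∀ o : List Letter,
      Exec (.loop isOne (.seq writeLetter (.pop .x)))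
        ⟨(enc l).word.head?, [], o, (enc l).word.tail, [], [], []⟩
        ⟨some .zero, [], l.reverse ++ o, [], [], [], []⟩ (14 * l.length + 1) := by
    induction l with
    | nil => exact fun o => Exec.loop_false rfl
    | cons a l ih =>
      intro o
      obtain ⟨v', hv'⟩ := exec_writeLetter a (v := some .one) (i := []) (o := o)
        (x := (enc l).word) (y := []) (z := []) (c := [])
      refine Exec.mono (Exec.loop_true rfl (Exec.seq hv' (Exec.pop .x _))
        (t₂ := 14 * l.length + 1) ?_) (by simp; omega)
      simp only [List.reverse_cons, List.append_assoc]
      exact ih (a :: o)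
  have h' := h l []
  rw [List.append_nil] at h'
  refine ⟨some .zero, Exec.mono (Exec.seq (Exec.pop .x _) (t₂ := 14 * l.length + 1) ?_)
    (by omega)⟩
  simpa [treeMem, Mem.get, Mem.set, Mem.setV] using h'

/-- A function is computable in polynomial time if it is, on reversed words, the restriction of
a function in the class `PolyTime`. -/
theorem nonempty_computable_of_polyTime {α β : Type} {wIn : α → List Letter}
    {wOut : β → List Letter} {f : α → β} {F : List Letter → List Letter} (hF : PolyTime F)
    (h : ∀ a, F (wIn a).reverse = (wOut (f a)).reverse) :
    Nonempty (Turing.TM2ComputableInPolyTime wIn wOut f) := by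
  obtain ⟨Q, hQ⟩ := hF.bound
  obtain ⟨p, P, hp⟩ := hF
  let S : Polynomial ℕ := 8 * Polynomial.X + 1
  refine nonempty_computable wIn wOut f (.seq readInput (.seq p writeResult))
    (14 * Polynomial.X + 3 + (P.comp S + (14 * Q.comp S + 2))) fun a => ?_
  obtain ⟨v, hv⟩ := exec_writeResult (F (wIn a).reverse)
  refine ⟨v, ?_⟩
  have h1 := (exec_readInput (wIn a)).seq ((hp (wIn a).reverse [] [] []).seq hv)
  rw [h, List.reverse_reverse] at h1
  refine h1.mono ?_
  have h2 := esize_letters_le (wIn a).reverse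
  have h3 := eval_mono P h2
  have h4 : esize (F (wIn a).reverse) ≤ _ := (hQ (wIn a).reverse).trans (eval_mono Q h2)
  have h5 := length_le_esize (F (wIn a).reverse)
  rw [h] at h4 h5
  simp only [S, Polynomial.eval_add, Polynomial.eval_mul, Polynomial.eval_comp, Polynomial.eval_X,
    Polynomial.eval_ofNat, Polynomial.eval_one, List.length_reverse] at *
  omega

end StackMachine

/-! ### The algorithm and its running time -/

namespace StackMachine

open BTree
open Enc (enc)

section Lists

variable {α β γ : Type} [Enc α] [Enc β] [Enc γ]

theorem esize_map_le {β : Type} (f : β → γ) (c : ℕ) (l : List β) (h : ∀ b ∈ l, esize (f b) ≤ c) :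
    esize (l.map f) ≤ l.length * (c + 1) + 1 := by
  induction l with
  | nil => simp [esize_nil]
  | cons b l ih =>
    have h1 := ih fun b hb => h b (List.mem_cons_of_mem _ hb)
    have h2 := h b List.mem_cons_self
    rw [List.map_cons, esize_cons, List.length_cons, Nat.succ_mul]
    omega

theorem PolyTime.map {l : α → List β} {f : α × β → γ} (hl : PolyTime l) (hf : PolyTime f) :
    PolyTime fun x => (l x).map fun b => f (x, b) := by
  have h (g : β → γ) (t : List β) : ∀ s, t.foldl (fun s b => g b :: s) s =
      (t.map g).reverse ++ s := by
    induction t with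
    | nil => simp
    | cons b t ih => simp [ih]
  obtain ⟨P, hP⟩ := hf.bound
  have hm : PolyBound fun x => esize (l x) * (P.eval (esize x + esize (l x) + 1) + 1) + 1 :=
    (hl.bound.mul ((((PolyBound.id.add hl.bound).add (.const 1)).eval P).add (.const 1))).add
      (.const 1)
  have := PolyTime.foldl (f := fun p : α × List γ × β => f (p.1, p.2.2) :: p.2.1) hl.reverse
    (.const []) (by fun_prop) hm fun x t ht => by
      rw [h fun b => f (x, b), List.append_nil, esize_reverse]
      refine (esize_map_le _ (P.eval (esize x + esize (l x) + 1)) t fun b hb => ?_).trans ?_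
      · refine (hP (x, b)).trans (eval_mono P ?_)
        have := esize_le_of_mem (List.mem_reverse.1 (ht.subset hb))
        rw [esize_mk]
        omega
      · have h1 := ht.length_le
        have h2 := length_le_esize (l x)
        rw [List.length_reverse] at h1
        exact Nat.add_le_add_right (Nat.mul_le_mul_right _ (h1.trans h2)) 1
  simpa only [h fun b => f (_, b), List.append_nil, List.map_reverse, List.reverse_reverse]
    using this

/-- Cut a list into pairs. -/
def pairUpStep (s : List β × List (β × β)) (b : β) : List β × List (β × β) :=
  caseList s.1 ([b], s.2) fun c _ => ([], (b, c) :: s.2)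

/-- Cut a list into pairs, from the end. -/
def pairUp (l : List β) : List (β × β) := (l.reverse.foldl pairUpStep ([], [])).2

theorem pairUp_flatten {β : Type} (l : List (β × β)) : pairUp (l.map fun p => [p.1, p.2]).flatten = l := by
  have h : ((l.map fun p => [p.1, p.2]).flatten.reverse.foldl pairUpStep ([], [])) = ([], l) := by
    induction l with
    | nil => rfl
    | cons p l ih =>
      rw [List.map_cons, List.flatten_cons, List.reverse_append, List.foldl_append, ih]
      rfl
  rw [pairUp, h]

@[fun_prop]
theorem PolyTime.pairUp {l : α → List β} (hl : PolyTime l) : PolyTime fun x => pairUp (l x) := by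
  have h (t : List β) (s : List β × List (β × β)) :
      esize (t.foldl pairUpStep s) ≤ esize s + 2 * esize t := by
    induction t generalizing s with
    | nil => exact Nat.le_add_right _ _
    | cons b t ih =>
      refine (ih _).trans ?_
      obtain ⟨s₁, s₂⟩ := s
      cases s₁ with
      | nil =>
        simp only [pairUpStep, caseList, esize_mk, esize_cons, esize_nil]
        omega
      | cons c s₁ =>
        have := esize_pos s₁
        simp only [pairUpStep, caseList, esize_mk, esize_cons, esize_nil]
        omega
  have h1 : PolyTime fun p : α × (List β × List (β × β)) × β => pairUpStep p.2.1 p.2.2 :=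
    PolyTime.listCase (l := fun p : α × (List β × List (β × β)) × β => p.2.1.1)
      (f := fun p => ([p.2.2], p.2.1.2))
      (g := fun q => ([], (q.1.2.2, q.2.1) :: q.1.2.1.2)) (by fun_prop) (by fun_prop)
      (by fun_prop)
  refine (PolyTime.foldl (f := fun p : α × (List β × List (β × β)) × β => pairUpStep p.2.1 p.2.2)
    hl.reverse (.const ([], [])) h1 ((PolyBound.const 3).add ((PolyBound.const 2).mul hl.bound))
    fun x t ht => ?_).snd
  have h2 : _ ≤ 3 + _ := h t ([], [])
  have h3 := esize_le_of_prefix ht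
  rw [esize_reverse] at h3
  change esize (t.foldl pairUpStep ([], [])) ≤ _
  omega

end Lists

/-! #### Parsing and printing -/

section Parse

variable {α : Type} [Enc α]

/-- Process a letter of the input, which is read backwards. -/
def parseStep (s : List (Bool × ℕ)) (a : Letter) : List (Bool × ℕ) :=
  match a with
  | .zero => caseList s [] fun p t => (p.1, Nat.bit false p.2) :: t
  | .one => caseList s [] fun p t => (p.1, Nat.bit true p.2) :: t
  | .minus => caseList s [] fun p t => (true, p.2) :: t
  | .endMark => (false, 0) :: s

/-- Parse the reverse of a word as a list of integers, given by sign and absolute value. -/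
def parse (w : List Letter) : List (Bool × ℕ) := w.foldl parseStep []

/-- The code of a letter as a list. -/
def letterList : Letter → List Unit
  | .zero => []
  | .one => [()]
  | .endMark => [(), ()]
  | .minus => [(), (), ()]

theorem PolyTime.letterCase {β : Type} [Enc β] {a : α → Letter} {f g h k : α → β}
    (ha : PolyTime a) (hf : PolyTime f) (hg : PolyTime g) (hh : PolyTime h) (hk : PolyTime k) :
    PolyTime fun x => match a x with
      | .zero => f x
      | .one => g x
      | .minus => h x
      | .endMark => k x := by
  have hl : PolyTime fun x => letterList (a x) := ha.of_enc_comp fun x => by cases a x <;> rfl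
  have h1 : PolyTime fun q : (α × Unit × List Unit) × Unit × List Unit =>
      caseList q.2.2 (k q.1.1) fun _ _ => h q.1.1 :=
    PolyTime.listCase (l := fun q : (α × Unit × List Unit) × Unit × List Unit => q.2.2)
      (g := fun q => h q.1.1.1) (by fun_prop) (by fun_prop) (by fun_prop)
  have h2 : PolyTime fun q : α × Unit × List Unit => caseList q.2.2 (g q.1) fun _ t =>
      caseList t (k q.1) fun _ _ => h q.1 :=
    PolyTime.listCase (l := fun q : α × Unit × List Unit => q.2.2) (by fun_prop) (by fun_prop) h1
  have h3 : PolyTime fun x => caseList (letterList (a x)) (f x) fun _ t =>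
      caseList t (g x) fun _ t => caseList t (k x) fun _ _ => h x :=
    PolyTime.listCase hl hf h2
  have e : (fun x => match a x with
      | .zero => f x
      | .one => g x
      | .minus => h x
      | .endMark => k x) = fun x => caseList (letterList (a x)) (f x) fun _ t =>
      caseList t (g x) fun _ t => caseList t (k x) fun _ _ => h x := by
    funext x
    cases a x <;> rfl
  rw [e]
  exact h3

/-- An end mark opens a new number at cost 8, a digit costs at most 6, and a minus sign nothing
because both Boolean codes have equal size. -/
theorem esize_foldl_parseStep_le (w : List Letter) (s : List (Bool × ℕ)) :
    esize (w.foldl parseStep s) ≤ esize s + 8 * w.length := by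
  induction w generalizing s with
  | nil => exact le_rfl
  | cons a w ih =>
    have h : esize (parseStep s a) ≤ esize s + 8 := by
      have hb (b : Bool) (n : ℕ) : esize (Nat.bit b n) ≤ esize n + 6 := by
        have := size_bit_le b n
        rw [esize_nat, esize_nat]
        omega
      rcases s with _ | ⟨⟨b, n⟩, s⟩
      · cases a <;> simp only [parseStep, caseList, esize_cons, esize_mk, esize_bool,
          esize_nat, Nat.size_zero] <;> omega
      · have h1 := hb false n
        have h2 := hb true n
        cases a <;> simp only [parseStep, caseList, esize_cons, esize_mk, esize_bool,
          Nat.size_zero, esize_nat 0] <;> omega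
    refine (ih _).trans ?_
    rw [List.length_cons]
    omega

@[fun_prop]
theorem PolyTime.parse {w : α → List Letter} (hw : PolyTime w) :
    PolyTime fun x => parse (w x) := by
  have h (c : Bool × ℕ → Bool × ℕ) (hc : PolyTime c) :
      PolyTime fun p : α × List (Bool × ℕ) × Letter => caseList p.2.1 [] fun q t => c q :: t :=
    PolyTime.listCase (l := fun p : α × List (Bool × ℕ) × Letter => p.2.1)
      (g := fun q => c q.2.1 :: q.2.2) (by fun_prop) (by fun_prop) (by fun_prop)
  have h1 : PolyTime fun p : α × List (Bool × ℕ) × Letter => parseStep p.2.1 p.2.2 :=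
    PolyTime.letterCase (a := fun p : α × List (Bool × ℕ) × Letter => p.2.2)
      (by fun_prop) (h (fun q => (q.1, Nat.bit false q.2)) (by fun_prop))
      (h (fun q => (q.1, Nat.bit true q.2)) (by fun_prop))
      (h (fun q => (true, q.2)) (by fun_prop)) (by fun_prop)
  refine PolyTime.foldl hw (.const []) h1 ((PolyBound.const 1).add
    ((PolyBound.const 8).mul hw.bound)) fun x t ht => ?_
  have h2 := esize_foldl_parseStep_le t []
  have h3 := ht.length_le
  have h4 := length_le_esize (w x)
  rw [esize_nil] at h2
  change esize (t.foldl parseStep []) ≤ _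
  omega

/-- The letter of a binary digit. -/
def digitLetter (d : Bool) : Letter := if d then .one else .zero

/-- The reverse of the word of a natural number. -/
def printNat (n : ℕ) : List Letter := .endMark :: (n.bits.map digitLetter).reverse

/-- The reverse of the word of a list of natural numbers. -/
def printList (l : List ℕ) : List Letter := l.foldl (fun s n => printNat n ++ s) []

theorem length_foldl_printNat_le (l : List ℕ) (s : List Letter) :
    (l.foldl (fun s n => printNat n ++ s) s).length ≤ s.length + esize l := by
  induction l generalizing s with
  | nil => exact Nat.le_add_right _ _
  | cons n l ih =>
    refine (ih _).trans ?_
    rw [List.length_append, esize_cons, esize_nat, printNat, List.length_cons,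
      List.length_reverse, List.length_map, Nat.size_eq_bits_len]
    omega

@[fun_prop]
theorem PolyTime.printList {l : α → List ℕ} (hl : PolyTime l) :
    PolyTime fun x => printList (l x) := by
  have hd : PolyTime digitLetter := polyTime_of_bool _
  have h1 : PolyTime fun p : α × List Letter × ℕ => p.2.2.bits.map digitLetter :=
    PolyTime.map (f := fun q => digitLetter q.2) (by fun_prop) (by fun_prop)
  have h2 : PolyTime fun p : α × List Letter × ℕ => printNat p.2.2 ++ p.2.1 := by
    unfold printNat
    fun_prop
  refine PolyTime.foldl hl (.const []) h2 (((PolyBound.const 8).mul hl.bound).add (.const 1))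
    fun x t ht => ?_
  refine (esize_letters_le _).trans ?_
  have h3 := length_foldl_printNat_le t []
  have h4 := esize_le_of_prefix ht
  rw [List.length_nil] at h3
  simp only
  omega

end Parse

/-! #### Elimination modulo `d` -/

/-- A vector with a distinguished first coordinate. -/
abbrev Row : Type := ℕ × ℕ × ℕ

/-- All coordinates are smaller than `2 ^ k`. -/
def Row.Small (k : ℕ) (a : Row) : Prop := a.1 < 2 ^ k ∧ a.2.1 < 2 ^ k ∧ a.2.2 < 2 ^ k

/-- Subtraction modulo `d`. -/
def subMod (d x y : ℕ) : ℕ := (x + (d - y % d)) % d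

/-- One step of the Euclidean algorithm on the first coordinates of two vectors; the other
coordinates are only computed modulo `d`. -/
def elimStep (d : ℕ) (p : Row × Row) : Row × Row :=
  bif decide (p.2.1 = 0) then p else
    (p.2, (p.1.1 % p.2.1, (subMod d p.1.2.1 (p.1.1 / p.2.1 * p.2.2.1),
      subMod d p.1.2.2 (p.1.1 / p.2.1 * p.2.2.2))))

/-- Euclidean algorithm on the first coordinates of two vectors. -/
def elim (d : ℕ) (a b : Row) : Row × Row :=
  (elimStep d)^[(a.1.bits ++ b.1.bits ++ [true]).length] (a, b)

theorem subMod_lt {d x k : ℕ} (y : ℕ) (hx : x < 2 ^ k) (hd : d < 2 ^ k) :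
    subMod d x y < 2 ^ k := by
  rcases Nat.eq_zero_or_pos d with rfl | h
  -- The time bound must hold on all words, hence also for `d = 0`, where `subMod` returns `x`.
  · simpa [subMod] using hx
  · exact (Nat.mod_lt _ h).trans hd

theorem small_elimStep {d k : ℕ} {p : Row × Row} (hd : d < 2 ^ k) (h₁ : p.1.Small k)
    (h₂ : p.2.Small k) : (elimStep d p).1.Small k ∧ (elimStep d p).2.Small k := by
  unfold elimStep
  cases decide (p.2.1 = 0) with
  | true => exact ⟨h₁, h₂⟩
  | false =>
    exact ⟨h₂, (Nat.mod_le _ _).trans_lt h₁.1, subMod_lt _ h₁.2.1 hd, subMod_lt _ h₁.2.2 hd⟩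

theorem small_iterate_elimStep {d k : ℕ} {p : Row × Row} (hd : d < 2 ^ k) (h₁ : p.1.Small k)
    (h₂ : p.2.Small k) (n : ℕ) :
    ((elimStep d)^[n] p).1.Small k ∧ ((elimStep d)^[n] p).2.Small k := by
  induction n with
  | zero => exact ⟨h₁, h₂⟩
  | succ n ih =>
    rw [Function.iterate_succ_apply']
    exact small_elimStep hd ih.1 ih.2

theorem small_elim {d k : ℕ} {a b : Row} (hd : d < 2 ^ k) (h₁ : a.Small k) (h₂ : b.Small k) :
    (elim d a b).1.Small k ∧ (elim d a b).2.Small k :=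
  small_iterate_elimStep hd h₁ h₂ _

theorem lt_two_pow_of_esize_le {n k : ℕ} (h : esize n ≤ k) : n < 2 ^ k := by
  rw [esize_nat] at h
  exact (Nat.lt_size_self n).trans_le (Nat.pow_le_pow_right two_pos (by omega))

theorem esize_le_of_lt_two_pow {n k : ℕ} (h : n < 2 ^ k) : esize n ≤ 6 * k + 1 := by
  have := Nat.size_le.2 h
  rw [esize_nat]
  omega

theorem small_of_esize_le {a : Row} {k : ℕ} (h : esize a ≤ k) : a.Small k := by
  rw [esize_prod, esize_prod] at h
  exact ⟨lt_two_pow_of_esize_le (by omega), lt_two_pow_of_esize_le (by omega),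
    lt_two_pow_of_esize_le (by omega)⟩

theorem Row.Small.esize_le {a : Row} {k : ℕ} (h : a.Small k) : esize a ≤ 18 * k + 5 := by
  have h₁ := esize_le_of_lt_two_pow h.1
  have h₂ := esize_le_of_lt_two_pow h.2.1
  have h₃ := esize_le_of_lt_two_pow h.2.2
  rw [esize_prod, esize_prod]
  omega

section

variable {α : Type} [Enc α]

@[fun_prop]
theorem PolyTime.subMod {d x y : α → ℕ} (hd : PolyTime d) (hx : PolyTime x) (hy : PolyTime y) :
    PolyTime fun a => subMod (d a) (x a) (y a) := by
  unfold StackMachine.subMod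
  fun_prop

@[fun_prop]
theorem PolyTime.elim {d : α → ℕ} {a b : α → Row} (hd : PolyTime d) (ha : PolyTime a)
    (hb : PolyTime b) : PolyTime fun x => elim (d x) (a x) (b x) := by
  have h1 : PolyTime fun p : α × (Row × Row) => decide (p.2.2.1 = 0) :=
    PolyTime.decide_eq_zero (by fun_prop)
  have h2 : PolyTime fun p : α × (Row × Row) => elimStep (d p.1) p.2 := by
    unfold elimStep
    fun_prop
  refine PolyTime.iterate (f := fun p => elimStep (d p.1) p.2)
    (l := fun x => (a x).1.bits ++ (b x).1.bits ++ [true]) (i := fun x => (a x, b x)) (by fun_prop) (by fun_prop) h2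
    (m := fun x => 36 * (esize (d x) + esize (a x) + esize (b x)) + 11)
    (((PolyBound.const 36).mul ((hd.bound.add ha.bound).add hb.bound)).add (.const 11))
    fun x n _ => ?_
  obtain ⟨h3, h4⟩ := small_iterate_elimStep (d := d x)
    (k := esize (d x) + esize (a x) + esize (b x)) (p := (a x, b x))
    (lt_two_pow_of_esize_le (by omega)) (small_of_esize_le (a := a x) (by omega))
    (small_of_esize_le (a := b x) (by omega)) n
  have h5 := h3.esize_le
  have h6 := h4.esize_le
  change esize ((elimStep (d x))^[n] (a x, b x)) ≤ _
  rw [esize_prod]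
  omega

end

/-! #### Adding a generator to a lattice -/

/-- The data that are kept when a generator `z` is added to a lattice: the new basis
`(g, q), (0, s)` of the lattice, the multiples of `z` in its two vectors, and a bound on the
multiples of `z` that are needed. -/
structure Extension : Type where
  z : ℕ × ℕ
  basis : Row
  cof : ℕ × ℕ
  index : ℕ

instance : Enc Extension := ⟨fun e => enc ((e.z, e.basis), (e.cof, e.index))⟩

theorem esize_extension (e : Extension) :
    esize e = (esize e.z + esize e.basis + 1) + (esize e.cof + esize e.index + 1) + 1 := by
  change esize ((e.z, e.basis), (e.cof, e.index)) = _
  rw [esize_mk (e.z, e.basis), esize_mk e.z, esize_mk e.cof]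

/-- Elimination of the first coordinate. -/
def firstElim (d : ℕ) (L : Row) (z : ℕ × ℕ) : Row × Row :=
  elim d (L.1, (L.2.1, 0)) (z.1, (z.2, 1))

/-- Elimination of the second coordinate. -/
def secondElim (d : ℕ) (L : Row) (z : ℕ × ℕ) : Row × Row :=
  elim d (L.2.2, (0, 0)) ((firstElim d L z).2.2.1, (0, (firstElim d L z).2.2.2))

/-- Add the generator `z` to the lattice with basis `L`. -/
def extend (d : ℕ) (L : Row) (z : ℕ × ℕ) : Extension where
  z := z
  basis := ((firstElim d L z).1.1, ((firstElim d L z).1.2.1, (secondElim d L z).1.1))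
  cof := ((firstElim d L z).1.2.2, (secondElim d L z).1.2.2)
  index := L.1 / (firstElim d L z).1.1 * (L.2.2 / (secondElim d L z).1.1)

/-- Add one more generator to a lattice. -/
def forwardStep (d : ℕ) (s : Row × List Extension) (z : ℕ × ℕ) : Row × List Extension :=
  ((extend d s.1 z).basis, extend d s.1 z :: s.2)

/-- Add generators, one after the other, to the lattice of all multiples of `d`. -/
def forward (d : ℕ) (l : List (ℕ × ℕ)) : Row × List Extension :=
  l.foldl (forwardStep d) ((d, (0, d)), [])

/-- The multiple of the generator in a representation of a vector. -/
def coefficient (d : ℕ) (e : Extension) (y : ℕ × ℕ) : ℕ :=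
  (y.1 / e.basis.1 * e.cof.1 +
    subMod d y.2 (y.1 / e.basis.1 * e.basis.2.1) / e.basis.2.2 * e.cof.2) % e.index

/-- Subtract a multiple of the generator. -/
def backwardStep (d : ℕ) (s : (ℕ × ℕ) × List ℕ) (e : Extension) : (ℕ × ℕ) × List ℕ :=
  ((s.1.1 - coefficient d e s.1 * e.z.1, s.1.2 - coefficient d e s.1 * e.z.2),
    coefficient d e s.1 :: s.2)

/-- Represent a vector by the generators that were added, up to a multiple of `d`. -/
def backward (d : ℕ) (y : ℕ × ℕ) (l : List Extension) : (ℕ × ℕ) × List ℕ :=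
  l.foldl (backwardStep d) (y, [])

/-- Represent `y` as a nonnegative combination of `(d, 0)`, `(0, d)` and the given vectors. -/
def solve (d : ℕ) (y : ℕ × ℕ) (l : List (ℕ × ℕ)) : List ℕ :=
  (backward d y (forward d l).2).1.1 / d :: (backward d y (forward d l).2).1.2 / d ::
    (backward d y (forward d l).2).2

/-- The new basis obeys the same bound `2 ^ k` as the old one: first coordinates only shrink in the
Euclidean algorithm, the others are reduced modulo `d`. Numbers therefore do not grow with the
number of generators. -/
theorem small_extend {d k : ℕ} {L : Row} {z : ℕ × ℕ} (hd : d < 2 ^ k) (hL : L.Small k)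
    (hz : esize z ≤ k) : (extend d L z).basis.Small k ∧ esize (extend d L z) ≤ 70 * k + 70 := by
  have hk : 1 < 2 ^ k := by
    have := esize_pos z
    exact Nat.one_lt_two_pow (by omega)
  have h0 : 0 < 2 ^ k := by positivity
  rw [esize_prod] at hz
  have h1 := small_elim (a := (L.1, (L.2.1, 0))) (b := (z.1, (z.2, 1))) hd ⟨hL.1, hL.2.1, h0⟩
    ⟨lt_two_pow_of_esize_le (by simp only; omega), lt_two_pow_of_esize_le (by simp only; omega), hk⟩
  have h2 := small_elim (a := (L.2.2, (0, 0)))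
    (b := ((firstElim d L z).2.2.1, (0, (firstElim d L z).2.2.2))) hd ⟨hL.2.2, h0, h0⟩
    ⟨h1.2.2.1, h0, h1.2.2.2⟩
  have h3 : (extend d L z).basis.Small k := ⟨h1.1.1, h1.1.2.1, h2.1.1⟩
  refine ⟨h3, ?_⟩
  have h4 := h3.esize_le
  have h5 := esize_le_of_lt_two_pow h1.1.2.2
  have h6 := esize_le_of_lt_two_pow h2.1.2.2
  have h7 : (extend d L z).index < 2 ^ (k + k) := by
    rw [pow_add]
    exact Nat.mul_lt_mul'' ((Nat.div_le_self _ _).trans_lt hL.1)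
      ((Nat.div_le_self _ _).trans_lt hL.2.2)
  have h8 := esize_le_of_lt_two_pow h7
  have h9 : esize (extend d L z).z = esize z.1 + esize z.2 + 1 := esize_prod z
  have h10 : esize (extend d L z).cof = _ := esize_prod _
  change esize (extend d L z).cof.1 ≤ _ at h5
  change esize (extend d L z).cof.2 ≤ _ at h6
  rw [esize_extension]
  omega

theorem small_foldl_forwardStep {d k : ℕ} (hd : d < 2 ^ k) (l : List (ℕ × ℕ))
    (hl : ∀ z ∈ l, esize z ≤ k) (s : Row × List Extension) (hs : s.1.Small k) :
    (l.foldl (forwardStep d) s).1.Small k ∧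
      esize (l.foldl (forwardStep d) s).2 ≤ esize s.2 + l.length * (70 * k + 71) := by
  induction l generalizing s with
  | nil => exact ⟨hs, Nat.le_add_right _ _⟩
  | cons z l ih =>
    obtain ⟨h1, h2⟩ := small_extend hd hs (hl z List.mem_cons_self)
    obtain ⟨h3, h4⟩ := ih (fun z hz => hl z (List.mem_cons_of_mem _ hz)) (forwardStep d s z) h1
    refine ⟨h3, h4.trans ?_⟩
    have h5 : esize (forwardStep d s z).2 = esize (extend d s.1 z) + esize s.2 + 1 :=
      esize_cons _ _
    rw [h5, List.length_cons, Nat.succ_mul l.length]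
    omega

theorem coefficient_lt {d k : ℕ} {e : Extension} {y : ℕ × ℕ} (hd : d < 2 ^ k)
    (he : esize e ≤ k) (h₁ : y.1 < 2 ^ k) (h₂ : y.2 < 2 ^ k) :
    coefficient d e y < 2 ^ (k + k + 1) := by
  rw [esize_extension, esize_prod e.cof] at he
  refine (Nat.mod_le _ _).trans_lt ?_
  rw [pow_succ, mul_two, pow_add]
  have h3 : e.cof.1 < 2 ^ k := lt_two_pow_of_esize_le (by omega)
  have h4 : e.cof.2 < 2 ^ k := lt_two_pow_of_esize_le (by omega)
  exact Nat.add_lt_add (Nat.mul_lt_mul'' ((Nat.div_le_self _ _).trans_lt h₁) h3)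
    (Nat.mul_lt_mul'' ((Nat.div_le_self _ _).trans_lt (subMod_lt _ h₂ hd)) h4)

/-- Truncated subtraction never increases the vector, so the bound holds on every input, including
those where truncation does occur. -/
theorem esize_foldl_backwardStep_le {d k : ℕ} (hd : d < 2 ^ k) (l : List Extension)
    (hl : ∀ e ∈ l, esize e ≤ k) (s : (ℕ × ℕ) × List ℕ) (h₁ : s.1.1 < 2 ^ k) (h₂ : s.1.2 < 2 ^ k) :
    esize (l.foldl (backwardStep d) s) ≤ 12 * k + 4 + esize s.2 + l.length * (12 * k + 8) := by
  induction l generalizing s with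
  | nil =>
    have h3 := esize_le_of_lt_two_pow h₁
    have h4 := esize_le_of_lt_two_pow h₂
    rw [List.foldl_nil, esize_prod, esize_prod]
    omega
  | cons e l ih =>
    refine (ih (fun z hz => hl z (List.mem_cons_of_mem _ hz)) (backwardStep d s e)
      ((Nat.sub_le _ _).trans_lt h₁) ((Nat.sub_le _ _).trans_lt h₂)).trans ?_
    have h3 := esize_le_of_lt_two_pow (coefficient_lt hd (hl e List.mem_cons_self) h₁ h₂)
    have h4 : esize (backwardStep d s e).2 = esize (coefficient d e s.1) + esize s.2 + 1 :=
      esize_cons _ _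
    rw [h4, List.length_cons, Nat.succ_mul l.length]
    omega

section

variable {α : Type} [Enc α]

theorem polyTime_extension_data :
    PolyTime fun e : Extension => ((e.z, e.basis), (e.cof, e.index)) := .of_enc_eq fun _ => rfl

@[fun_prop]
theorem PolyTime.extension_z {e : α → Extension} (he : PolyTime e) : PolyTime fun x => (e x).z :=
  (polyTime_extension_data.comp he).fst.fst

@[fun_prop]
theorem PolyTime.extension_basis {e : α → Extension} (he : PolyTime e) :
    PolyTime fun x => (e x).basis := (polyTime_extension_data.comp he).fst.snd

@[fun_prop]
theorem PolyTime.extension_cof {e : α → Extension} (he : PolyTime e) :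
    PolyTime fun x => (e x).cof := (polyTime_extension_data.comp he).snd.fst

@[fun_prop]
theorem PolyTime.extension_index {e : α → Extension} (he : PolyTime e) :
    PolyTime fun x => (e x).index := (polyTime_extension_data.comp he).snd.snd

@[fun_prop]
theorem PolyTime.extend {d : α → ℕ} {L : α → Row} {z : α → ℕ × ℕ} (hd : PolyTime d)
    (hL : PolyTime L) (hz : PolyTime z) : PolyTime fun x => StackMachine.extend (d x) (L x) (z x) := by
  have h1 : PolyTime fun x => firstElim (d x) (L x) (z x) := by
    unfold firstElim
    fun_prop
  have h2 : PolyTime fun x => secondElim (d x) (L x) (z x) := by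
    unfold secondElim
    fun_prop
  have h3 : PolyTime fun x => (((StackMachine.extend (d x) (L x) (z x)).z, (StackMachine.extend (d x) (L x) (z x)).basis),
      ((StackMachine.extend (d x) (L x) (z x)).cof, (StackMachine.extend (d x) (L x) (z x)).index)) := by
    unfold StackMachine.extend
    fun_prop
  exact h3.of_enc_comp fun x => rfl

@[fun_prop]
theorem PolyTime.forward {d : α → ℕ} {l : α → List (ℕ × ℕ)} (hd : PolyTime d) (hl : PolyTime l) :
    PolyTime fun x => forward (d x) (l x) := by
  have h1 : PolyTime fun p : α × (Row × List Extension) × (ℕ × ℕ) =>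
      forwardStep (d p.1) p.2.1 p.2.2 := by
    have h : PolyTime fun p : α × (Row × List Extension) × (ℕ × ℕ) =>
        StackMachine.extend (d p.1) p.2.1.1 p.2.2 := by fun_prop
    exact h.extension_basis.prodMk (h.cons (by fun_prop))
  have hk : PolyBound fun x => esize (d x) + esize (l x) := hd.bound.add hl.bound
  refine PolyTime.foldl hl (i := fun x => ((d x, (0, d x)), [])) (by fun_prop) h1
    (m := fun x => 18 * (esize (d x) + esize (l x)) + 7 +
      esize (l x) * (70 * (esize (d x) + esize (l x)) + 71))
    ((((PolyBound.const 18).mul hk).add (.const 7)).add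
      (hl.bound.mul (((PolyBound.const 70).mul hk).add (.const 71)))) fun x t ht => ?_
  have hd' : d x < 2 ^ (esize (d x) + esize (l x)) := lt_two_pow_of_esize_le (by omega)
  obtain ⟨h2, h3⟩ := small_foldl_forwardStep hd' t (fun z hz => by
    have := esize_le_of_mem (ht.subset hz)
    omega) ((d x, (0, d x)), []) ⟨hd', by positivity, hd'⟩
  have h4 := h2.esize_le
  have h5 := Nat.mul_le_mul_right (70 * (esize (d x) + esize (l x)) + 71)
    (ht.length_le.trans (length_le_esize (l x)))
  rw [esize_nil] at h3
  change esize (t.foldl (forwardStep (d x)) ((d x, (0, d x)), [])) ≤ _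
  rw [esize_prod]
  omega

@[fun_prop]
theorem PolyTime.backward {d : α → ℕ} {y : α → ℕ × ℕ} {l : α → List Extension} (hd : PolyTime d)
    (hy : PolyTime y) (hl : PolyTime l) : PolyTime fun x => backward (d x) (y x) (l x) := by
  have h1 : PolyTime fun p : α × ((ℕ × ℕ) × List ℕ) × Extension =>
      backwardStep (d p.1) p.2.1 p.2.2 := by
    unfold backwardStep coefficient
    fun_prop
  have hk : PolyBound fun x => esize (d x) + esize (y x) + esize (l x) :=
    (hd.bound.add hy.bound).add hl.bound
  refine PolyTime.foldl hl (i := fun x => (y x, [])) (by fun_prop) h1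
    (m := fun x => 12 * (esize (d x) + esize (y x) + esize (l x)) + 4 + 1 +
      esize (l x) * (12 * (esize (d x) + esize (y x) + esize (l x)) + 8))
    (((((PolyBound.const 12).mul hk).add (.const 4)).add (.const 1)).add
      (hl.bound.mul (((PolyBound.const 12).mul hk).add (.const 8)))) fun x t ht => ?_
  have hy' := esize_prod (y x)
  have h2 := esize_foldl_backwardStep_le (d := d x)
    (k := esize (d x) + esize (y x) + esize (l x)) (lt_two_pow_of_esize_le (by omega)) t
    (fun z hz => by
      have := esize_le_of_mem (ht.subset hz)
      omega) (y x, []) (lt_two_pow_of_esize_le (by simp only; omega))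
    (lt_two_pow_of_esize_le (by simp only; omega))
  have h3 := Nat.mul_le_mul_right (12 * (esize (d x) + esize (y x) + esize (l x)) + 8)
    (ht.length_le.trans (length_le_esize (l x)))
  rw [esize_nil] at h2
  change esize (t.foldl (backwardStep (d x)) (y x, [])) ≤ _
  omega

@[fun_prop]
theorem PolyTime.solve {d : α → ℕ} {y : α → ℕ × ℕ} {l : α → List (ℕ × ℕ)} (hd : PolyTime d)
    (hy : PolyTime y) (hl : PolyTime l) : PolyTime fun x => solve (d x) (y x) (l x) := by
  unfold StackMachine.solve
  fun_prop

end

/-! #### Coordinates -/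

/-- The positive part of an integer given by sign and absolute value. -/
def posPart (u : Bool × ℕ) : ℕ := bif u.1 then 0 else u.2

/-- The negative part of an integer given by sign and absolute value. -/
def negPart (u : Bool × ℕ) : ℕ := bif u.1 then u.2 else 0

/-- Vectors whose coordinates are given by sign and absolute value. -/
abbrev SignedVec : Type := (Bool × ℕ) × (Bool × ℕ)

/-- The positive terms in the determinant of two vectors. -/
def detPos (u w : SignedVec) : ℕ :=
  posPart u.1 * posPart w.2 + negPart u.1 * negPart w.2 +
    (posPart u.2 * negPart w.1 + negPart u.2 * posPart w.1)

/-- The negative terms in the determinant of two vectors. -/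
def detNeg (u w : SignedVec) : ℕ :=
  posPart u.1 * negPart w.2 + negPart u.1 * posPart w.2 +
    (posPart u.2 * posPart w.1 + negPart u.2 * negPart w.1)

/-- The absolute value of the determinant of two vectors. -/
def absDet (u w : SignedVec) : ℕ := (detPos u w - detNeg u w) + (detNeg u w - detPos u w)

/-- The coordinates of `y` with respect to `u` and `w`, up to sign and scaling. -/
def coords (u w y : SignedVec) : ℕ × ℕ := (absDet y w, absDet u y)

/-- The algorithm on a list of vectors, consisting of the right-hand side and the columns. -/
def solveVectors (l : List SignedVec) : List ℕ :=
  caseList l [] fun y l => caseList l [] fun u l => caseList l [] fun w l =>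
    solve (absDet u w) (coords u w y) (l.map fun z => coords u w z)

/-- The algorithm on words. -/
def algorithm (w : List Letter) : List Letter := printList (solveVectors (pairUp (parse w)))

section

variable {α : Type} [Enc α]

@[fun_prop]
theorem PolyTime.absDet {u w : α → SignedVec} (hu : PolyTime u) (hw : PolyTime w) :
    PolyTime fun x => absDet (u x) (w x) := by
  unfold StackMachine.absDet detPos detNeg posPart negPart
  fun_prop

@[fun_prop]
theorem PolyTime.coords {u w y : α → SignedVec} (hu : PolyTime u) (hw : PolyTime w)
    (hy : PolyTime y) : PolyTime fun x => coords (u x) (w x) (y x) := by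
  unfold StackMachine.coords
  fun_prop

theorem polyTime_solveVectors : PolyTime solveVectors := by
  have h1 : PolyTime fun q : ((List SignedVec × SignedVec × List SignedVec) × SignedVec ×
      List SignedVec) × SignedVec × List SignedVec =>
      solve (absDet q.1.2.1 q.2.1) (coords q.1.2.1 q.2.1 q.1.1.2.1)
        (q.2.2.map fun z => coords q.1.2.1 q.2.1 z) := by
    have := PolyTime.map (l := fun q : ((List SignedVec × SignedVec × List SignedVec) × SignedVec ×
      List SignedVec) × SignedVec × List SignedVec => q.2.2)
      (f := fun p => coords p.1.1.2.1 p.1.2.1 p.2) (by fun_prop) (by fun_prop)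
    fun_prop
  have h2 : PolyTime fun q : (List SignedVec × SignedVec × List SignedVec) × SignedVec ×
      List SignedVec => caseList q.2.2 [] fun w l =>
      solve (absDet q.2.1 w) (coords q.2.1 w q.1.2.1) (l.map fun z => coords q.2.1 w z) :=
    PolyTime.listCase (l := fun q : (List SignedVec × SignedVec × List SignedVec) × SignedVec ×
      List SignedVec => q.2.2) (by fun_prop) (by fun_prop) h1
  have h3 : PolyTime fun q : List SignedVec × SignedVec × List SignedVec =>
      caseList q.2.2 [] fun u l => caseList l [] fun w l =>
      solve (absDet u w) (coords u w q.2.1) (l.map fun z => coords u w z) :=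
    PolyTime.listCase (l := fun q : List SignedVec × SignedVec × List SignedVec => q.2.2)
      (by fun_prop) (by fun_prop) h2
  exact PolyTime.listCase (l := fun x : List SignedVec => x) (by fun_prop) (by fun_prop) h3

theorem polyTime_algorithm : PolyTime algorithm := by
  have := polyTime_solveVectors
  unfold algorithm
  fun_prop

end

end StackMachine

/-! ### Correctness: lattices in the plane -/

namespace StackMachine

/-- A row as an integer vector. -/
def Row.toInt (a : Row) : ℤ × ℤ × ℤ := (a.1, a.2.1, a.2.2)

theorem exists_subMod_eq {d : ℕ} (hd : 0 < d) (x y : ℕ) :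
    ∃ m : ℤ, (subMod d x y : ℤ) = x - y + m * d := by
  have h1 := Nat.div_add_mod (x + (d - y % d)) d
  have h2 := Nat.div_add_mod y d
  have h3 := Nat.mod_lt y hd
  refine ⟨1 + (y / d : ℕ) - ((x + (d - y % d)) / d : ℕ), ?_⟩
  unfold subMod
  zify [h3.le] at h1 h2 ⊢
  linear_combination h1 - h2

/-- Modulo `(0, d, 0)` and `(0, 0, d)` the step is an invertible row operation, so membership passes
in both directions. For suitable `H`, one direction shows that the new rows satisfy a relation, the
other recovers the old rows from the new ones. -/
theorem elimStep_mem_iff {d : ℕ} (hd : 0 < d) (H : AddSubgroup (ℤ × ℤ × ℤ))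
    (h₁ : ((0, (d : ℤ), 0) : ℤ × ℤ × ℤ) ∈ H) (h₂ : ((0, 0, (d : ℤ)) : ℤ × ℤ × ℤ) ∈ H)
    (p : Row × Row) :
    (elimStep d p).1.toInt ∈ H ∧ (elimStep d p).2.toInt ∈ H ↔
      p.1.toInt ∈ H ∧ p.2.toInt ∈ H := by
  by_cases h0 : p.2.1 = 0
  · simp [elimStep, h0]
  · obtain ⟨m₁, hm₁⟩ := exists_subMod_eq hd p.1.2.1 (p.1.1 / p.2.1 * p.2.2.1)
    obtain ⟨m₂, hm₂⟩ := exists_subMod_eq hd p.1.2.2 (p.1.1 / p.2.1 * p.2.2.2)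
    have h4 : (elimStep d p).1 = p.2 := by simp [elimStep, h0]
    have h3 : p.1.toInt = (elimStep d p).2.toInt + (((p.1.1 / p.2.1 : ℕ) : ℤ) • p.2.toInt -
        (m₁ • ((0, (d : ℤ), 0) : ℤ × ℤ × ℤ) + m₂ • ((0, 0, (d : ℤ)) : ℤ × ℤ × ℤ))) := by
      have h5 := Nat.div_add_mod p.1.1 p.2.1
      zify at h5
      push_cast at hm₁ hm₂
      simp only [elimStep, h0, decide_false, cond_false, Row.toInt, Prod.smul_mk, smul_eq_mul,
        mul_zero, Prod.mk_add_mk, Prod.mk_sub_mk, Prod.mk.injEq]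
      push_cast
      refine ⟨?_, ?_, ?_⟩
      · linear_combination -h5
      · linear_combination -hm₁
      · linear_combination -hm₂
    have h6 : m₁ • ((0, (d : ℤ), 0) : ℤ × ℤ × ℤ) + m₂ • ((0, 0, (d : ℤ)) : ℤ × ℤ × ℤ) ∈ H :=
      H.add_mem (H.zsmul_mem h₁ _) (H.zsmul_mem h₂ _)
    rw [h4, and_comm]
    refine and_congr_left fun h7 => ?_
    rw [h3, H.add_mem_cancel_right (H.sub_mem (H.zsmul_mem h7 _) h6)]

theorem elim_mem_iff {d : ℕ} (hd : 0 < d) (H : AddSubgroup (ℤ × ℤ × ℤ))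
    (h₁ : ((0, (d : ℤ), 0) : ℤ × ℤ × ℤ) ∈ H) (h₂ : ((0, 0, (d : ℤ)) : ℤ × ℤ × ℤ) ∈ H)
    (a b : Row) :
    (elim d a b).1.toInt ∈ H ∧ (elim d a b).2.toInt ∈ H ↔ a.toInt ∈ H ∧ b.toInt ∈ H := by
  have h (n : ℕ) (p : Row × Row) : ((elimStep d)^[n] p).1.toInt ∈ H ∧
      ((elimStep d)^[n] p).2.toInt ∈ H ↔ p.1.toInt ∈ H ∧ p.2.toInt ∈ H := by
    induction n generalizing p with
    | zero => rfl
    | succ n ih => rw [Function.iterate_succ_apply, ih, elimStep_mem_iff hd H h₁ h₂]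
  exact h _ (a, b)

theorem gcd_elimStep (d : ℕ) (p : Row × Row) :
    Nat.gcd (elimStep d p).1.1 (elimStep d p).2.1 = Nat.gcd p.1.1 p.2.1 := by
  by_cases h0 : p.2.1 = 0
  · simp [elimStep, h0]
  · simp only [elimStep, h0, decide_false, cond_false]
    rw [Nat.gcd_comm, ← Nat.gcd_rec, Nat.gcd_comm]

theorem gcd_iterate_elimStep (d n : ℕ) (p : Row × Row) :
    Nat.gcd ((elimStep d)^[n] p).1.1 ((elimStep d)^[n] p).2.1 = Nat.gcd p.1.1 p.2.1 := by
  induction n generalizing p with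
  | zero => rfl
  | succ n ih => rw [Function.iterate_succ_apply, ih, gcd_elimStep]

/-- For `0 < b ≤ a` one has `2 * (a % b) ≤ a`, so the product of the first coordinates at least
halves in each step. -/
theorem iterate_elimStep_snd (d k : ℕ) (p : Row × Row) (h : p.2.1 ≤ p.1.1)
    (hk : p.1.1 * p.2.1 < 2 ^ k) : ((elimStep d)^[k] p).2.1 = 0 := by
  induction k generalizing p with
  | zero =>
    have h1 : p.1.1 * p.2.1 = 0 := by simpa using hk
    rcases Nat.mul_eq_zero.1 h1 with h2 | h2
    · simp only [Function.iterate_zero, id_eq]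
      omega
    · exact h2
  | succ k ih =>
    rw [Function.iterate_succ_apply]
    by_cases h0 : p.2.1 = 0
    · have e : elimStep d p = p := by simp [elimStep, h0]
      rw [e]
      refine ih p h ?_
      rw [h0]
      simp
    · have hlt := Nat.mod_lt p.1.1 (Nat.pos_of_ne_zero h0)
      refine ih _ ?_ ?_
      · simp only [elimStep, h0, decide_false, cond_false]
        exact hlt.le
      · simp only [elimStep, h0, decide_false, cond_false]
        have h1 := Nat.div_add_mod p.1.1 p.2.1
        have h2 : 1 ≤ p.1.1 / p.2.1 := Nat.div_pos h (Nat.pos_of_ne_zero h0)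
        have h3 : p.2.1 ≤ p.2.1 * (p.1.1 / p.2.1) := Nat.le_mul_of_pos_right _ h2
        rw [pow_succ] at hk
        have h4 : 2 * (p.1.1 % p.2.1) ≤ p.1.1 := by omega
        have h5 := Nat.mul_le_mul_left p.2.1 h4
        have h6 : p.2.1 * (2 * (p.1.1 % p.2.1)) = 2 * (p.2.1 * (p.1.1 % p.2.1)) := by ring
        have h7 : p.2.1 * p.1.1 = p.1.1 * p.2.1 := by ring
        omega

theorem elim_snd (d : ℕ) (a b : Row) : (elim d a b).2.1 = 0 := by
  have hs (m n : ℕ) : m * n < 2 ^ (m.bits ++ n.bits).length := by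
    rw [List.length_append, Nat.size_eq_bits_len, Nat.size_eq_bits_len, pow_add]
    exact Nat.mul_lt_mul'' (Nat.lt_size_self m) (Nat.lt_size_self n)
  rw [elim, List.length_append, List.length_singleton]
  rcases le_or_gt b.1 a.1 with h | h
  · exact iterate_elimStep_snd d _ (a, b) h
      ((hs _ _).trans_le (Nat.pow_le_pow_right two_pos (Nat.le_succ _)))
  -- Here the first step merely exchanges the first coordinates; the additional entry `[true]` in
  -- `elim` provides for it.
  · rw [Function.iterate_succ_apply]
    have h0 : b.1 ≠ 0 := by omega
    have h1 : a.1 % b.1 = a.1 := Nat.mod_eq_of_lt h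
    refine iterate_elimStep_snd d _ _ ?_ ?_
    · simp only [elimStep, h0, decide_false, cond_false, h1]
      exact h.le
    · simp only [elimStep, h0, decide_false, cond_false, h1]
      rw [mul_comm]
      exact hs _ _

theorem elim_fst (d : ℕ) (a b : Row) : (elim d a b).1.1 = Nat.gcd a.1 b.1 := by
  have h := gcd_iterate_elimStep d (a.1.bits ++ b.1.bits ++ [true]).length (a, b)
  have h' := elim_snd d a b
  change Nat.gcd (elim d a b).1.1 (elim d a b).2.1 = _ at h
  rwa [h', Nat.gcd_zero_right] at h

/-! ### Planar lattices in triangular form. -/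

/-- The lattice with basis `(g, q), (0, s)`. -/
def lat (L : Row) : AddSubgroup (ℤ × ℤ) where
  carrier := {y | ∃ a b : ℤ, y = (a * L.1, a * L.2.1 + b * L.2.2)}
  zero_mem' := ⟨0, 0, by simp [Prod.zero_eq_mk]⟩
  add_mem' := by
    rintro _ _ ⟨a, b, rfl⟩ ⟨a', b', rfl⟩
    exact ⟨a + a', b + b', by simp; constructor <;> ring⟩
  neg_mem' := by
    rintro _ ⟨a, b, rfl⟩
    exact ⟨-a, -b, by simp; ring⟩

theorem mem_lat {L : Row} {y : ℤ × ℤ} :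
    y ∈ lat L ↔ ∃ a b : ℤ, y = (a * L.1, a * L.2.1 + b * L.2.2) := Iff.rfl

theorem lat_le {L : Row} {K : AddSubgroup (ℤ × ℤ)} :
    lat L ≤ K ↔ ((L.1 : ℤ), (L.2.1 : ℤ)) ∈ K ∧ ((0 : ℤ), (L.2.2 : ℤ)) ∈ K := by
  constructor
  · exact fun h => ⟨h ⟨1, 0, by simp⟩, h ⟨0, 1, by simp⟩⟩
  · rintro ⟨h₁, h₂⟩ _ ⟨a, b, rfl⟩
    have := K.add_mem (K.zsmul_mem h₁ a) (K.zsmul_mem h₂ b)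
    simpa using this

theorem basis_mem_lat (L : Row) :
    ((L.1 : ℤ), (L.2.1 : ℤ)) ∈ lat L ∧ ((0 : ℤ), (L.2.2 : ℤ)) ∈ lat L := lat_le.1 le_rfl

/-- The vectors `(y, x)` such that `y - x z` is in the lattice. -/
def multiples (L : Row) (z : ℕ × ℕ) : AddSubgroup (ℤ × ℤ × ℤ) :=
  (lat L).comap (AddMonoidHom.mk' (fun y => (y.1 - y.2.2 * z.1, y.2.1 - y.2.2 * z.2)) fun y y' => by
    simp only [Prod.fst_add, Prod.snd_add, Prod.mk_add_mk, Prod.mk.injEq]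
    constructor <;> ring)

theorem mem_multiples {L : Row} {z : ℕ × ℕ} {y₁ y₂ x : ℤ} :
    (y₁, y₂, x) ∈ multiples L z ↔ (y₁ - x * z.1, y₂ - x * z.2) ∈ lat L := Iff.rfl

/-- Properties of the extension of a lattice by a vector. -/
structure ExtensionSpec (d : ℕ) (L : Row) (e : Extension) : Prop where
  pos₁ : 0 < e.basis.1
  pos₂ : 0 < e.basis.2.2
  le : lat L ≤ lat e.basis
  mem : ((e.z.1 : ℤ), (e.z.2 : ℤ)) ∈ lat e.basis
  least : ∀ K : AddSubgroup (ℤ × ℤ), lat L ≤ K → ((e.z.1 : ℤ), (e.z.2 : ℤ)) ∈ K →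
    lat e.basis ≤ K
  index_mul : e.index * (e.basis.1 * e.basis.2.2) = L.1 * L.2.2
  coefficient_mem : ∀ y : ℕ × ℕ, ((y.1 : ℤ), (y.2 : ℤ)) ∈ lat e.basis →
    ((y.1 : ℤ) - coefficient d e y * e.z.1, (y.2 : ℤ) - coefficient d e y * e.z.2) ∈ lat L

/-- The third coordinate of a row records a multiple of `z`: all rows stay in `multiples L z`.
Reducing it modulo `d` is harmless because `L` contains `dℤ²` and hence `d z`. -/
theorem extend_spec {d : ℕ} (hd : 0 < d) {L : Row} (hg : 0 < L.1) (hs : 0 < L.2.2)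
    (h₁ : ((d : ℤ), (0 : ℤ)) ∈ lat L) (h₂ : ((0 : ℤ), (d : ℤ)) ∈ lat L) (z : ℕ × ℕ) :
    ExtensionSpec d L (extend d L z) := by
  set e := extend d L z with he
  obtain ⟨bL₁, bL₂⟩ := basis_mem_lat L
  obtain ⟨be₁, be₂⟩ := basis_mem_lat e.basis
  -- the results of the two eliminations
  have f0 : (firstElim d L z).2.1 = 0 := elim_snd _ _ _
  have f1 : e.basis.1 = Nat.gcd L.1 z.1 := elim_fst _ _ _
  have s1 : e.basis.2.2 = Nat.gcd L.2.2 (firstElim d L z).2.2.1 := elim_fst _ _ _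
  have pos₁ : 0 < e.basis.1 := f1 ▸ Nat.gcd_pos_of_pos_left _ hg
  have pos₂ : 0 < e.basis.2.2 := s1 ▸ Nat.gcd_pos_of_pos_left _ hs
  have ds : e.basis.2.2 ∣ L.2.2 := s1 ▸ Nat.gcd_dvd_left _ _
  have dz : e.basis.2.2 ∣ (firstElim d L z).2.2.1 := s1 ▸ Nat.gcd_dvd_right _ _
  -- As `(0, d)` lies in the old lattice, reduction modulo `d` does not leave the new lattice
  -- either.
  have dd : e.basis.2.2 ∣ d := by
    obtain ⟨a, b, hab⟩ := h₂
    simp only [Prod.mk.injEq] at hab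
    have ha : a = 0 := by
      rcases mul_eq_zero.1 hab.1.symm with h | h
      · exact h
      · omega
    rw [ha, zero_mul, zero_mul, zero_add] at hab
    exact ds.trans (Int.natCast_dvd_natCast.1 ⟨b, by rw [hab.2, mul_comm]⟩)
  have snd_mem {n : ℕ} (hn : e.basis.2.2 ∣ n) : ((0 : ℤ), (n : ℤ)) ∈ lat e.basis := by
    obtain ⟨m, rfl⟩ := hn
    exact ⟨0, m, by simp [mul_comm]⟩
  -- membership in `multiples L z`
  have m1 : ((0 : ℤ), (d : ℤ), (0 : ℤ)) ∈ multiples L z := mem_multiples.2 (by simpa using h₂)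
  have m2 : ((0 : ℤ), (0 : ℤ), (d : ℤ)) ∈ multiples L z := by
    rw [mem_multiples]
    have := (lat L).neg_mem ((lat L).add_mem ((lat L).zsmul_mem h₁ z.1) ((lat L).zsmul_mem h₂ z.2))
    simpa [mul_comm] using this
  have m3 : (firstElim d L z).1.toInt ∈ multiples L z ∧
      (firstElim d L z).2.toInt ∈ multiples L z := by
    refine (elim_mem_iff hd _ m1 m2 _ _).2 ⟨?_, ?_⟩
    · exact mem_multiples.2 (by simpa using bL₁)
    · exact mem_multiples.2 (by
        simp only [Nat.cast_one, one_mul, sub_self]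
        exact (lat L).zero_mem)
  have m4 : ((e.basis.1 : ℤ), (e.basis.2.1 : ℤ), (e.cof.1 : ℤ)) ∈ multiples L z := m3.1
  have m5 : ((0 : ℤ), (e.basis.2.2 : ℤ), (e.cof.2 : ℤ)) ∈ multiples L z := by
    -- The middle coordinate of the second elimination is a dummy, discarded by pulling back along
    -- `(y₁, y₂, x) ↦ (0, y₁, x)`.
    have := (elim_mem_iff hd ((multiples L z).comap (AddMonoidHom.mk'
      (fun y : ℤ × ℤ × ℤ => ((0 : ℤ), y.1, y.2.2)) fun y y' => by simp))
      (by exact (multiples L z).zero_mem) m2 (L.2.2, (0, 0))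
      ((firstElim d L z).2.2.1, (0, (firstElim d L z).2.2.2))).2 ⟨?_, ?_⟩
    · exact this.1
    · exact mem_multiples.2 (by simpa [Row.toInt] using bL₂)
    · have := m3.2
      rw [Row.toInt, f0] at this
      exact this
  -- the new lattice contains the old one and `z`
  have m6 : ((L.1 : ℤ), (L.2.1 : ℤ)) ∈ lat e.basis ∧ ((z.1 : ℤ), (z.2 : ℤ)) ∈ lat e.basis := by
    -- The elimination read backwards: the final rows lie in the new lattice, hence so do the
    -- original ones; the third coordinate plays no role.
    have := (elim_mem_iff hd ((lat e.basis).comap (AddMonoidHom.mk'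
      (fun y : ℤ × ℤ × ℤ => (y.1, y.2.1)) fun y y' => by simp))
      (by exact snd_mem dd) (by exact (lat e.basis).zero_mem) (L.1, (L.2.1, 0))
      (z.1, (z.2, 1))).1 ⟨be₁, ?_⟩
    · exact this
    · change (((firstElim d L z).2.1 : ℤ), ((firstElim d L z).2.2.1 : ℤ)) ∈ lat e.basis
      rw [f0]
      exact snd_mem dz
  have hle : lat L ≤ lat e.basis := lat_le.2 ⟨m6.1, snd_mem ds⟩
  -- the index
  obtain ⟨a, b, hab⟩ := mem_lat.1 m6.1
  simp only [Prod.mk.injEq] at hab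
  have dg : e.basis.1 ∣ L.1 := Int.natCast_dvd_natCast.1 ⟨a, by rw [hab.1, mul_comm]⟩
  obtain ⟨α, hα⟩ := dg
  obtain ⟨γ, hγ⟩ := ds
  have hindex : e.index = α * γ := by
    change L.1 / e.basis.1 * (L.2.2 / e.basis.2.2) = α * γ
    rw [hα, hγ, Nat.mul_div_cancel_left _ pos₁, Nat.mul_div_cancel_left _ pos₂]
  have haα : a = α := by
    have h3 : (a - α) * e.basis.1 = 0 := by
      have h4 := hab.1
      rw [hα] at h4
      push_cast at h4
      linear_combination -h4
    rcases mul_eq_zero.1 h3 with h | h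
    · omega
    · omega
  rw [haα] at hab
  have i1 : ((0 : ℤ), (e.index * e.basis.2.2 : ℤ)) ∈ lat L := by
    have := (lat L).zsmul_mem bL₂ α
    rw [hγ] at this
    rw [hindex]
    simpa [mul_comm, mul_assoc, mul_left_comm] using this
  -- Write `(g, q)`, `(0, s)` for the old basis and `(g', q')`, `(0, s')` for the new one. From `(g,
  -- q) = α (g', q') + b (0, s')` and `s = γ s'` follows `α γ (g', q') = γ (g, q) - b (0, s)`.
  have i2 : ((e.index * e.basis.1 : ℤ), (e.index * e.basis.2.1 : ℤ)) ∈ lat L := by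
    have := (lat L).sub_mem ((lat L).zsmul_mem bL₁ γ) ((lat L).zsmul_mem bL₂ b)
    convert this using 1
    rw [hab.1, hab.2, hγ, hindex]
    simp only [Prod.smul_mk, smul_eq_mul, Prod.mk_sub_mk, Prod.mk.injEq]
    push_cast
    constructor <;> ring
  -- In other words, `e.index` times `z` is in the old lattice, so the coefficient of `z` matters
  -- only modulo `e.index`.
  have m7 : ((0 : ℤ), (0 : ℤ), (e.index : ℤ)) ∈ multiples L z := by
    obtain ⟨a', b', hz⟩ := mem_lat.1 m6.2
    simp only [Prod.mk.injEq] at hz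
    rw [mem_multiples, hz.1, hz.2]
    have := (lat L).neg_mem ((lat L).add_mem ((lat L).zsmul_mem i2 a') ((lat L).zsmul_mem i1 b'))
    convert this using 1
    simp only [Prod.smul_mk, smul_eq_mul, Prod.mk_add_mk, Prod.neg_mk, Prod.mk.injEq]
    constructor <;> ring
  refine ⟨pos₁, pos₂, hle, m6.2, fun K hK hz => ?_, ?_, fun y hy => ?_⟩
  · rw [lat_le]
    have k1 := K.add_mem (hK (mem_multiples.1 m4)) (K.zsmul_mem hz e.cof.1)
    have k2 := K.add_mem (hK (mem_multiples.1 m5)) (K.zsmul_mem hz e.cof.2)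
    constructor
    · simpa [he, extend] using k1
    · simpa [he, extend] using k2
  · rw [hindex, hα, hγ]
    ring
  · obtain ⟨t, b', hy'⟩ := mem_lat.1 hy
    simp only [Prod.mk.injEq] at hy'
    have ht : ((y.1 / e.basis.1 : ℕ) : ℤ) = t := by
      rw [Int.natCast_div, hy'.1, Int.mul_ediv_cancel _ (by omega)]
    -- To stay in `ℕ`, the second coordinate is computed only up to a multiple `m * d`. This is a
    -- multiple of `e.basis.2.2`, and `m1` compensates for it in `key`.
    obtain ⟨m, hm⟩ := exists_subMod_eq hd y.2 (y.1 / e.basis.1 * e.basis.2.1)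
    obtain ⟨d', hd'⟩ := dd
    set w := subMod d y.2 (y.1 / e.basis.1 * e.basis.2.1) with hw
    have hw' : ((w / e.basis.2.2 : ℕ) : ℤ) = b' + m * d' := by
      have hwe : (w : ℤ) = (b' + m * d') * e.basis.2.2 := by
        rw [hm]
        push_cast [ht]
        rw [hd', hy'.2]
        push_cast
        ring
      rw [Int.natCast_div, hwe, Int.mul_ediv_cancel _ (by omega)]
    set X := y.1 / e.basis.1 * e.cof.1 + w / e.basis.2.2 * e.cof.2 with hX
    have hc : coefficient d e y = X % e.index := rfl
    have hmod := Nat.div_add_mod X e.index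
    have hXe : (X : ℤ) = t * e.cof.1 + (b' + m * d') * e.cof.2 := by
      rw [hX]
      push_cast [ht, hw']
      ring
    zify at hmod
    have key := (multiples L z).sub_mem ((multiples L z).sub_mem ((multiples L z).add_mem
      ((multiples L z).zsmul_mem m4 t) ((multiples L z).zsmul_mem m5 (b' + m * d')))
      ((multiples L z).zsmul_mem m1 m)) ((multiples L z).zsmul_mem m7 (X / e.index))
    refine (mem_multiples (z := z) (y₁ := y.1) (y₂ := y.2) (x := coefficient d e y)).1 ?_
    convert key using 1
    simp only [Prod.smul_mk, smul_eq_mul, Prod.mk_add_mk, Prod.mk_sub_mk, Prod.mk.injEq]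
    refine ⟨?_, ?_, ?_⟩
    · linear_combination hy'.1
    · rw [hy'.2, hd']
      push_cast
      ring
    · rw [hc]
      push_cast
      linear_combination hmod + hXe

theorem ExtensionSpec.index_pos {d : ℕ} {L : Row} {e : Extension} (h : ExtensionSpec d L e)
    (hg : 0 < L.1) (hs : 0 < L.2.2) : 0 < e.index := by
  have h1 : 0 < e.index * (e.basis.1 * e.basis.2.2) := h.index_mul ▸ Nat.mul_pos hg hs
  exact Nat.pos_of_mul_pos_right h1

theorem ExtensionSpec.coefficient_lt_index {d : ℕ} {L : Row} {e : Extension}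
    (h : ExtensionSpec d L e) (hg : 0 < L.1) (hs : 0 < L.2.2) (y : ℕ × ℕ) :
    coefficient d e y < e.index := Nat.mod_lt _ (h.index_pos hg hs)

/-! ### The chain of lattices and the descent along it. -/

/-- The linear combination of the first components. -/
def dot₁ (x : List ℕ) (l : List (ℕ × ℕ)) : ℕ := (List.zipWith (fun a z => a * z.1) x l).sum

/-- The linear combination of the second components. -/
def dot₂ (x : List ℕ) (l : List (ℕ × ℕ)) : ℕ := (List.zipWith (fun a z => a * z.2) x l).sum

theorem dot₁_append {x : List ℕ} {l : List (ℕ × ℕ)} (h : x.length = l.length) (a : ℕ)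
    (z : ℕ × ℕ) : dot₁ (x ++ [a]) (l ++ [z]) = dot₁ x l + a * z.1 := by
  simp [dot₁, List.zipWith_append h]

theorem dot₂_append {x : List ℕ} {l : List (ℕ × ℕ)} (h : x.length = l.length) (a : ℕ)
    (z : ℕ × ℕ) : dot₂ (x ++ [a]) (l ++ [z]) = dot₂ x l + a * z.2 := by
  simp [dot₂, List.zipWith_append h]

/-- Properties of the lattice generated by the multiples of `d` and the vectors in `l`. -/
structure ForwardSpec (d : ℕ) (l : List (ℕ × ℕ)) : Prop where
  pos₁ : 0 < (forward d l).1.1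
  pos₂ : 0 < (forward d l).1.2.2
  mem₁ : ((d : ℤ), (0 : ℤ)) ∈ lat (forward d l).1
  mem₂ : ((0 : ℤ), (d : ℤ)) ∈ lat (forward d l).1
  mem : ∀ z ∈ l, ((z.1 : ℤ), (z.2 : ℤ)) ∈ lat (forward d l).1
  least : ∀ K : AddSubgroup (ℤ × ℤ), ((d : ℤ), (0 : ℤ)) ∈ K → ((0 : ℤ), (d : ℤ)) ∈ K →
    (∀ z ∈ l, ((z.1 : ℤ), (z.2 : ℤ)) ∈ K) → lat (forward d l).1 ≤ K
  index_pos : 0 < ((forward d l).2.map Extension.index).prod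
  index_mul : ((forward d l).2.map Extension.index).prod *
    ((forward d l).1.1 * (forward d l).1.2.2) = d * d

theorem forward_append (d : ℕ) (l : List (ℕ × ℕ)) (z : ℕ × ℕ) :
    forward d (l ++ [z]) = ((extend d (forward d l).1 z).basis,
      extend d (forward d l).1 z :: (forward d l).2) := by
  simp [forward, List.foldl_append, forwardStep]

theorem forward_spec {d : ℕ} (hd : 0 < d) (l : List (ℕ × ℕ)) : ForwardSpec d l := by
  induction l using List.reverseRecOn with
  | nil =>
    refine ⟨hd, hd, ⟨1, 0, by simp [forward]⟩, ⟨0, 1, by simp [forward]⟩, by simp,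
      fun K h₁ h₂ _ => lat_le.2 ⟨by simpa [forward] using h₁, h₂⟩, by simp [forward],
      by simp [forward]⟩
  | append_singleton l z ih =>
    have h := extend_spec hd ih.pos₁ ih.pos₂ ih.mem₁ ih.mem₂ z
    have hi := h.index_pos ih.pos₁ ih.pos₂
    constructor
    all_goals rw [forward_append]
    · exact h.pos₁
    · exact h.pos₂
    · exact h.le ih.mem₁
    · exact h.le ih.mem₂
    · intro z' hz'
      rcases List.mem_append.1 hz' with hz' | hz'
      · exact h.le (ih.mem z' hz')
      · rw [List.mem_singleton.1 hz']
        exact h.mem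
    · intro K h₁ h₂ h₃
      refine h.least K (ih.least K h₁ h₂ fun z' hz' => h₃ z' (List.mem_append_left _ hz')) ?_
      exact h₃ z (List.mem_append_right _ (List.mem_singleton_self z))
    · rw [List.map_cons, List.prod_cons]
      exact Nat.mul_pos hi ih.index_pos
    · rw [List.map_cons, List.prod_cons, ← ih.index_mul, ← h.index_mul]
      ring

/-- With `P` the product of the indices, `h₁` and `h₂` say `(P - 1) * mᵢ ≤ yᵢ` without subtraction.
If `x < p` and `P' ≥ 1` is the product of the remaining indices, then `x + P' ≤ p * P'`; so the
hypothesis survives the subtraction of `x z`, and no subtraction truncates. Reverse induction fits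
because `forward` stores the last extension first. -/
theorem backward_spec {d : ℕ} (hd : 0 < d) (m₁ m₂ : ℕ) (l : List (ℕ × ℕ))
    (hl : ∀ z ∈ l, z.1 ≤ m₁ ∧ z.2 ≤ m₂) (y : ℕ × ℕ)
    (hy : ((y.1 : ℤ), (y.2 : ℤ)) ∈ lat (forward d l).1)
    (h₁ : ((forward d l).2.map Extension.index).prod * m₁ ≤ y.1 + m₁)
    (h₂ : ((forward d l).2.map Extension.index).prod * m₂ ≤ y.2 + m₂) (x₀ : List ℕ) :
    ∃ (x : List ℕ) (a b : ℕ), (forward d l).2.foldl (backwardStep d) (y, x₀) =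
      ((d * a, d * b), x ++ x₀) ∧ x.length = l.length ∧ y.1 = d * a + dot₁ x l ∧
      y.2 = d * b + dot₂ x l := by
  induction l using List.reverseRecOn generalizing y x₀ with
  | nil =>
    obtain ⟨a, b, hab⟩ := mem_lat.1 hy
    simp only [forward, List.foldl_nil, Prod.mk.injEq, Nat.cast_zero, mul_zero, zero_add] at hab
    obtain ⟨a', ha'⟩ : d ∣ y.1 := Int.natCast_dvd_natCast.1 ⟨a, by rw [hab.1, mul_comm]⟩
    obtain ⟨b', hb'⟩ : d ∣ y.2 := Int.natCast_dvd_natCast.1 ⟨b, by rw [hab.2, mul_comm]⟩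
    exact ⟨[], a', b', by simp [forward, ← ha', ← hb'], rfl, by simp [dot₁, ha'],
      by simp [dot₂, hb']⟩
  | append_singleton l z ih =>
    have hf := forward_spec hd l
    have h := extend_spec hd hf.pos₁ hf.pos₂ hf.mem₁ hf.mem₂ z
    have hx := h.coefficient_lt_index hf.pos₁ hf.pos₂ y
    rw [forward_append] at hy h₁ h₂ ⊢
    rw [List.map_cons, List.prod_cons] at h₁ h₂
    have hm := h.coefficient_mem y hy
    have hP := hf.index_pos
    set e := extend d (forward d l).1 z with he
    set x := coefficient d e y with hxdef
    set P := ((forward d l).2.map Extension.index).prod with hPdef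
    have bound {m u v : ℕ} (hv : v ≤ m) (hu : e.index * P * m ≤ u + m) :
        x * v ≤ u ∧ P * m ≤ u - x * v + m := by
      have b1 : x * v ≤ x * m := Nat.mul_le_mul_left _ hv
      have b2 : (x + P) * m ≤ e.index * P * m := by
        refine Nat.mul_le_mul_right _ ?_
        have : (x + 1) * P ≤ e.index * P := Nat.mul_le_mul_right _ hx
        nlinarith
      have b3 : m ≤ P * m := Nat.le_mul_of_pos_left _ hP
      rw [add_mul] at b2
      omega
    obtain ⟨hz₁, hz₂⟩ := hl z (List.mem_append_right _ (List.mem_singleton_self z))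
    obtain ⟨c1, c2⟩ := bound hz₁ h₁
    obtain ⟨c3, c4⟩ := bound hz₂ h₂
    obtain ⟨x', a, b, e1, e2, e3, e4⟩ := ih (fun z' hz' => hl z' (List.mem_append_left _ hz'))
      (y.1 - x * z.1, y.2 - x * z.2) (by
        push_cast [Nat.cast_sub c1, Nat.cast_sub c3]
        exact hm) c2 c4 (x :: x₀)
    refine ⟨x' ++ [x], a, b, ?_, by simp [e2], ?_, ?_⟩
    · rw [List.foldl_cons, List.append_assoc]
      exact e1
    · rw [dot₁_append e2]
      simp only at e3
      omega
    · rw [dot₂_append e2]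
      simp only at e4
      omega

theorem solve_spec {d : ℕ} (hd : 0 < d) (m₁ m₂ : ℕ) (l : List (ℕ × ℕ))
    (hl : ∀ z ∈ l, z.1 ≤ m₁ ∧ z.2 ≤ m₂) (y : ℕ × ℕ)
    (hy : ((y.1 : ℤ), (y.2 : ℤ)) ∈ lat (forward d l).1)
    (hdet : d ≤ (forward d l).1.1 * (forward d l).1.2.2)
    (h₁ : d * m₁ ≤ y.1 + m₁) (h₂ : d * m₂ ≤ y.2 + m₂) :
    ∃ (x : List ℕ) (a b : ℕ), solve d y l = a :: b :: x ∧ x.length = l.length ∧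
      y.1 = d * a + dot₁ x l ∧ y.2 = d * b + dot₂ x l := by
  have hi := (forward_spec hd l).index_mul
  -- The product of the indices times the determinant of the last lattice is `d²`, and this
  -- determinant is at least `d`.
  have hP : ((forward d l).2.map Extension.index).prod ≤ d := by
    refine Nat.le_of_mul_le_mul_right (c := d) ?_ hd
    rw [← hi]
    exact Nat.mul_le_mul_left _ hdet
  obtain ⟨x, a, b, e1, e2, e3, e4⟩ := backward_spec hd m₁ m₂ l hl y hy
    ((Nat.mul_le_mul_right _ hP).trans h₁) ((Nat.mul_le_mul_right _ hP).trans h₂) []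
  refine ⟨x, a, b, ?_, e2, e3, e4⟩
  rw [solve, backward, e1, List.append_nil, Nat.mul_div_cancel_left _ hd,
    Nat.mul_div_cancel_left _ hd]

end StackMachine

/-! ### Correctness: parsing and printing -/

namespace StackMachine

theorem encodeNat_eq_bits (n : ℕ) : Computability.encodeNat n = n.bits := by
  induction n using Nat.binaryRec' with
  | zero => simp [Computability.encodeNat, Computability.encodeNum]
  | bit b n h ih =>
    rw [Nat.bits_append_bit _ _ h, ← ih]
    unfold Computability.encodeNat
    rw [← Num.ofNat'_eq, ← Num.ofNat'_eq, Num.ofNat'_bit]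
    cases hn : Num.ofNat' n with
    | zero =>
      have h0 : n = 0 := by
        rw [Num.ofNat'_eq] at hn
        rw [← Num.to_of_nat n, hn]
        rfl
      rw [h h0]
      rfl
    | pos p => cases b <;> rfl

/-- Sign and absolute value of an integer. -/
def signed (z : ℤ) : Bool × ℕ := (decide (z < 0), z.natAbs)

theorem foldl_parseStep_bits (n : ℕ) (s : List (Bool × ℕ)) :
    (n.bits.map digitLetter).reverse.foldl parseStep ((false, 0) :: s) = (false, n) :: s := by
  induction n using Nat.binaryRec' with
  | zero => simp
  | bit b n h ih =>
    rw [Nat.bits_append_bit _ _ h, List.map_cons, List.reverse_cons, List.foldl_append, ih]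
    cases b <;> rfl

theorem foldl_parseStep_writeInt (z : ℤ) (s : List (Bool × ℕ)) :
    (writeInt z).reverse.foldl parseStep s = signed z :: s := by
  have h : (fun d : Bool => if d then Letter.one else Letter.zero) = digitLetter := rfl
  rw [writeInt, encodeNat_eq_bits, h, List.reverse_append, List.reverse_append]
  simp only [List.reverse_singleton, List.foldl_append, List.foldl_cons, List.foldl_nil]
  change List.foldl parseStep (List.foldl parseStep ((false, 0) :: s) _) _ = _
  rw [foldl_parseStep_bits]
  by_cases hz : z < 0 <;> simp [hz, signed, parseStep, caseList]

theorem parse_writeInts (l : List ℤ) : parse (writeInts l).reverse = l.map signed := by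
  induction l with
  | nil => rfl
  | cons z l ih =>
    have h : writeInts (z :: l) = writeInt z ++ writeInts l := rfl
    rw [parse] at ih
    rw [h, parse, List.reverse_append, List.foldl_append, ih, foldl_parseStep_writeInt,
      List.map_cons]

theorem printNat_eq (n : ℕ) : printNat n = (writeInt n).reverse := by
  have h : (fun d : Bool => if d then Letter.one else Letter.zero) = digitLetter := rfl
  rw [writeInt, encodeNat_eq_bits, h]
  simp [printNat]

theorem printList_eq (l : List ℕ) :
    printList l = (writeInts (l.map fun n : ℕ => (n : ℤ))).reverse := by
  have h (s : List Letter) : l.foldl (fun s n => printNat n ++ s) s =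
      (writeInts (l.map fun n : ℕ => (n : ℤ))).reverse ++ s := by
    induction l generalizing s with
    | nil => rfl
    | cons n l ih =>
      have h : writeInts ((n :: l).map fun n : ℕ => (n : ℤ)) =
        writeInt n ++ writeInts (l.map fun n : ℕ => (n : ℤ)) := rfl
      rw [List.foldl_cons, ih, h, List.reverse_append, printNat_eq, List.append_assoc]
  rw [printList, h, List.append_nil]

/-! ### Correctness: geometry -/

/-- The determinant of two vectors in the plane. -/
def det₂ {R : Type} [CommRing R] (u w : R × R) : R := u.1 * w.2 - u.2 * w.1

/-- The coordinates of an integer vector by sign and absolute value. -/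
def signedVec (y : ℤ × ℤ) : SignedVec := (signed y.1, signed y.2)

theorem absDet_signedVec (u w : ℤ × ℤ) :
    absDet (signedVec u) (signedVec w) = (det₂ u w).natAbs := by
  have h (z : ℤ) : (posPart (signed z) : ℤ) - negPart (signed z) = z := by
    by_cases hz : z < 0 <;> simp only [posPart, negPart, signed, hz, decide_true, decide_false,
      cond_true, cond_false] <;> omega
  have e : (detPos (signedVec u) (signedVec w) : ℤ) - detNeg (signedVec u) (signedVec w) =
      det₂ u w := by
    rw [det₂]
    conv_rhs => rw [← h u.1, ← h u.2, ← h w.1, ← h w.2]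
    simp only [detPos, detNeg, signedVec]
    push_cast
    ring
  rw [absDet, ← e]
  omega

/-- A subgroup that contains the columns of a matrix with coprime minors is everything. -/
theorem eq_top_of_subdetGcd {n : ℕ} {A : Matrix (Fin 2) (Fin n) ℤ} (h : subdetGcd A = 1)
    (K : AddSubgroup (ℤ × ℤ)) (hK : ∀ j, (A 0 j, A 1 j) ∈ K) : K = ⊤ := by
  -- The ideal of all `c` with `cℤ² ⊆ K`. By Cramer's rule it contains all minors, hence their
  -- greatest common divisor 1.
  let J : Ideal ℤ :=
    { carrier := {c | ∀ y : ℤ × ℤ, c • y ∈ K}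
      zero_mem' := fun y => by simp
      add_mem' := fun {a b} ha hb y => by
        rw [add_smul]
        exact K.add_mem (ha y) (hb y)
      smul_mem' := fun a b hb y => by
        rw [smul_eq_mul, mul_smul]
        exact K.zsmul_mem (hb y) a }
  have hminor (s : Fin 2 ↪ Fin n) : (A.submatrix id s).det ∈ J := by
    intro y
    have h1 := K.add_mem (K.zsmul_mem (hK (s 0)) (y.1 * A 1 (s 1) - y.2 * A 0 (s 1)))
      (K.zsmul_mem (hK (s 1)) (y.2 * A 0 (s 0) - y.1 * A 1 (s 0)))
    convert h1 using 1
    ext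
    · simp [Matrix.det_fin_two]
      ring
    · simp [Matrix.det_fin_two]
      ring
  have h1 : (1 : ℤ) ∈ J := by
    rw [← Ideal.span_singleton_generator J, Ideal.mem_span_singleton, ← h]
    refine Finset.dvd_gcd fun s _ => ?_
    rw [← Ideal.mem_span_singleton, Ideal.span_singleton_generator]
    exact hminor s
  refine (AddSubgroup.eq_top_iff' K).2 fun y => ?_
  simpa using h1 y

/-- Lagrange's identity: the squares of the determinant and of the inner product add up to the
product of the squared norms. -/
theorem abs_det_le (a b : Fin 2 → ℝ) :
    |a 0 * b 1 - a 1 * b 0| ≤ ‖WithLp.toLp 2 a‖ * ‖WithLp.toLp 2 b‖ := by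
  rw [EuclideanSpace.norm_eq, EuclideanSpace.norm_eq, ← Real.sqrt_mul (by positivity)]
  refine Real.abs_le_sqrt ?_
  simp only [Fin.sum_univ_two, Real.norm_eq_abs, sq_abs]
  nlinarith [sq_nonneg (a 0 * b 0 + a 1 * b 1)]

theorem norm_column_le {m n : ℕ} (M : Matrix (Fin m) (Fin n) ℤ) (j : Fin n) :
    ‖WithLp.toLp 2 ((realMatrix M)ᵀ j)‖ ≤ maxColumnLength M :=
  le_ciSup (f := fun j => ‖WithLp.toLp 2 ((realMatrix M)ᵀ j)‖) (Set.finite_range _).bddAbove j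

theorem column_mem_cone {m n : ℕ} (M : Matrix (Fin m) (Fin n) ℤ) (j : Fin n) :
    (realMatrix M)ᵀ j ∈ columnCone M := by
  refine ⟨Pi.single j 1, ?_, ?_⟩
  · intro i
    by_cases h : i = j <;> simp [h]
  · ext i
    simp [Matrix.mulVec_single]

/-- A linear functional that is nonnegative on the cone is large on vectors deep in the cone. -/
theorem le_functional {m n : ℕ} {M : Matrix (Fin m) (Fin n) ℤ} (φ : (Fin m → ℝ) →ₗ[ℝ] ℝ)
    (hφ : ∀ y ∈ columnCone M, 0 ≤ φ y) {t : ℝ} (ht : 0 ≤ t) {b : Fin m → ℝ}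
    (hb : b ∈ ({t • columnSum M} : Set (Fin m → ℝ)) + columnCone M) (j : Fin n) :
    t * φ ((realMatrix M)ᵀ j) ≤ φ b := by
  obtain ⟨_, rfl, c, hc, rfl⟩ := hb
  have h0 : φ (columnSum M) = ∑ j, φ ((realMatrix M)ᵀ j) :=
    map_sum φ (fun j => (realMatrix M)ᵀ j) Finset.univ
  rw [map_add, map_smul, smul_eq_mul, h0]
  have h1 : φ ((realMatrix M)ᵀ j) ≤ ∑ j, φ ((realMatrix M)ᵀ j) :=
    Finset.single_le_sum (f := fun j => φ ((realMatrix M)ᵀ j))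
      (fun j _ => hφ _ (column_mem_cone M j)) (Finset.mem_univ j)
  have h2 := mul_le_mul_of_nonneg_left h1 ht
  have h3 := hφ c hc
  linarith

/-- The functional `y ↦ ε det(y, w)`. -/
noncomputable def detFunctional (ε : ℝ) (w : Fin 2 → ℝ) : (Fin 2 → ℝ) →ₗ[ℝ] ℝ :=
  (ε * w 1) • LinearMap.proj 0 - (ε * w 0) • LinearMap.proj 1

theorem detFunctional_apply (ε : ℝ) (w y : Fin 2 → ℝ) :
    detFunctional ε w y = ε * (y 0 * w 1 - y 1 * w 0) := by
  simp [detFunctional]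
  ring

/-! ### Correctness: the lattice -/

/-- The coordinates of `y` with respect to `u` and `w`, scaled by `|det(u, w)|`. -/
def coordHom (u w : ℤ × ℤ) : ℤ × ℤ →+ ℤ × ℤ where
  toFun y := ((det₂ u w).sign * det₂ y w, (det₂ u w).sign * det₂ u y)
  map_zero' := by simp [det₂]
  map_add' y z := by
    ext <;> simp only [det₂, Prod.fst_add, Prod.snd_add] <;> ring

theorem coordHom_left (u w : ℤ × ℤ) : coordHom u w u = (((det₂ u w).natAbs : ℤ), (0 : ℤ)) := by
  ext
  · exact Int.sign_mul_self_eq_natAbs _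
  · simp only [coordHom, AddMonoidHom.coe_mk, ZeroHom.coe_mk, det₂]
    ring

theorem coordHom_right (u w : ℤ × ℤ) : coordHom u w w = ((0 : ℤ), ((det₂ u w).natAbs : ℤ)) := by
  ext
  · simp only [coordHom, AddMonoidHom.coe_mk, ZeroHom.coe_mk, det₂]
    ring
  · exact Int.sign_mul_self_eq_natAbs _

theorem coordHom_injective {u w : ℤ × ℤ} (h : det₂ u w ≠ 0) :
    Function.Injective (coordHom u w) := by
  rw [injective_iff_map_eq_zero]
  intro y hy
  have h1 : (det₂ u w).sign * det₂ y w = 0 := congrArg Prod.fst hy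
  have h2 : (det₂ u w).sign * det₂ u y = 0 := congrArg Prod.snd hy
  have hs : (det₂ u w).sign ≠ 0 := by simpa using h
  replace h1 := (mul_eq_zero.1 h1).resolve_left hs
  replace h2 := (mul_eq_zero.1 h2).resolve_left hs
  -- Cramer's rule: the two determinants determine `det₂ u w` times `y`.
  have e1 : det₂ u w * y.1 = det₂ y w * u.1 + det₂ u y * w.1 := by
    simp only [det₂]
    ring
  have e2 : det₂ u w * y.2 = det₂ y w * u.2 + det₂ u y * w.2 := by
    simp only [det₂]
    ring
  rw [h1, h2] at e1 e2
  ext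
  · simpa [h] using e1
  · simpa [h] using e2

/-- Determinants of pairs in the image are multiples of `det₂ u w`; this bounds the determinant of
the last lattice from below. -/
theorem det₂_coordHom {u w : ℤ × ℤ} (h : det₂ u w ≠ 0) (y z : ℤ × ℤ) :
    det₂ (coordHom u w y) (coordHom u w z) = det₂ u w * det₂ y z := by
  have hs : (det₂ u w).sign * (det₂ u w).sign = 1 := by
    rcases lt_or_gt_of_ne h with h | h
    · simp [Int.sign_eq_neg_one_of_neg h]
    · simp [Int.sign_eq_one_of_pos h]
  calc
    _ = ((det₂ u w).sign * (det₂ u w).sign) * (det₂ u w * det₂ y z) := by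
      simp only [coordHom, AddMonoidHom.coe_mk, ZeroHom.coe_mk]
      generalize (det₂ u w).sign = s
      simp only [det₂]
      ring
    _ = _ := by rw [hs, one_mul]

/-- For vectors with nonnegative coordinates, the absolute values that the algorithm computes are
the coordinates themselves. -/
theorem cast_coords {u w z : ℤ × ℤ} (h : det₂ u w ≠ 0) (hz : 0 ≤ coordHom u w z) :
    (((coords (signedVec u) (signedVec w) (signedVec z)).1 : ℤ),
      ((coords (signedVec u) (signedVec w) (signedVec z)).2 : ℤ)) = coordHom u w z := by
  have hs (x : ℤ) (hx : 0 ≤ (det₂ u w).sign * x) : (x.natAbs : ℤ) = (det₂ u w).sign * x := by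
    rcases lt_or_gt_of_ne h with h | h
    · rw [Int.sign_eq_neg_one_of_neg h] at *
      omega
    · rw [Int.sign_eq_one_of_pos h] at *
      omega
  simp only [coords, absDet_signedVec]
  rw [hs _ hz.1, hs _ hz.2]
  rfl

/-- The combination of the vectors in `l` with the coefficients in `x`. -/
def combination (x : List ℕ) (l : List (ℤ × ℤ)) : ℤ × ℤ :=
  (List.zipWith (fun (a : ℕ) z => (a : ℤ) • z) x l).sum

theorem coordHom_combination {u w : ℤ × ℤ} (h : det₂ u w ≠ 0) (x : List ℕ) (l : List (ℤ × ℤ))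
    (hl : ∀ z ∈ l, 0 ≤ coordHom u w z) :
    coordHom u w (combination x l) =
      ((dot₁ x (l.map fun z => coords (signedVec u) (signedVec w) (signedVec z)) : ℤ),
        (dot₂ x (l.map fun z => coords (signedVec u) (signedVec w) (signedVec z)) : ℤ)) := by
  induction l generalizing x with
  | nil => cases x <;> simpa [combination, dot₁, dot₂] using Prod.zero_eq_mk
  | cons z l ih =>
    cases x with
    | nil => simpa [combination, dot₁, dot₂] using Prod.zero_eq_mk
    | cons a x =>
      have h1 := ih x fun z hz => hl z (List.mem_cons_of_mem _ hz)
      have h2 := cast_coords h (hl z List.mem_cons_self)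
      simp only [combination, dot₁, dot₂, List.zipWith_cons_cons, List.map_cons, List.sum_cons,
        map_add, map_zsmul] at h1 ⊢
      rw [h1, ← h2]
      ext <;> simp

theorem solveVectors_spec {u w y : ℤ × ℤ} {l : List (ℤ × ℤ)} (h : det₂ u w ≠ 0) (m : ℕ)
    (hl : ∀ z ∈ l, 0 ≤ coordHom u w z ∧ coordHom u w z ≤ ((m : ℤ), (m : ℤ)))
    (hy : 0 ≤ coordHom u w y)
    (h₁ : (det₂ u w).natAbs * m ≤ (coordHom u w y).1 + m)
    (h₂ : (det₂ u w).natAbs * m ≤ (coordHom u w y).2 + m)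
    (htop : ∀ K : AddSubgroup (ℤ × ℤ), u ∈ K → w ∈ K → (∀ z ∈ l, z ∈ K) → K = ⊤) :
    ∃ x a b, solveVectors (signedVec y :: signedVec u :: signedVec w :: l.map signedVec) =
      a :: b :: x ∧ x.length = l.length ∧
      y = (a : ℤ) • u + (b : ℤ) • w + combination x l := by
  have hd : 0 < (det₂ u w).natAbs := Int.natAbs_pos.2 h
  set l' := l.map fun z => coords (signedVec u) (signedVec w) (signedVec z) with hl'
  set y' := coords (signedVec u) (signedVec w) (signedVec y) with hy'
  have ey : ((y'.1 : ℤ), (y'.2 : ℤ)) = coordHom u w y := cast_coords h hy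
  have F := forward_spec hd l'
  -- The preimage of the last lattice contains `u`, `w` and all of `l`, so it is everything.
  have hmem : ∀ z, coordHom u w z ∈ lat (forward (det₂ u w).natAbs l').1 := by
    intro z
    have := htop ((lat (forward (det₂ u w).natAbs l').1).comap (coordHom u w))
      (by rw [AddSubgroup.mem_comap, coordHom_left]; exact F.mem₁)
      (by rw [AddSubgroup.mem_comap, coordHom_right]; exact F.mem₂)
      (fun z hz => by
        rw [AddSubgroup.mem_comap, ← cast_coords h (hl z hz).1]
        exact F.mem _ (List.mem_map_of_mem hz))
    rw [← AddSubgroup.mem_comap, this]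
    trivial
  -- Conversely, the last lattice lies in the image of `ℤ²`, so its determinant is a positive
  -- multiple of that of `u` and `w`.
  have hrange := F.least (coordHom u w).range ⟨u, coordHom_left u w⟩ ⟨w, coordHom_right u w⟩
    (fun z' hz' => by
      obtain ⟨z, hz, rfl⟩ := List.mem_map.1 hz'
      exact ⟨z, (cast_coords h (hl z hz).1).symm⟩)
  have hdet : (det₂ u w).natAbs ≤
      (forward (det₂ u w).natAbs l').1.1 * (forward (det₂ u w).natAbs l').1.2.2 := by
    obtain ⟨z₁, hz₁⟩ := hrange (basis_mem_lat _).1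
    obtain ⟨z₂, hz₂⟩ := hrange (basis_mem_lat _).2
    have e := det₂_coordHom h z₁ z₂
    rw [hz₁, hz₂] at e
    refine Nat.le_of_dvd (Nat.mul_pos F.pos₁ F.pos₂) ?_
    rw [← Int.natCast_dvd_natCast, Int.natAbs_dvd]
    refine ⟨det₂ z₁ z₂, ?_⟩
    rw [← e]
    simp [det₂]
  obtain ⟨x, a, b, e, hx, e₁, e₂⟩ := solve_spec hd m m l'
    (fun z' hz' => by
      obtain ⟨z, hz, rfl⟩ := List.mem_map.1 hz'
      have e := cast_coords h (hl z hz).1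
      have hle := (hl z hz).2
      rw [← e] at hle
      exact ⟨Int.ofNat_le.1 hle.1, Int.ofNat_le.1 hle.2⟩)
    y' (by rw [ey]; exact hmem y) hdet
    (by rw [← ey] at h₁; exact Int.ofNat_le.1 h₁) (by rw [← ey] at h₂; exact Int.ofNat_le.1 h₂)
  refine ⟨x, a, b, ?_, by rw [hx, hl', List.length_map], coordHom_injective h ?_⟩
  · rw [← e, hl', hy', ← absDet_signedVec]
    simp [solveVectors, caseList, Function.comp_def]
  · rw [map_add, map_add, map_zsmul, map_zsmul, coordHom_left, coordHom_right,
      coordHom_combination h x l fun z hz => (hl z hz).1, ← hl', ← ey, e₁, e₂]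
    ext <;> simp [mul_comm]

/-! ### Coordinate bounds from the cone conditions. -/

/-- A column of a matrix with two rows. -/
def column {n : ℕ} (A : Matrix (Fin 2) (Fin n) ℤ) (j : Fin n) : ℤ × ℤ := (A 0 j, A 1 j)

/-- At `B c` the two functionals take the values `|det B| c₀` and `|det B| c₁`. -/
theorem detFunctional_nonneg (B : Matrix (Fin 2) (Fin 2) ℤ) {y : Fin 2 → ℝ}
    (hy : y ∈ columnCone B) :
    0 ≤ detFunctional (B.det.sign : ℤ) ((realMatrix B)ᵀ 1) y ∧
      0 ≤ detFunctional (-(B.det.sign : ℤ)) ((realMatrix B)ᵀ 0) y := by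
  obtain ⟨c, hc, rfl⟩ := hy
  have h : (0 : ℝ) ≤ (B.det.sign : ℤ) * (B 0 0 * B 1 1 - B 0 1 * B 1 0 : ℝ) := by
    have : 0 ≤ B.det.sign * B.det := by
      rw [Int.sign_mul_self_eq_natAbs]
      positivity
    rw [B.det_fin_two] at this ⊢
    exact_mod_cast this
  have h0 := mul_nonneg (hc 0) h
  have h1 := mul_nonneg (hc 1) h
  simp only [detFunctional_apply, Matrix.mulVec, dotProduct, Fin.sum_univ_two, realMatrix,
    Matrix.map_apply, Matrix.transpose_apply]
  constructor
  · refine h0.trans_eq ?_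
    ring
  · refine h1.trans_eq ?_
    ring

theorem coordHom_column {B : Matrix (Fin 2) (Fin 2) ℤ} (y : Fin 2 → ℤ) :
    (((coordHom (column B 0) (column B 1) (y 0, y 1)).1 : ℤ) : ℝ) =
        detFunctional (B.det.sign : ℤ) ((realMatrix B)ᵀ 1) (fun i => (y i : ℝ)) ∧
      (((coordHom (column B 0) (column B 1) (y 0, y 1)).2 : ℤ) : ℝ) =
        detFunctional (-(B.det.sign : ℤ)) ((realMatrix B)ᵀ 0) (fun i => (y i : ℝ)) := by
  have h : det₂ (column B 0) (column B 1) = B.det := by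
    rw [Matrix.det_fin_two, det₂, column, column]
    ring
  rw [detFunctional_apply, detFunctional_apply]
  simp only [coordHom, AddMonoidHom.coe_mk, ZeroHom.coe_mk, h]
  simp only [det₂, column, realMatrix, Matrix.transpose_apply, Matrix.map_apply]
  push_cast
  constructor <;> ring

theorem abs_detFunctional_le {ε : ℝ} (hε : |ε| ≤ 1) (w y : Fin 2 → ℝ) :
    |detFunctional ε w y| ≤ ‖WithLp.toLp 2 w‖ * ‖WithLp.toLp 2 y‖ := by
  rw [detFunctional_apply, abs_mul, mul_comm ‖WithLp.toLp 2 w‖]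
  exact (mul_le_of_le_one_left (abs_nonneg _) hε).trans (abs_det_le y w)

/-- Each coordinate functional equals `|det B|` on one column of `B`, which cancels the denominator
in `hb`; `le_functional` then gives the lower bounds for `b`. The upper bounds for the columns of
`N` come from `abs_detFunctional_le`. -/
theorem coordHom_bounds (I : KnapsackInput 2) (hB : I.B.det ≠ 0)
    (hcone : columnCone I.B = columnCone I.A)
    (hb : (fun i => (I.b i : ℝ)) ∈
      ({(maxColumnLength I.B * maxColumnLength I.N / |(I.B.det : ℝ)| *
        (|(I.B.det : ℝ)| - 1)) • columnSum I.A} : Set (Fin 2 → ℝ)) + columnCone I.A) :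
    ∃ m : ℕ,
      (∀ j, 0 ≤ coordHom (column I.B 0) (column I.B 1) (column I.N j) ∧
        coordHom (column I.B 0) (column I.B 1) (column I.N j) ≤ ((m : ℤ), (m : ℤ))) ∧
      0 ≤ coordHom (column I.B 0) (column I.B 1) (I.b 0, I.b 1) ∧
      I.B.det.natAbs * m ≤ (coordHom (column I.B 0) (column I.B 1) (I.b 0, I.b 1)).1 + m ∧
      I.B.det.natAbs * m ≤ (coordHom (column I.B 0) (column I.B 1) (I.b 0, I.b 1)).2 + m := by
  set φ₁ := detFunctional (I.B.det.sign : ℤ) ((realMatrix I.B)ᵀ 1) with hφ₁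
  set φ₂ := detFunctional (-(I.B.det.sign : ℤ)) ((realMatrix I.B)ᵀ 0) with hφ₂
  have hpos₁ (y) (hy : y ∈ columnCone I.A) : 0 ≤ φ₁ y :=
    (detFunctional_nonneg I.B (hcone ▸ hy)).1
  have hpos₂ (y) (hy : y ∈ columnCone I.A) : 0 ≤ φ₂ y :=
    (detFunctional_nonneg I.B (hcone ▸ hy)).2
  have hε : |((I.B.det.sign : ℤ) : ℝ)| ≤ 1 := by
    rcases lt_or_gt_of_ne hB with h | h
    · simp [Int.sign_eq_neg_one_of_neg h]
    · simp [Int.sign_eq_one_of_pos h]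
  have hε' : |(-(I.B.det.sign : ℤ) : ℝ)| ≤ 1 := by rwa [abs_neg]
  have hlB : 0 ≤ maxColumnLength I.B := Real.iSup_nonneg fun _ => norm_nonneg _
  have hlN : 0 ≤ maxColumnLength I.N := Real.iSup_nonneg fun _ => norm_nonneg _
  have hl : 0 ≤ maxColumnLength I.B * maxColumnLength I.N := mul_nonneg hlB hlN
  have hD : (1 : ℝ) ≤ |(I.B.det : ℝ)| := by exact_mod_cast Int.one_le_abs hB
  have ht : 0 ≤ maxColumnLength I.B * maxColumnLength I.N / |(I.B.det : ℝ)| *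
      (|(I.B.det : ℝ)| - 1) :=
    mul_nonneg (div_nonneg hl (abs_nonneg _)) (by linarith)
  have hcol (j : Fin 2) : (realMatrix I.A)ᵀ (Fin.castAdd I.k j) = (realMatrix I.B)ᵀ j := rfl
  have hsum := Int.sign_mul_self_eq_natAbs I.B.det
  have hnat : ((I.B.det.natAbs : ℕ) : ℝ) = |(I.B.det : ℝ)| := Nat.cast_natAbs _ |>.trans (by simp)
  have hself : ((I.B.det.sign : ℤ) : ℝ) * (I.B 0 0 * I.B 1 1 - I.B 0 1 * I.B 1 0 : ℝ) =
      |(I.B.det : ℝ)| := by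
    have h1 : (I.B.det : ℝ) = I.B 0 0 * I.B 1 1 - I.B 0 1 * I.B 1 0 := by
      rw [Matrix.det_fin_two]
      push_cast
      rfl
    rw [← h1, ← Int.cast_mul, hsum, Int.cast_natCast, hnat]
  have hu : φ₁ ((realMatrix I.B)ᵀ 0) = |(I.B.det : ℝ)| := by
    rw [← hself, hφ₁, detFunctional_apply]
    simp only [realMatrix, Matrix.map_apply, Matrix.transpose_apply]
    ring
  have hw : φ₂ ((realMatrix I.B)ᵀ 1) = |(I.B.det : ℝ)| := by
    rw [← hself, hφ₂, detFunctional_apply]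
    simp only [realMatrix, Matrix.map_apply, Matrix.transpose_apply]
    ring
  have key : maxColumnLength I.B * maxColumnLength I.N / |(I.B.det : ℝ)| *
      (|(I.B.det : ℝ)| - 1) * |(I.B.det : ℝ)| =
      maxColumnLength I.B * maxColumnLength I.N * (|(I.B.det : ℝ)| - 1) := by
    field_simp
  have hb₁ := le_functional φ₁ hpos₁ ht hb (Fin.castAdd I.k 0)
  have hb₂ := le_functional φ₂ hpos₂ ht hb (Fin.castAdd I.k 1)
  rw [hcol, hu, key, ← (coordHom_column I.b).1] at hb₁
  rw [hcol, hw, key, ← (coordHom_column I.b).2] at hb₂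
  have hm := Nat.floor_le hl
  -- The coordinates are integers, so the real bound may be rounded down.
  set m := ⌊maxColumnLength I.B * maxColumnLength I.N⌋₊
  have hm' := mul_le_mul_of_nonneg_right hm (sub_nonneg.2 hD)
  have hle (ε : ℝ) (hε : |ε| ≤ 1) (i : Fin 2) (j : Fin I.k) (z : ℤ)
      (hz : (z : ℝ) = detFunctional ε ((realMatrix I.B)ᵀ i) ((realMatrix I.N)ᵀ j)) : z ≤ m := by
    have h : (z : ℝ) ≤ maxColumnLength I.B * maxColumnLength I.N := by
      rw [hz]
      exact (le_abs_self _).trans ((abs_detFunctional_le hε _ _).trans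
        (mul_le_mul (norm_column_le _ _) (norm_column_le _ _) (norm_nonneg _) hlB))
    exact (Int.le_floor.2 h).trans_eq (Int.natCast_floor_eq_floor hl).symm
  refine ⟨m, fun j => ?_, ?_, ?_, ?_⟩
  · have e := coordHom_column (B := I.B) fun i => I.N i j
    have hmem := column_mem_cone I.A (Fin.natAdd 2 j)
    have h₁ := hpos₁ _ hmem
    have h₂ := hpos₂ _ hmem
    refine ⟨⟨?_, ?_⟩, hle _ hε _ j _ e.1, hle _ hε' _ j _ e.2⟩
    · exact_mod_cast h₁.trans_eq e.1.symm
    · exact_mod_cast h₂.trans_eq e.2.symm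
  · have h0 := mul_nonneg hl (sub_nonneg.2 hD)
    constructor
    · exact_mod_cast h0.trans hb₁
    · exact_mod_cast h0.trans hb₂
  · rw [← Int.cast_le (R := ℝ), Int.cast_add, Int.cast_mul, Int.cast_natCast, Int.cast_natCast,
      hnat]
    linarith
  · rw [← Int.cast_le (R := ℝ), Int.cast_add, Int.cast_mul, Int.cast_natCast, Int.cast_natCast,
      hnat]
    linarith

/-! ### Correctness of the algorithm on words. -/

theorem ofFn_column (I : KnapsackInput 2) :
    List.ofFn (column I.A) = column I.B 0 :: column I.B 1 :: List.ofFn (column I.N) := by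
  rw [List.ofFn_add]
  simp [List.ofFn_succ]
  exact ⟨rfl, rfl, rfl⟩

/-- The input lists `b` and then the columns, two entries each, so cutting into pairs recovers these
vectors in order. -/
theorem pairUp_parse_writeInput (I : KnapsackInput 2) :
    pairUp (parse (writeInput I).reverse) =
      signedVec (I.b 0, I.b 1) :: signedVec (column I.B 0) :: signedVec (column I.B 1) ::
        (List.ofFn (column I.N)).map signedVec := by
  have h := ofFn_column I
  rw [← List.map_cons, ← List.map_cons, ← h, ← List.map_cons,
    ← pairUp_flatten (List.map signedVec _), writeInput, parse_writeInts]
  congr 1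
  simp [List.map_flatten, List.map_ofFn, Function.comp_def, signedVec, column, List.ofFn_succ]

theorem combination_ofFn {k : ℕ} (x : Fin k → ℕ) (c : Fin k → ℤ × ℤ) :
    combination (List.ofFn x) (List.ofFn c) = ∑ j, (x j : ℤ) • c j := by
  induction k with
  | zero => simp [combination]
  | succ k ih =>
    rw [List.ofFn_succ, List.ofFn_succ, Fin.sum_univ_succ, ← ih]
    rfl

theorem algorithm_spec (I : KnapsackInput 2) (hB : I.B.det ≠ 0)
    (hcone : columnCone I.B = columnCone I.A) (hgcd : subdetGcd I.A = 1)
    (hb : (fun i => (I.b i : ℝ)) ∈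
      ({(maxColumnLength I.B * maxColumnLength I.N / |(I.B.det : ℝ)| *
        (|(I.B.det : ℝ)| - 1)) • columnSum I.A} : Set (Fin 2 → ℝ)) + columnCone I.A) :
    ∃ x : Fin (2 + I.k) → ℤ, 0 ≤ x ∧ I.A *ᵥ x = I.b ∧
      algorithm (writeInput I).reverse = (writeOutput ⟨2 + I.k, x⟩).reverse := by
  obtain ⟨m, hN, h0, h₁, h₂⟩ := coordHom_bounds I hB hcone hb
  have hdet : det₂ (column I.B 0) (column I.B 1) = I.B.det := by
    rw [Matrix.det_fin_two, det₂, column, column]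
    ring
  have hmem (K : AddSubgroup (ℤ × ℤ)) (hu : column I.B 0 ∈ K) (hw : column I.B 1 ∈ K)
      (hl : ∀ z ∈ List.ofFn (column I.N), z ∈ K) : K = ⊤ := by
    refine eq_top_of_subdetGcd hgcd K fun j => ?_
    have hj : column I.A j ∈ List.ofFn (column I.A) := List.mem_ofFn.2 ⟨j, rfl⟩
    rw [ofFn_column, List.mem_cons, List.mem_cons] at hj
    change column I.A j ∈ K
    obtain h | h | h := hj
    · rwa [h]
    · rwa [h]
    · exact hl _ h
  obtain ⟨x, a, b, hx, hlen, he⟩ := solveVectors_spec (hdet ▸ hB) m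
    (l := List.ofFn (column I.N)) (y := (I.b 0, I.b 1))
    (fun z hz => by
      obtain ⟨j, rfl⟩ := List.mem_ofFn.1 hz
      exact hN j)
    h0 (by rwa [hdet]) (by rwa [hdet]) hmem
  rw [List.length_ofFn] at hlen
  obtain ⟨x, rfl⟩ : ∃ f : Fin I.k → ℕ, x = List.ofFn f :=
    ⟨fun j => x[j], List.ext_getElem (by simp [hlen]) (by simp)⟩
  rw [combination_ofFn] at he
  let X : Fin (2 + I.k) → ℕ := Fin.append ![a, b] x
  refine ⟨fun i => (X i : ℤ), fun i => Int.natCast_nonneg _, ?_, ?_⟩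
  · have e₁ : I.b 0 = _ := congrArg Prod.fst he
    have e₂ : I.b 1 = _ := congrArg Prod.snd he
    ext i
    rw [Matrix.mulVec, dotProduct, Fin.sum_univ_add, Fin.sum_univ_two]
    simp only [X, Fin.append_left, Fin.append_right]
    fin_cases i
    · refine Eq.trans ?_ e₁.symm
      simp [column, KnapsackInput.B, KnapsackInput.N, mul_comm, Prod.fst_sum]
    · refine Eq.trans ?_ e₂.symm
      simp [column, KnapsackInput.B, KnapsackInput.N, mul_comm, Prod.snd_sum]
  · have hX : List.ofFn X = a :: b :: List.ofFn x := by
      rw [List.ofFn_fin_append]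
      simp
    rw [algorithm, pairUp_parse_writeInput, hx, ← hX, printList_eq, writeOutput, List.map_ofFn]
    rfl

end StackMachine
theorem corollary2 :
    SolvableInPolyTime (writeInput (m := 2)) writeOutput
      (fun I : KnapsackInput 2 =>
        I.B.det ≠ 0 ∧
        columnCone I.B = columnCone I.A ∧
        subdetGcd I.A = 1 ∧
        {x : Fin (2 + I.k) → ℝ | 0 ≤ x ∧ realMatrix I.A *ᵥ x = 0} = {0} ∧
        (fun i => (I.b i : ℝ)) ∈
          ({(maxColumnLength I.B * maxColumnLength I.N / |(I.B.det : ℝ)| *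
              (|(I.B.det : ℝ)| - 1)) • columnSum I.A} : Set (Fin 2 → ℝ)) + columnCone I.A)
      (fun I y => ∃ x : Fin (2 + I.k) → ℤ, y = ⟨2 + I.k, x⟩ ∧ 0 ≤ x ∧ I.A *ᵥ x = I.b) := by
  choose f h₀ h₁ h₂ using StackMachine.algorithm_spec
  exact ⟨fun a => ⟨2 + a.1.k, f a.1 a.2.1 a.2.2.1 a.2.2.2.1 a.2.2.2.2.2⟩,
    StackMachine.nonempty_computable_of_polyTime StackMachine.polyTime_algorithm
      fun a => h₂ a.1 a.2.1 a.2.2.1 a.2.2.2.1 a.2.2.2.2.2,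
    fun a => ⟨_, rfl, h₀ _ _ _ _ _, h₁ _ _ _ _ _⟩⟩
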